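/- For a graph $G$ and a function $\mathsf{rev}\colon V(G)\times\{1,\dots,k\}\to\mathbb{Q}_{\ge 0}$, the problem Max Partial $k$-Coloring asks for a set $X\subseteq V(G)$ and a proper $k$-coloring $c$ of the induced subgraph $G[X]$ such that $\sum_{v\in X}\mathsf{rev}(v,c(v))$ is maximum possible. The bull is the graph obtained from a triangle by attaching one pendant vertex to each of two of its vertices; the chair is the graph obtained from the claw $K_{1,3}$ by subdividing one edge once. A graph is (bull, chair)-free if neither of them is isomorphic to an induced subgraph of it. Theorem. There is an absolute constant $\tau$ such that for every $k\ge 1$ there is a (deterministic) algorithm which, given any (bull, chair)-free graph $G$ with $n$ vertices and a revenue function $\mathsf{rev}$, finds an optimum solution $(X,c)$ of Max Partial $k$-Coloring on $(G,\mathsf{rev})$ in time $n^{\tau k\omega}$ if $n\ge 2$ (and in at most $2^{\tau k}$ steps if $n\le 1$), where $\omega$ is the clique number of $G$. In other words, the problem is solvable in time $n^{O(k\omega)}$ on this class. Time is counted on a random-access machine whose arithmetic operations (additions and truncated subtractions of natural numbers, additions of revenue values, and comparisons) take constant time. -/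

import Mathlib

open scoped SimpleGraph

/-! ### The graphs and the optimization problem -/

/-- The bull: a triangle `0, 1, 2` with a pendant vertex `3` at `0` and a pendant vertex `4`
at `1`. -/
def bull : SimpleGraph (Fin 5) :=
  SimpleGraph.fromEdgeSet {s(0, 1), s(1, 2), s(0, 2), s(0, 3), s(1, 4)}

/-- The chair (or fork): the claw with centre `0` and leaves `1, 2, 3`, and one more vertex `4`
attached to the leaf `3`. -/
def chair : SimpleGraph (Fin 5) :=
  SimpleGraph.fromEdgeSet {s(0, 1), s(0, 2), s(0, 3), s(3, 4)}

/-- A feasible solution of Max Partial `k`-Coloring: a set `X` of vertices together with a proper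
`k`-coloring of the induced subgraph `G[X]`. -/
structure PartialColoring {V : Type*} (G : SimpleGraph V) (k : ℕ) where
  X : Finset V
  color : (G.induce (X : Set V)).Coloring (Fin k)

namespace PartialColoring

variable {V : Type*} {G : SimpleGraph V} {k : ℕ}

/-- The total revenue `∑ v ∈ X, rev (v, c v)`. -/
def revenue (rev : V → Fin k → ℚ≥0) (S : PartialColoring G k) : ℚ≥0 :=
  ∑ v ∈ S.X.attach, rev v (S.color ⟨v.1, v.2⟩)

/-- `S` has the largest revenue among all feasible solutions. -/
def IsOptimal (rev : V → Fin k → ℚ≥0) (S : PartialColoring G k) : Prop :=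
  ∀ S' : PartialColoring G k, S'.revenue rev ≤ S.revenue rev

end PartialColoring

/-! ### The machine model

A random-access machine, programmed in a structured language with recursive procedures. Its memory
consists of arrays of natural numbers and arrays of nonnegative rationals (numbered `0, 1, 2, …`,
every array indexed by the natural numbers; all array names in a program are literals, so that a
program uses only finitely many arrays) and of the local integer variables of the procedure being
executed. The only arithmetic is addition and truncated subtraction of natural numbers, and
addition of rationals; numbers of either kind can be compared. There is no multiplication,
so unit cost per operation is a realistic measure. -/

namespace RAM

/-- A memory configuration: the local variables, the integer arrays and the rational arrays. -/
structure State where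
  var : ℕ → ℕ
  nat : ℕ → ℕ → ℕ
  rat : ℕ → ℕ → ℚ≥0

/-- Integer expressions; `get a e` reads cell `e` of the integer array `a`. -/
inductive NExp
  | const (c : ℕ)
  | var (x : ℕ)
  | get (a : ℕ) (e : NExp)
  | add (e₁ e₂ : NExp)
  | sub (e₁ e₂ : NExp)

/-- The value of an integer expression. -/
def NExp.eval (s : State) : NExp → ℕ
  | const c => c
  | var x => s.var x
  | get a e => s.nat a (e.eval s)
  | add e₁ e₂ => e₁.eval s + e₂.eval s
  | sub e₁ e₂ => e₁.eval s - e₂.eval s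

/-- The number of operations performed to evaluate an integer expression. -/
def NExp.cost : NExp → ℕ
  | const _ => 1
  | var _ => 1
  | get _ e => e.cost + 1
  | add e₁ e₂ => e₁.cost + e₂.cost + 1
  | sub e₁ e₂ => e₁.cost + e₂.cost + 1

/-- Rational expressions; `get a e` reads cell `e` of the rational array `a`. -/
inductive QExp
  | zero
  | get (a : ℕ) (e : NExp)
  | add (q₁ q₂ : QExp)

/-- The value of a rational expression. -/
def QExp.eval (s : State) : QExp → ℚ≥0
  | zero => 0
  | get a e => s.rat a (e.eval s)
  | add q₁ q₂ => q₁.eval s + q₂.eval s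

/-- The number of operations performed to evaluate a rational expression. -/
def QExp.cost : QExp → ℕ
  | zero => 1
  | get _ e => e.cost + 1
  | add q₁ q₂ => q₁.cost + q₂.cost + 1

/-- Tests: strict comparison of two integers or of two rationals. -/
inductive Test
  | natLt (e₁ e₂ : NExp)
  | ratLt (q₁ q₂ : QExp)

/-- The truth value of a test. -/
def Test.eval (s : State) : Test → Prop
  | natLt e₁ e₂ => e₁.eval s < e₂.eval s
  | ratLt q₁ q₂ => q₁.eval s < q₂.eval s

/-- The number of operations performed to evaluate a test. -/
def Test.cost : Test → ℕ
  | natLt e₁ e₂ => e₁.cost + e₂.cost + 1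
  | ratLt q₁ q₂ => q₁.cost + q₂.cost + 1

/-- Statements. -/
inductive Stmt
  /-- do nothing -/
  | skip
  /-- `x := e` -/
  | set (x : ℕ) (e : NExp)
  /-- `a[i] := e` for an integer array `a` -/
  | put (a : ℕ) (i e : NExp)
  /-- `a[i] := q` for a rational array `a` -/
  | putRat (a : ℕ) (i : NExp) (q : QExp)
  /-- `c; d` -/
  | seq (c d : Stmt)
  /-- `if b then c else d` -/
  | ite (b : Test) (c d : Stmt)
  /-- `while b do c` -/
  | loop (b : Test) (c : Stmt)
  /-- `x := p(args)`: call procedure number `p`. Arguments are passed by value in the first local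
  variables of the callee, whose other local variables start at `0`; its result is the final value
  of its variable `0`. The arrays are global. -/
  | call (x p : ℕ) (args : List NExp)

/-- A program: a finite list of procedures, which may call each other and themselves, and a main
statement. -/
structure Program where
  procs : List Stmt
  main : Stmt

/-- `Exec procs c s t s'`: with the procedures `procs`, the statement `c`, started in `s`, halts
in `s'` after exactly `t` operations. -/
inductive Exec (procs : List Stmt) : Stmt → State → ℕ → State → Prop
  | skip (s : State) : Exec procs .skip s 1 s
  | set (x : ℕ) (e : NExp) (s : State) :
      Exec procs (.set x e) s (e.cost + 1) { s with var := Function.update s.var x (e.eval s) }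
  | put (a : ℕ) (i e : NExp) (s : State) :
      Exec procs (.put a i e) s (i.cost + e.cost + 1)
        { s with nat := Function.update s.nat a (Function.update (s.nat a) (i.eval s) (e.eval s)) }
  | putRat (a : ℕ) (i : NExp) (q : QExp) (s : State) :
      Exec procs (.putRat a i q) s (i.cost + q.cost + 1)
        { s with rat := Function.update s.rat a (Function.update (s.rat a) (i.eval s) (q.eval s)) }
  | seq {c d : Stmt} {s s' s'' : State} {t t' : ℕ} :
      Exec procs c s t s' → Exec procs d s' t' s'' → Exec procs (.seq c d) s (t + t') s''
  | iteTrue {b : Test} {c d : Stmt} {s s' : State} {t : ℕ} :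
      b.eval s → Exec procs c s t s' → Exec procs (.ite b c d) s (b.cost + t) s'
  | iteFalse {b : Test} {c d : Stmt} {s s' : State} {t : ℕ} :
      ¬ b.eval s → Exec procs d s t s' → Exec procs (.ite b c d) s (b.cost + t) s'
  | loopTrue {b : Test} {c : Stmt} {s s' s'' : State} {t t' : ℕ} :
      b.eval s → Exec procs c s t s' → Exec procs (.loop b c) s' t' s'' →
        Exec procs (.loop b c) s (b.cost + t + t') s''
  | loopFalse {b : Test} {c : Stmt} {s : State} :
      ¬ b.eval s → Exec procs (.loop b c) s b.cost s
  | call {x p : ℕ} {args : List NExp} {body : Stmt} {s s' : State} {t : ℕ} :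
      procs[p]? = some body →
      Exec procs body { s with var := fun i => (args.map (NExp.eval s)).getD i 0 } t s' →
        Exec procs (.call x p args) s ((args.map NExp.cost).sum + t + 1)
          { s' with var := Function.update s.var x (s'.var 0) }

/-- The program `P`, started in `s`, halts in `s'` after exactly `t` operations. -/
def Program.Run (P : Program) (s : State) (t : ℕ) (s' : State) : Prop :=
  Exec P.procs P.main s t s'

end RAM

/-! ### Input and output -/

open Classical in
/-- The initial memory for the instance `(G, rev)`: variable `0` holds the number `n` of vertices,
cell `u * n + v` of the integer array `0` holds `1` if `u` and `v` are adjacent and `0` otherwise,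
cell `v * k + c` of the rational array `0` holds `rev v c`, and everything else is `0`. -/
noncomputable def inputState {n k : ℕ} (G : SimpleGraph (Fin n)) (rev : Fin n → Fin k → ℚ≥0) :
    RAM.State where
  var x := if x = 0 then n else 0
  nat a i := if a = 0 ∧ ∃ u v : Fin n, i = u * n + v ∧ G.Adj u v then 1 else 0
  rat a i :=
    if h : a = 0 ∧ i < n * k then
      rev (Fin.divNat (⟨i, h.2⟩ : Fin (n * k))) (Fin.modNat (⟨i, h.2⟩ : Fin (n * k)))
    else 0

/-- The final memory `s` contains the solution `S`: cell `v` of the integer array `1` holds `0` if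
`v` is not in `X`, and `c + 1` if `v` is in `X` and has color `c ∈ {0, …, k - 1}`. -/
def IsOutput {n k : ℕ} {G : SimpleGraph (Fin n)} (s : RAM.State) (S : PartialColoring G k) : Prop :=
  ∀ v : Fin n,
    (v ∉ S.X → s.nat 1 v = 0) ∧ ∀ h : v ∈ S.X, s.nat 1 v = (S.color ⟨v, h⟩ : ℕ) + 1

/-!
# Max Partial `k`-Coloring on (bull, chair)-free graphs

**The structure behind the algorithm.** A graph is (bull, chair)-free iff the two ends of every
induced path `a - b - c - d` dominate all neighbours of `b` and of `c` (`EndsDominate`; only the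
direction `endsDominate_of_free` is needed). From this follows a dichotomy for connected graphs
(`hasTwinSeparator_or_exists_classes`):

* either deleting two classes of true twins leaves components with at most half of the vertices,
* or the vertices fall into classes such that every class has a vertex outside that is adjacent to
  all of it, and in every maximal independent set at most three vertices already dominate every edge
  that joins different classes.

If the complement is disconnected, the classes are the two sides of a complete cut. Otherwise two
vertices are in the same class if a proper module contains both. An induced path on six vertices
extends to a module that is a clique blow-up of a long path or cycle
(`exists_module_of_inducedP6`). If this module is the whole graph, a weighted median of the path
gives the separator. If it never is, consider a vertex `u` of the independent set. The edges
between different classes that `u` fails to dominate lie in one component `C` of the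
non-neighbours of `u` (`IsAnticomponent.mem_of_not_sameModule`), and two further vertices of the
independent set dominate them: they are found from a neighbour of `u` that is mixed on `C` and has
as few neighbours there as possible (`exists_triple_of_maximal_independent`).

**The algorithm.** A partial coloring is an independent set of pairs (vertex, color) in the
conflict graph, in which two pairs conflict if they have the same vertex, or the same color and
adjacent vertices. To find the optimum for a connected set of pairs, one looks for two twin classes
that form a balanced separator. If there are such, one guesses the solution on them; the guesses
are few, since a twin class is a clique and has at most `k ω` pairs. Otherwise one guesses three
vertices of each color (`exists_guess`). For the right guess, the components of what remains have
at most half of the vertices in the first case, and are dominated by a vertex in the second case,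
so that their clique number is smaller. Components that violate this are skipped, hence every
guess gives a lower bound, and the right one gives the optimum. Halving happens at most
`log₂ n + 1` times and passing to a smaller clique number at most `ω` times along a branch of the
recursion, which with `2 ^ (2 k ω)` and `(n + 1) ^ (3 k)` guesses, respectively, amounts to
`n ^ O(k ω)` operations (`RAM.solves_of_cliqueLE`, `steps_le_pow`). An optimum solution is found
by deleting, one after the other, the pairs without which the optimum stays the same.

**The program.** The machine is treated by computing weakest preconditions: `RAM.Runs` says that a
statement halts with a certain postcondition on the number of operations and the final state. Each
procedure has one lemma that bounds its running time, says which cells it may change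
(`RAM.Frame`), and describes its result.
-/

section Structure

/-! ### Cut-connected sets -/

/-- A set `C` is cut-connected for the relation `r` if every partition of `C` into two nonempty
parts is crossed by `r`. For adjacency this means that `C` induces a connected graph, or is empty.
It is the only notion of connectivity that is used, for graphs, complements, and the conflict
graph alike. -/
def CutConnected {α : Type*} (r : α → α → Prop) (C : Set α) : Prop :=
  ∀ Y : Set α, (∃ c ∈ C, c ∈ Y) → (∃ c ∈ C, c ∉ Y) → ∃ c ∈ C, c ∈ Y ∧ ∃ d ∈ C, d ∉ Y ∧ r c d

/-- The elements that can be reached from `e` by `r`-steps into `P`. -/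
def reachSet {α : Type*} (r : α → α → Prop) (P : Set α) (e : α) : Set α :=
  {w | Relation.ReflTransGen (fun a b => r a b ∧ b ∈ P) e w}

theorem self_mem_reachSet {α : Type*} (r : α → α → Prop) (P : Set α) (e : α) :
    e ∈ reachSet r P e := Relation.ReflTransGen.refl

theorem reachSet_subset {α : Type*} {r : α → α → Prop} {P : Set α} {e : α} (he : e ∈ P) :
    reachSet r P e ⊆ P := by
  intro w hw
  induction hw with
  | refl => exact he
  | tail _ h _ => exact h.2

theorem reachSet_closed {α : Type*} {r : α → α → Prop} {P : Set α} {e a b : α}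
    (ha : a ∈ reachSet r P e) (hab : r a b) (hb : b ∈ P) : b ∈ reachSet r P e :=
  Relation.ReflTransGen.tail ha ⟨hab, hb⟩

theorem reachSet_cutConnected {α : Type*} {r : α → α → Prop} (hr : ∀ a b, r a b → r b a)
    (P : Set α) (e : α) : CutConnected r (reachSet r P e) := by
  have key : ∀ Y : Set α, e ∈ Y → (∃ c ∈ reachSet r P e, c ∉ Y) →
      ∃ c ∈ reachSet r P e, c ∈ Y ∧ ∃ d ∈ reachSet r P e, d ∉ Y ∧ r c d := by
    rintro Y he ⟨c, hc, hcY⟩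
    by_contra hcon
    push Not at hcon
    have : ∀ w, Relation.ReflTransGen (fun a b => r a b ∧ b ∈ P) e w → w ∈ Y := by
      intro w hw
      induction hw with
      | refl => exact he
      | tail h1 h2 ih =>
        by_contra hn
        exact hcon _ h1 ih _ (Relation.ReflTransGen.tail h1 h2) hn h2.1
    exact hcY (this c hc)
  rintro Y hY hnY
  by_cases he : e ∈ Y
  · exact key Y he hnY
  · obtain ⟨c, hc, hcY, d, hd, hdY, hcd⟩ := key Yᶜ he (by
      obtain ⟨c, hc, hcY⟩ := hY
      exact ⟨c, hc, fun h => h hcY⟩)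
    exact ⟨d, hd, by simpa using hdY, c, hc, hcY, hr _ _ hcd⟩

/-- A cut-connected set inside `P` stays within the part of `P` reachable from any of its points. -/
theorem CutConnected.subset_reachSet {α : Type*} {r : α → α → Prop} {C P : Set α}
    (hC : CutConnected r C) (hCP : C ⊆ P) {e : α} (he : e ∈ C) : C ⊆ reachSet r P e := by
  by_contra hcon
  obtain ⟨c, hc, hn⟩ := Set.not_subset.mp hcon
  obtain ⟨a, _, haY, d, hd, hdY, had⟩ :=
    hC (reachSet r P e) ⟨e, he, self_mem_reachSet r P e⟩ ⟨c, hc, hn⟩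
  exact hdY (reachSet_closed haY had (hCP hd))

/-! ### The dominating ends of induced paths on four vertices -/

variable {V : Type*} {G : SimpleGraph V}

/-- The common reformulation of bull-freeness and chair-freeness: the two ends of an induced path
`a - b - c - d` dominate all neighbours of its two inner vertices. -/
def EndsDominate (G : SimpleGraph V) : Prop :=
  ∀ ⦃a b c d : V⦄, G.Adj a b → G.Adj b c → G.Adj c d → ¬ G.Adj a c → ¬ G.Adj b d → ¬ G.Adj a d →
    ∀ ⦃x : V⦄, (G.Adj x b ∨ G.Adj x c) → G.Adj x a ∨ G.Adj x d ∨ x = a ∨ x = d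

theorem endsDominate_of_free (hb : ¬ bull ⊴ G) (hc : ¬ chair ⊴ G) : EndsDominate G := by
  intro a b c d hab hbc hcd hac hbd had x hx
  by_contra hcon
  push Not at hcon
  obtain ⟨hxa, hxd, hxa', hxd'⟩ := hcon
  have hba := hab.symm
  have hcb := hbc.symm
  have hdc := hcd.symm
  have hca : ¬ G.Adj c a := fun h => hac h.symm
  have hdb : ¬ G.Adj d b := fun h => hbd h.symm
  have hda : ¬ G.Adj d a := fun h => had h.symm
  have hax : ¬ G.Adj a x := fun h => hxa h.symm
  have hdx : ¬ G.Adj d x := fun h => hxd h.symm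
  have nab := hab.ne
  have nbc := hbc.ne
  have ncd := hcd.ne
  have nac : a ≠ c := by rintro rfl; exact had hcd
  have nbd : b ≠ d := by rintro rfl; exact had hab
  have nad : a ≠ d := by rintro rfl; exact hbd hba
  have nxb : x ≠ b := by rintro rfl; exact hxa hba
  have nxc : x ≠ c := by rintro rfl; exact hxd hcd
  have mk : ∀ (H : SimpleGraph (Fin 5)) (v : Fin 5 → V), Function.Injective v →
      (∀ i j, G.Adj (v i) (v j) ↔ H.Adj i j) → H ⊴ G := fun H v hv h =>
    ⟨⟨⟨v, hv⟩, h _ _⟩⟩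
  -- With triangle `b c x` this is a bull; otherwise a chair centred at `b` or at `c`.
  by_cases h1 : G.Adj x b <;> by_cases h2 : G.Adj x c
  · have h1' := h1.symm
    have h2' := h2.symm
    refine hb (mk bull ![b, c, x, a, d] ?_ ?_)
    · intro i j h
      fin_cases i <;> fin_cases j <;> simp_all
    · intro i j
      fin_cases i <;> fin_cases j <;> simp [bull, *]
  · have h1' := h1.symm
    have h2' : ¬ G.Adj c x := fun h => h2 h.symm
    refine hc (mk chair ![b, a, x, c, d] ?_ ?_)
    · intro i j h
      fin_cases i <;> fin_cases j <;> simp_all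
    · intro i j
      fin_cases i <;> fin_cases j <;> simp [chair, *]
  · have h2' := h2.symm
    have h1' : ¬ G.Adj b x := fun h => h1 h.symm
    refine hc (mk chair ![c, d, x, b, a] ?_ ?_)
    · intro i j h
      fin_cases i <;> fin_cases j <;> simp_all
    · intro i j
      fin_cases i <;> fin_cases j <;> simp [chair, *]
  · exact hx.elim h1 h2

/-! ### Long induced paths -/

/-- `W` is a clique blow-up of a path with at least six vertices: the labels `lo, …, hi` name the
vertices of the path, and two vertices are adjacent iff their labels differ by at most one. -/
structure IsPathBlowup (G : SimpleGraph V) (W : Finset V) (f : V → ℤ) (lo hi : ℤ) : Prop where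
  adj : ∀ x ∈ W, ∀ y ∈ W, G.Adj x y ↔ x ≠ y ∧ f x ≤ f y + 1 ∧ f y ≤ f x + 1
  range : ∀ x ∈ W, lo ≤ f x ∧ f x ≤ hi
  surj : ∀ i, lo ≤ i → i ≤ hi → ∃ x ∈ W, f x = i
  long : lo + 5 ≤ hi

theorem IsPathBlowup.neg {W : Finset V} {f : V → ℤ} {lo hi : ℤ} (h : IsPathBlowup G W f lo hi) :
    IsPathBlowup G W (fun x => - f x) (-hi) (-lo) where
  adj x hx y hy := by
    rw [h.adj x hx y hy]
    refine and_congr_right fun _ => ?_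
    constructor <;> rintro ⟨h1, h2⟩ <;> constructor <;> linarith
  range x hx := by have := h.range x hx; constructor <;> linarith
  surj i h1 h2 := by
    obtain ⟨x, hx, hf⟩ := h.surj (-i) (by linarith) (by linarith)
    exact ⟨x, hx, by simp only [hf]; ring⟩
  long := by have := h.long; linarith

/-- An outside vertex is adjacent to all or to none of the vertices with a given label. -/
theorem IsPathBlowup.adj_of_label_eq (hG : EndsDominate G) {W : Finset V} {f : V → ℤ} {lo hi : ℤ}
    (h : IsPathBlowup G W f lo hi) {t x x' : V} (hx : x ∈ W) (hx' : x' ∈ W)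
    (hf : f x = f x') (ht : t ∉ W) (htx : G.Adj t x) : G.Adj t x' := by
  -- By symmetry there are three more labels above that of `x`. The vertices with these labels, or
  -- with the labels around them, form induced paths with `t` for which `hG` gives a contradiction.
  have aux : ∀ {f : V → ℤ} {lo hi : ℤ}, IsPathBlowup G W f lo hi → f x = f x' → f x + 3 ≤ hi →
      G.Adj t x' := by
    clear hf h f lo hi
    intro f lo hi h hf hhi
    by_contra htx'
    have hlo := (h.range x hx).1
    have hlong := h.long
    obtain ⟨y1, hy1, f1⟩ := h.surj (f x + 1) (by linarith) (by linarith)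
    obtain ⟨y2, hy2, f2⟩ := h.surj (f x + 2) (by linarith) (by linarith)
    obtain ⟨y3, hy3, f3⟩ := h.surj (f x + 3) (by linarith) (by linarith)
    have ad : ∀ a ∈ W, ∀ b ∈ W, f b = f a + 1 → G.Adj a b := fun a ha b hb hab =>
      (h.adj a ha b hb).2 ⟨by rintro rfl; omega, by omega, by omega⟩
    have nad : ∀ a ∈ W, ∀ b ∈ W, f a + 2 ≤ f b → ¬ G.Adj a b := fun a ha b hb hab hc => by
      have := (h.adj a ha b hb).1 hc; omega
    have nn : ∀ a ∈ W, t ≠ a := fun a ha h => ht (h ▸ ha)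
    have hxx' : G.Adj x x' := (h.adj x hx x' hx').2
      ⟨by rintro rfl; exact htx' htx, by omega, by omega⟩
    have axy := ad x hx y1 hy1 f1
    have axy' := ad x' hx' y1 hy1 (by omega)
    have a12 := ad y1 hy1 y2 hy2 (by omega)
    have a23 := ad y2 hy2 y3 hy3 (by omega)
    have n13 := nad y1 hy1 y3 hy3 (by omega)
    have nx2 := nad x hx y2 hy2 (by omega)
    have nx2' := nad x' hx' y2 hy2 (by omega)
    have nx3 := nad x hx y3 hy3 (by omega)
    have nx3' := nad x' hx' y3 hy3 (by omega)
    have s1 := @hG t x y1 y2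
    have s2 := @hG x' y1 y2 y3
    have hsym := G.adj_comm
    rcases le_or_gt (f x + 4) hi with h4 | h4
    · obtain ⟨y4, hy4, f4⟩ := h.surj (f x + 4) (by linarith) (by linarith)
      have a34 := ad y3 hy3 y4 hy4 (by omega)
      have n24 := nad y2 hy2 y4 hy4 (by omega)
      have n14 := nad y1 hy1 y4 hy4 (by omega)
      have nx4 := nad x hx y4 hy4 (by omega)
      have nx4' := nad x' hx' y4 hy4 (by omega)
      have s3 := @hG y1 y2 y3 y4
      have s4 := @hG x' x t y4
      have s5 := @hG x t y3 y4
      have s6 := @hG x' y1 t y4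
      clear h hG ad nad
      grind
    · obtain ⟨z, hz, fz⟩ := h.surj (f x - 1) (by linarith) (by linarith)
      obtain ⟨z2, hz2, fz2⟩ := h.surj (f x - 2) (by linarith) (by linarith)
      have a1 := ad z2 hz2 z hz (by omega)
      have a2 := ad z hz x hx (by omega)
      have a3 := ad z hz x' hx' (by omega)
      have m1 := nad z hz y1 hy1 (by omega)
      have m2 := nad z hz y2 hy2 (by omega)
      have m3 := nad z hz y3 hy3 (by omega)
      have m4 := nad z2 hz2 y1 hy1 (by omega)
      have m5 := nad z2 hz2 y2 hy2 (by omega)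
      have m6 := nad z2 hz2 y3 hy3 (by omega)
      have m7 := nad z2 hz2 x hx (by omega)
      have m8 := nad z2 hz2 x' hx' (by omega)
      have s3 := @hG z x t y3
      have s4 := @hG z2 z x' y1
      have s5 := @hG x' x t z2
      have s6 := @hG z2 z t y3
      have s7 := @hG z2 t y3 y2
      clear h hG ad nad
      grind
  have hlong := h.long
  rcases le_or_gt (f x + 3) hi with h3 | h3
  · exact aux h hf h3
  · exact aux h.neg (by simp [hf]) (by linarith)

end Structure

section LongPaths
variable {V : Type*} {G : SimpleGraph V}

/-- `p₁ - p₂ - p₃ - p₄ - p₅ - p₆` is an induced path. -/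
structure IsInducedP6 (G : SimpleGraph V) (p₁ p₂ p₃ p₄ p₅ p₆ : V) : Prop where
  a12 : G.Adj p₁ p₂
  a23 : G.Adj p₂ p₃
  a34 : G.Adj p₃ p₄
  a45 : G.Adj p₄ p₅
  a56 : G.Adj p₅ p₆
  n13 : ¬ G.Adj p₁ p₃
  n14 : ¬ G.Adj p₁ p₄
  n15 : ¬ G.Adj p₁ p₅
  n16 : ¬ G.Adj p₁ p₆
  n24 : ¬ G.Adj p₂ p₄
  n25 : ¬ G.Adj p₂ p₅
  n26 : ¬ G.Adj p₂ p₆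
  n35 : ¬ G.Adj p₃ p₅
  n36 : ¬ G.Adj p₃ p₆
  n46 : ¬ G.Adj p₄ p₆

theorem IsInducedP6.reverse {p₁ p₂ p₃ p₄ p₅ p₆ : V} (h : IsInducedP6 G p₁ p₂ p₃ p₄ p₅ p₆) :
    IsInducedP6 G p₆ p₅ p₄ p₃ p₂ p₁ := by
  obtain ⟨h1, h2, h3, h4, h5, h6, h7, h8, h9, h10, h11, h12, h13, h14, h15⟩ := h
  constructor <;> rw [G.adj_comm] <;> assumption

/-- On an induced path with six vertices, no vertex other than
`p₂` and `p₃` is adjacent to `p₁` and `p₃` but not to `p₂`, or to `p₂` and `p₄` but not to `p₃`. -/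
theorem IsInducedP6.no_gap (hG : EndsDominate G) {p₁ p₂ p₃ p₄ p₅ p₆ : V}
    (h : IsInducedP6 G p₁ p₂ p₃ p₄ p₅ p₆) {t : V} (n2 : p₂ ≠ t) (n3 : p₃ ≠ t) :
    ¬ (G.Adj t p₁ ∧ ¬ G.Adj t p₂ ∧ G.Adj t p₃) ∧ ¬ (G.Adj t p₂ ∧ ¬ G.Adj t p₃ ∧ G.Adj t p₄) := by
  obtain ⟨h1, h2, h3, h4, h5, h6, h7, h8, h9, h10, h11, h12, h13, h14, h15⟩ := h
  have hsym := G.adj_comm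
  constructor
  · rintro ⟨t1, t2, t3⟩
    have s1 := @hG p₂ p₃ p₄ p₅ h2 h3 h4 h10 h13 h11 t (.inl t3)
    have s2 := @hG p₁ t p₅ p₆
    have s3 := @hG p₄ p₃ t p₆
    have s4 := @hG p₂ p₁ t p₆
    grind
  · rintro ⟨t1, t2, t3⟩
    have s1 := @hG p₃ p₄ p₅ p₆ h3 h4 h5 h13 h15 h14 t (.inl t3)
    have s2 := @hG p₁ p₂ t p₆
    have s3 := @hG p₁ t p₄ p₃
    grind

/-- If the vertex `t` outside a path blow-up is adjacent to the vertices with an inner label `i`,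
but not to those with label `i + 1`, then its neighbours are those with the labels `i - 2`, `i - 1`
and `i`. So `t` is attached like a vertex with label `i - 1`. Here `L` is the set of the labels of
the neighbours of `t`. -/
theorem IsPathBlowup.label_of_boundary (hG : EndsDominate G) {W : Finset V} {f : V → ℤ}
    {lo hi : ℤ} (h : IsPathBlowup G W f lo hi) {t : V} (ht : t ∉ W) {L : ℤ → Prop}
    (hL : ∀ x ∈ W, G.Adj t x ↔ L (f x)) {i : ℤ} (hlo : lo < i) (hhi : i + 1 ≤ hi)
    (hi1 : L i) (hi2 : ¬ L (i + 1)) :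
    ∀ x ∈ W, G.Adj t x ↔ f x ≤ i ∧ i - 2 ≤ f x := by
  have hlong := h.long
  have : Nonempty V := ⟨t⟩
  choose! p hpW hpf using h.surj
  have hp : ∀ j, lo ≤ j → j ≤ hi → (G.Adj t (p j) ↔ L j) := fun j h1 h2 => by
    rw [hL _ (hpW j h1 h2), hpf j h1 h2]
  have ad : ∀ a, lo ≤ a → a + 1 ≤ hi → G.Adj (p a) (p (a + 1)) := fun a h1 h2 => by
    refine (h.adj _ (hpW a (by omega) (by omega)) _ (hpW (a + 1) (by omega) (by omega))).2
      ⟨fun he => ?_, ?_, ?_⟩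
    · have := congrArg f he
      rw [hpf _ (by omega) (by omega), hpf _ (by omega) (by omega)] at this
      omega
    · rw [hpf _ (by omega) (by omega), hpf _ (by omega) (by omega)]; omega
    · rw [hpf _ (by omega) (by omega), hpf _ (by omega) (by omega)]
  have nad : ∀ a b, lo ≤ a → a + 2 ≤ b → b ≤ hi → ¬ G.Adj (p a) (p b) := fun a b h1 h2 h3 hc => by
    have := (h.adj _ (hpW a (by omega) (by omega)) _ (hpW b (by omega) (by omega))).1 hc
    rw [hpf _ (by omega) (by omega), hpf _ (by omega) (by omega)] at this
    omega
  have nt : ∀ a, lo ≤ a → a ≤ hi → p a ≠ t := fun a h1 h2 he => ht (he ▸ hpW a h1 h2)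
  have ne : ∀ a b, lo ≤ a → a < b → b ≤ hi → p a ≠ p b := fun a b h1 h2 h3 he => by
    have := congrArg f he
    rw [hpf _ (by omega) (by omega), hpf _ (by omega) (by omega)] at this
    omega
  have hsym := G.adj_comm
  -- on four consecutive labels, a neighbour inside forces a neighbour at one of the ends
  have four : ∀ j, lo ≤ j → j + 3 ≤ hi → L (j + 1) ∨ L (j + 2) → L j ∨ L (j + 3) := by
    intro j h1 h2 h3
    have a1 := ad j (by omega) (by omega)
    have a2 := ad (j + 1) (by omega) (by omega)
    have a3 := ad (j + 1 + 1) (by omega) (by omega)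
    have e2 : j + 1 + 1 = j + 2 := by ring
    have e3 : j + 2 + 1 = j + 3 := by ring
    rw [e2] at a2 a3; rw [e3] at a3
    have n1 := nad j (j + 2) (by omega) (by omega) (by omega)
    have n2 := nad (j + 1) (j + 3) (by omega) (by omega) (by omega)
    have n3 := nad j (j + 3) (by omega) (by omega) (by omega)
    rw [← hp _ (by omega) (by omega), ← hp _ (by omega) (by omega)] at h3 ⊢
    rcases hG a1 a2 a3 n1 n2 n3 h3 with h | h | h | h
    · exact .inl h
    · exact .inr h
    · exact absurd h.symm (nt _ (by omega) (by omega))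
    · exact absurd h.symm (nt _ (by omega) (by omega))
  -- six consecutive labels rule out the pattern "adjacent, nonadjacent, adjacent"
  have gap : ∀ j, lo ≤ j → j + 2 ≤ hi → L j → ¬ L (j + 1) → L (j + 2) → False := by
    have win : ∀ s, lo ≤ s → s + 5 ≤ hi →
        IsInducedP6 G (p s) (p (s + 1)) (p (s + 2)) (p (s + 3)) (p (s + 4)) (p (s + 5)) := by
      intro s h1 h2
      have e : ∀ a b, b = a + 1 → lo ≤ a → b ≤ hi → G.Adj (p a) (p b) := by
        rintro a b rfl h3 h4
        exact ad a h3 h4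
      constructor
      any_goals exact e _ _ (by ring) (by omega) (by omega)
      all_goals exact nad _ _ (by omega) (by omega) (by omega)
    intro j h1 h2 l0 l1 l2
    rw [← hp _ (by omega) (by omega)] at l0 l1 l2
    rcases le_or_gt (j + 5) hi with h5 | h5
    · exact ((win j h1 h5).no_gap hG
          (nt _ (by omega) (by omega)) (nt _ (by omega) (by omega))).1 ⟨l0, l1, l2⟩
    · obtain rfl | rfl | rfl : j = hi - 5 + 1 ∨ j = hi - 5 + 2 ∨ j = hi - 5 + 3 := by omega
      · have e : hi - 5 + 1 + 1 = hi - 5 + 2 ∧ hi - 5 + 1 + 2 = hi - 5 + 3 := by omega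
        rw [e.1] at l1; rw [e.2] at l2
        exact ((win (hi - 5) (by omega) (by omega)).no_gap hG
          (nt _ (by omega) (by omega)) (nt _ (by omega) (by omega))).2 ⟨l0, l1, l2⟩
      · have e : hi - 5 + 2 + 1 = hi - 5 + 3 ∧ hi - 5 + 2 + 2 = hi - 5 + 4 := by omega
        rw [e.1] at l1; rw [e.2] at l2
        exact ((win (hi - 5) (by omega) (by omega)).reverse.no_gap hG
          (nt _ (by omega) (by omega)) (nt _ (by omega) (by omega))).2 ⟨l2, l1, l0⟩
      · have e : hi - 5 + 3 + 1 = hi - 5 + 4 ∧ hi - 5 + 3 + 2 = hi - 5 + 5 := by omega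
        rw [e.1] at l1; rw [e.2] at l2
        exact ((win (hi - 5) (by omega) (by omega)).reverse.no_gap hG
          (nt _ (by omega) (by omega)) (nt _ (by omega) (by omega))).1 ⟨l2, l1, l0⟩
  have e1 : i - 1 + 1 = i := by ring
  have e2 : i - 2 + 1 = i - 1 := by ring
  have e3 : i - 2 + 2 = i := by ring
  have e4 : i - 2 + 3 = i + 1 := by ring
  have e5 : i - 1 + 2 = i + 1 := by ring
  have e6 : i + 1 + 1 = i + 2 := by ring
  have hi3 : i + 2 ≤ hi → ¬ L (i + 2) := fun h1 h2 => gap i (by omega) (by omega) hi1 hi2 h2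
  have hm1 : L (i - 1) := by
    rcases le_or_gt (i + 2) hi with h2 | h2
    · have a1 := ad i (by omega) (by omega)
      have a2 := ad (i + 1) (by omega) (by omega)
      have a0 := ad (i - 1) (by omega) (by omega)
      rw [e6] at a2; rw [e1] at a0
      have := hi3 h2
      have n3 := nad i (i + 2) (by omega) (by omega) (by omega)
      have n4 := nad (i - 1) (i + 2) (by omega) (by omega) (by omega)
      rw [← hp _ (by omega) (by omega)] at hi1 hi2 this ⊢
      rcases hG hi1 a1 a2 hi2 n3 this (.inl a0) with h | h | h | h
      · exact h.symm
      · exact absurd h n4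
      · exact absurd h (nt _ (by omega) (by omega))
      · exact absurd h (ne _ _ (by omega) (by omega) (by omega))
    · have h3 : L (i - 2) := by
        have := four (i - 2) (by omega) (by omega) (.inr (by rwa [e3]))
        rw [e4] at this
        exact this.resolve_right hi2
      by_contra hn
      exact gap (i - 2) (by omega) (by omega) h3 (by rwa [e2]) (by rwa [e3])
  have hm2 : lo ≤ i - 2 → L (i - 2) := fun h2 => by
    have := four (i - 2) (by omega) (by omega) (.inr (by rwa [e3]))
    rw [e4] at this
    exact this.resolve_right hi2
  intro x hx
  rw [hL x hx]
  obtain ⟨hx1, hx2⟩ := h.range x hx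
  generalize f x = j at hx1 hx2 ⊢
  constructor
  · intro hj
    by_contra hcon
    have hj1 : j ≠ i + 1 := by rintro rfl; exact hi2 hj
    have hj2 : j ≠ i + 2 := by rintro rfl; exact hi3 hx2 hj
    rw [← hp _ (by omega) (by omega)] at hj hi1 hi2 hm1
    have n1 : ¬ G.Adj (p j) (p i) ∧ ¬ G.Adj (p j) (p (i + 1)) ∧ ¬ G.Adj (p (i - 1)) (p j) ∧
        p (i - 1) ≠ p j := by
      rcases lt_or_ge j i with h1 | h1
      · exact ⟨nad _ _ (by omega) (by omega) (by omega), nad _ _ (by omega) (by omega) (by omega),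
          fun h => nad _ _ (by omega) (by omega) (by omega) h.symm,
          (ne _ _ (by omega) (by omega) (by omega)).symm⟩
      · exact ⟨fun h => nad _ _ (by omega) (by omega) (by omega) h.symm,
          fun h => nad _ _ (by omega) (by omega) (by omega) h.symm,
          nad _ _ (by omega) (by omega) (by omega),
          (ne _ _ (by omega) (by omega) (by omega))⟩
    have a1 := ad i (by omega) (by omega)
    rcases hG hj.symm hi1 a1 n1.1 hi2 n1.2.1 (.inl hm1.symm) with h | h | h | h
    · exact n1.2.2.1 h
    · exact nad _ _ (by omega) (by omega) (by omega) h
    · exact n1.2.2.2 h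
    · exact absurd h (ne _ _ (by omega) (by omega) (by omega))
  · rintro ⟨h1, h2⟩
    obtain rfl | rfl | rfl : j = i ∨ j = i - 1 ∨ j = i - 2 := by omega
    · exact hi1
    · exact hm1
    · exact hm2 hx1
end LongPaths

section Separators

/-! ### Modules and balanced separators -/
variable {V : Type*} {G : SimpleGraph V}

/-- `M` is a module: a vertex outside `M` is adjacent to all of `M` or to nothing in `M`. -/
def IsModule (G : SimpleGraph V) (M : Set V) : Prop :=
  ∀ v ∉ M, ∀ x ∈ M, ∀ y ∈ M, G.Adj v x → G.Adj v y

/-- `a` and `c` have the same closed neighbourhood. -/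
def IsTwin (G : SimpleGraph V) (a c : V) : Prop :=
  ∀ z, (z = a ∨ G.Adj a z) ↔ (z = c ∨ G.Adj c z)

/-- Deleting the twin classes of two vertices leaves only components with at most half of the
vertices. -/
def HasTwinSeparator (G : SimpleGraph V) [Fintype V] : Prop :=
  ∃ a b, ∀ C : Finset V, CutConnected G.Adj (C : Set V) →
    (∀ c ∈ C, ¬ IsTwin G a c ∧ ¬ IsTwin G b c) → 2 * C.card ≤ Fintype.card V

/-- An outside vertex of a path blow-up that cannot be enlarged is adjacent to all of it, to
nothing, or exactly to the vertices with the first and the last label; in every other case it could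
be added to the blow-up, inside or at one of the ends. -/
theorem IsPathBlowup.attach_of_maximal (hG : EndsDominate G) {W : Finset V} {f : V → ℤ}
    {lo hi : ℤ} (h : IsPathBlowup G W f lo hi)
    (hmax : ∀ (W' : Finset V) f' lo' hi', IsPathBlowup G W' f' lo' hi' → W ⊆ W' → W' ⊆ W)
    {t : V} (ht : t ∉ W) :
    (∀ x ∈ W, G.Adj t x) ∨ (∀ x ∈ W, ¬ G.Adj t x) ∨
      (∀ x ∈ W, G.Adj t x ↔ f x = lo ∨ f x = hi) := by
  classical
  have hlong := h.long
  -- the labels of the neighbours of `t`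
  set L : ℤ → Prop := fun j => ∃ x ∈ W, f x = j ∧ G.Adj t x with hLdef
  have hL : ∀ x ∈ W, G.Adj t x ↔ L (f x) := fun x hx =>
    ⟨fun hx' => ⟨x, hx, rfl, hx'⟩, fun ⟨y, hy, hyf, hty⟩ => h.adj_of_label_eq hG hy hx hyf ht hty⟩
  -- by maximality, `t` is not attached like a vertex with label `j`, where `j` may be a new end
  have ext : ∀ j, lo - 1 ≤ j → j ≤ hi + 1 → ¬ ∀ x ∈ W, G.Adj t x ↔ f x ≤ j + 1 ∧ j - 1 ≤ f x := by
    intro j hj1 hj2 hj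
    have hne : ∀ x ∈ W, x ≠ t := fun x hx he => ht (he ▸ hx)
    have hb : IsPathBlowup G (insert t W) (Function.update f t j) (min lo j) (max hi j) := by
      constructor
      · intro x hx₀ y hy₀
        rcases Finset.mem_insert.1 hx₀ with rfl | hx <;>
          rcases Finset.mem_insert.1 hy₀ with rfl | hy
        · simp
        · rw [Function.update_self, Function.update_of_ne (hne y hy), hj y hy]
          have := (hne y hy).symm
          constructor
          · rintro ⟨h1, h2⟩; exact ⟨this, by omega, by omega⟩
          · rintro ⟨_, h1, h2⟩; constructor <;> omega
        · rw [Function.update_self, Function.update_of_ne (hne x hx), G.adj_comm, hj x hx]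
          have := hne x hx
          constructor
          · rintro ⟨h1, h2⟩; exact ⟨this, by omega, by omega⟩
          · rintro ⟨_, h1, h2⟩; constructor <;> omega
        · rw [Function.update_of_ne (hne x hx), Function.update_of_ne (hne y hy), h.adj x hx y hy]
      · intro x hx
        rcases Finset.mem_insert.1 hx with rfl | hx
        · simp
        · rw [Function.update_of_ne (hne x hx)]
          have := h.range x hx
          omega
      · intro i h1 h2
        by_cases hij : i = j
        · exact ⟨t, by simp, by simp [hij]⟩
        · obtain ⟨x, hx, hf⟩ := h.surj i (by omega) (by omega)
          exact ⟨x, Finset.mem_insert_of_mem hx, by rw [Function.update_of_ne (hne x hx), hf]⟩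
      · omega
    exact ht (hmax _ _ _ _ hb (Finset.subset_insert _ _) (Finset.mem_insert_self _ _))
  have up : ∀ i, lo < i → i + 1 ≤ hi → L i → L (i + 1) := by
    intro i h1 h2 h3
    by_contra h4
    refine ext (i - 1) (by omega) (by omega) fun x hx => ?_
    rw [h.label_of_boundary hG ht hL h1 h2 h3 h4 x hx]
    constructor <;> rintro ⟨h5, h6⟩ <;> constructor <;> omega
  have down : ∀ i, lo ≤ i - 1 → i < hi → L i → L (i - 1) := by
    intro i h1 h2 h3
    by_contra h4
    refine ext (i + 1) (by omega) (by omega) fun x hx => ?_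
    rw [h.neg.label_of_boundary (L := fun j => L (-j)) (i := -i) hG ht (fun x hx => by
      rw [hL x hx, neg_neg]) (by omega) (by omega) (by simpa using h3)
      (by rwa [show -(-i + 1) = i - 1 by ring]) x hx]
    constructor <;> rintro ⟨h5, h6⟩ <;> constructor <;> omega
  by_cases hint : ∃ i, lo < i ∧ i < hi ∧ L i
  · left
    obtain ⟨i, h1, h2, h3⟩ := hint
    have hup : ∀ m : ℕ, i + m ≤ hi → L (i + m) := by
      intro m
      induction m with
      | zero => simpa using fun _ => h3
      | succ m ih =>
        intro hm
        push_cast at hm ⊢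
        rw [← add_assoc]
        exact up _ (by omega) (by omega) (ih (by omega))
    have hdown : ∀ m : ℕ, lo ≤ i - m → L (i - m) := by
      intro m
      induction m with
      | zero => simpa using fun _ => h3
      | succ m ih =>
        intro hm
        push_cast at hm ⊢
        rw [← sub_sub]
        exact down _ (by omega) (by omega) (ih (by omega))
    intro x hx
    rw [hL x hx]
    have := h.range x hx
    rcases le_total i (f x) with hle | hle
    · have := hup (f x - i).toNat (by omega)
      rwa [show i + ((f x - i).toNat : ℤ) = f x by omega] at this
    · have := hdown (i - f x).toNat (by omega)
      rwa [show i - ((i - f x).toNat : ℤ) = f x by omega] at this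
  · push Not at hint
    right
    have hLx : ∀ x ∈ W, L (f x) → f x = lo ∨ f x = hi := fun x hx hl => by
      have := h.range x hx
      by_contra hcon
      exact hint (f x) (by omega) (by omega) hl
    by_cases h1 : L lo <;> by_cases h2 : L hi
    · right
      intro x hx
      rw [hL x hx]
      exact ⟨hLx x hx, by rintro (h | h) <;> rwa [h]⟩
    · exfalso
      refine ext (lo - 1) (by omega) (by omega) fun x hx => ?_
      have := h.range x hx
      rw [hL x hx]
      constructor
      · intro h3
        rcases hLx x hx h3 with h | h
        · omega
        · rw [h] at h3; exact absurd h3 h2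
      · intro h3
        rwa [show f x = lo by omega]
    · exfalso
      refine ext (hi + 1) (by omega) (by omega) fun x hx => ?_
      have := h.range x hx
      rw [hL x hx]
      constructor
      · intro h3
        rcases hLx x hx h3 with h | h
        · rw [h] at h3; exact absurd h3 h1
        · omega
      · intro h3
        rwa [show f x = hi by omega]
    · left
      intro x hx h3
      rw [hL x hx] at h3
      rcases hLx x hx h3 with h | h <;> rw [h] at h3
      · exact h1 h3
      · exact h2 h3

/-- A weighted median: the vertices labelled before `j`, and those labelled after `j`, make up at
most half of `W`. -/
theorem exists_median_label (W : Finset V) (f : V → ℤ) {lo hi : ℤ} (hle : lo ≤ hi)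
    (hr : ∀ x ∈ W, lo ≤ f x ∧ f x ≤ hi) :
    ∃ j, lo ≤ j ∧ j ≤ hi ∧ 2 * (W.filter (fun x => f x < j)).card ≤ W.card ∧
      2 * (W.filter (fun x => j < f x)).card ≤ W.card := by
  have hex : ∃ m : ℕ, W.card ≤ 2 * (W.filter (fun x => f x ≤ lo + m)).card := by
    refine ⟨(hi - lo).toNat, ?_⟩
    rw [Finset.filter_true_of_mem fun x hx => by have := hr x hx; omega]
    omega
  classical
  set m := Nat.find hex with hm
  have h1 := Nat.find_spec hex
  have h2 : lo + m ≤ hi := by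
    by_contra hcon
    refine Nat.find_min hex (m := (hi - lo).toNat) (by omega) ?_
    rw [Finset.filter_true_of_mem fun x hx => by have := hr x hx; omega]
    omega
  refine ⟨lo + m, by omega, h2, ?_, ?_⟩
  · rcases Nat.eq_zero_or_pos m with h0 | h0
    · rw [Finset.filter_false_of_mem fun x hx => by have := hr x hx; omega]
      simp
    · have := Nat.find_min hex (m := m - 1) (by omega)
      rw [Finset.filter_congr (q := fun x => f x < lo + m) fun x hx => by omega] at this
      omega
  · have := Finset.card_filter_add_card_filter_not (s := W) (fun x => f x ≤ lo + m)
    simp only [not_le] at this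
    rw [← hm] at h1
    omega

/-- An induced path on six vertices lies in a module which is a clique blow-up of a path or of a
cycle. If this module is the whole graph, then it has a balanced separator. -/
theorem exists_module_of_inducedP6 [Fintype V] (hG : EndsDominate G) {p₁ p₂ p₃ p₄ p₅ p₆ : V}
    (hp : IsInducedP6 G p₁ p₂ p₃ p₄ p₅ p₆) :
    HasTwinSeparator G ∨ ∃ M : Set V, IsModule G M ∧ M ≠ Set.univ ∧
      p₁ ∈ M ∧ p₂ ∈ M ∧ p₃ ∈ M ∧ p₄ ∈ M ∧ p₅ ∈ M ∧ p₆ ∈ M := by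
  classical
  obtain ⟨h12, h23, h34, h45, h56, n13, n14, n15, n16, n24, n25, n26, n35, n36, n46⟩ := hp
  -- a blow-up of maximum size that contains the path
  obtain ⟨W₀, f₀, hW₀, hpW₀⟩ : ∃ (W : Finset V) (f : V → ℤ), IsPathBlowup G W f 1 6 ∧
      ({p₁, p₂, p₃, p₄, p₅, p₆} : Finset V) ⊆ W := by
    have e12 := h12.ne
    have e23 := h23.ne
    have e34 := h34.ne
    have e45 := h45.ne
    have e56 := h56.ne
    have e13 : p₁ ≠ p₃ := by rintro rfl; exact n14 h34
    have e14 : p₁ ≠ p₄ := by rintro rfl; exact n15 h45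
    have e15 : p₁ ≠ p₅ := by rintro rfl; exact n16 h56
    have e16 : p₁ ≠ p₆ := by rintro rfl; exact n26 h12.symm
    have e24 : p₂ ≠ p₄ := by rintro rfl; exact n25 h45
    have e25 : p₂ ≠ p₅ := by rintro rfl; exact n26 h56
    have e26 : p₂ ≠ p₆ := by rintro rfl; exact n36 h23.symm
    have e35 : p₃ ≠ p₅ := by rintro rfl; exact n36 h56
    have e36 : p₃ ≠ p₆ := by rintro rfl; exact n46 h34.symm
    have e46 : p₄ ≠ p₆ := by rintro rfl; exact n36 h34
    refine ⟨{p₁, p₂, p₃, p₄, p₅, p₆}, fun x => if x = p₁ then 1 else if x = p₂ then 2 else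
      if x = p₃ then 3 else if x = p₄ then 4 else if x = p₅ then 5 else 6, ⟨?_, ?_, ?_, by norm_num⟩,
      subset_rfl⟩
    · have hsym := G.adj_comm
      have g21 := h12.symm
      have g32 := h23.symm
      have g43 := h34.symm
      have g54 := h45.symm
      have g65 := h56.symm
      rw [hsym] at n13 n14 n15 n16 n24 n25 n26 n35 n36 n46
      have m13 := n13
      have m14 := n14
      have m15 := n15
      have m16 := n16
      have m24 := n24
      have m25 := n25
      have m26 := n26
      have m35 := n35
      have m36 := n36
      have m46 := n46
      rw [hsym] at n13 n14 n15 n16 n24 n25 n26 n35 n36 n46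
      intro x hx y hy
      simp only [Finset.mem_insert, Finset.mem_singleton] at hx hy
      rcases hx with rfl | rfl | rfl | rfl | rfl | rfl <;>
        rcases hy with rfl | rfl | rfl | rfl | rfl | rfl <;>
        simp [*, Ne.symm, e12.symm, e13.symm, e14.symm, e15.symm, e16.symm, e23.symm, e24.symm,
          e25.symm, e26.symm, e34.symm, e35.symm, e36.symm, e45.symm, e46.symm, e56.symm]
    · intro x _
      split_ifs <;> norm_num
    · intro i h1 h2
      obtain rfl | rfl | rfl | rfl | rfl | rfl :
        i = 1 ∨ i = 2 ∨ i = 3 ∨ i = 4 ∨ i = 5 ∨ i = 6 := by omega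
      · exact ⟨p₁, by simp, by simp⟩
      · exact ⟨p₂, by simp, by simp [e12.symm]⟩
      · exact ⟨p₃, by simp, by simp [e13.symm, e23.symm]⟩
      · exact ⟨p₄, by simp, by simp [e14.symm, e24.symm, e34.symm]⟩
      · exact ⟨p₅, by simp, by simp [e15.symm, e25.symm, e35.symm, e45.symm]⟩
      · exact ⟨p₆, by simp, by simp [e16.symm, e26.symm, e36.symm, e46.symm, e56.symm]⟩
  obtain ⟨W, hWmem, hWmax⟩ := Finset.exists_max_image
    ((Finset.univ : Finset (Finset V)).filter fun W =>
      W₀ ⊆ W ∧ ∃ f lo hi, IsPathBlowup G W f lo hi) Finset.card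
    ⟨W₀, by simpa using ⟨f₀, 1, 6, hW₀⟩⟩
  obtain ⟨hWW, f, lo, hi, h⟩ := (Finset.mem_filter.1 hWmem).2
  have hmax : ∀ (W' : Finset V) f' lo' hi', IsPathBlowup G W' f' lo' hi' → W ⊆ W' → W' ⊆ W := by
    intro W' f' lo' hi' h' hsub
    have := hWmax W' (by simpa using ⟨hWW.trans hsub, f', lo', hi', h'⟩)
    rw [Finset.eq_of_subset_of_card_le hsub this]
  have hpW := hpW₀.trans hWW
  simp only [Finset.insert_subset_iff, Finset.singleton_subset_iff] at hpW
  clear hWmem hWmax hWW hpW₀ hW₀ W₀ f₀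
  have hlong := h.long
  have hatt := fun t (ht : t ∉ W) => h.attach_of_maximal hG hmax ht
  have : Nonempty V := ⟨p₁⟩
  choose! p hpm hpf using h.surj
  have ad : ∀ a b, lo ≤ a → b = a + 1 → b ≤ hi → G.Adj (p a) (p b) := by
    rintro a b h1 rfl h2
    refine (h.adj _ (hpm a (by omega) (by omega)) _ (hpm (a + 1) (by omega) (by omega))).2
      ⟨fun he => ?_, ?_, ?_⟩
    · have := congrArg f he
      rw [hpf _ (by omega) (by omega), hpf _ (by omega) (by omega)] at this
      omega
    · rw [hpf _ (by omega) (by omega), hpf _ (by omega) (by omega)]; omega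
    · rw [hpf _ (by omega) (by omega), hpf _ (by omega) (by omega)]
  have nad : ∀ a b, lo ≤ a → a + 2 ≤ b → b ≤ hi → ¬ G.Adj (p a) (p b) ∧ p a ≠ p b := by
    intro a b h1 h2 h3
    constructor
    · intro hc
      have := (h.adj _ (hpm a (by omega) (by omega)) _ (hpm b (by omega) (by omega))).1 hc
      rw [hpf _ (by omega) (by omega), hpf _ (by omega) (by omega)] at this
      omega
    · intro hc
      have := congrArg f hc
      rw [hpf _ (by omega) (by omega), hpf _ (by omega) (by omega)] at this
      omega
  -- the vertices that close the path to a cycle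
  set T : Set V := {t | t ∉ W ∧ ∀ x ∈ W, G.Adj t x ↔ f x = lo ∨ f x = hi} with hT
  have hTlo : ∀ t ∈ T, G.Adj t (p lo) := fun t ht =>
    (ht.2 _ (hpm _ (by omega) (by omega))).2 (.inl (hpf _ (by omega) (by omega)))
  have hThi : ∀ t ∈ T, G.Adj t (p hi) := fun t ht =>
    (ht.2 _ (hpm _ (by omega) (by omega))).2 (.inr (hpf _ (by omega) (by omega)))
  have hTn : ∀ t ∈ T, ∀ j, lo < j → j < hi → ¬ G.Adj t (p j) := fun t ht j h1 h2 h3 => by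
    have := (ht.2 _ (hpm j (by omega) (by omega))).1 h3
    rw [hpf _ (by omega) (by omega)] at this
    omega
  have hmod : IsModule G (↑W ∪ T) := by
    intro v hv x hx y hy hvx
    have hvW : v ∉ W := fun h' => hv (.inl h')
    rcases hatt v hvW with hc | hc | hc
    · rcases hy with hy | hy
      · exact hc y hy
      · by_contra hn
        rcases hG (hTlo y hy) (hc _ (hpm lo (by omega) (by omega))).symm
          (hc _ (hpm (lo + 2) (by omega) (by omega))) (fun h' => hn h'.symm)
          (nad lo (lo + 2) (by omega) (by omega) (by omega)).1
          (hTn y hy _ (by omega) (by omega))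
          (.inr (hc _ (hpm (lo + 4) (by omega) (by omega))).symm) with h' | h' | h' | h'
        · exact hTn y hy _ (by omega) (by omega) h'.symm
        · exact (nad (lo + 2) (lo + 4) (by omega) (by omega) (by omega)).1 h'.symm
        · exact hy.1 (h' ▸ hpm (lo + 4) (by omega) (by omega))
        · exact (nad (lo + 2) (lo + 4) (by omega) (by omega) (by omega)).2 h'.symm
    · exfalso
      rcases hx with hx | hx
      · exact hc x hx hvx
      · rcases hG hvx (hTlo x hx) (ad lo (lo + 1) le_rfl rfl (by omega))
          (hc _ (hpm lo (by omega) (by omega))) (hTn x hx _ (by omega) (by omega))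
          (hc _ (hpm _ (by omega) (by omega))) (.inl (hThi x hx).symm) with h' | h' | h' | h'
        · exact hc _ (hpm hi (by omega) (by omega)) h'.symm
        · exact (nad (lo + 1) hi (by omega) (by omega) (by omega)).1 h'.symm
        · exact hvW (h' ▸ hpm hi (by omega) (by omega))
        · exact (nad (lo + 1) hi (by omega) (by omega) (by omega)).2 h'.symm
    · exact absurd (.inr ⟨hvW, hc⟩) hv
  by_cases huniv : (↑W ∪ T : Set V) = Set.univ
  -- If the blow-up is the whole graph, the vertices with one label are twins, and so are those in
  -- `T`. Cutting at `T` and at a median label separates the graph.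
  swap
  · exact .inr ⟨_, hmod, huniv, .inl hpW.1, .inl hpW.2.1, .inl hpW.2.2.1, .inl hpW.2.2.2.1,
      .inl hpW.2.2.2.2.1, .inl hpW.2.2.2.2.2⟩
  left
  have hcases : ∀ z, z ∈ W ∨ z ∈ T := fun z => by
    have : z ∈ (↑W ∪ T : Set V) := huniv ▸ Set.mem_univ z
    simpa using this
  have hTT : ∀ t ∈ T, ∀ t' ∈ T, t ≠ t' → G.Adj t t' := by
    intro t ht t' ht' hne
    rcases hG (hTlo t ht) (ad lo (lo + 1) le_rfl rfl (by omega))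
      (ad (lo + 1) (lo + 2) (by omega) (by omega) (by omega)) (hTn t ht _ (by omega) (by omega))
      (nad lo (lo + 2) (by omega) (by omega) (by omega)).1 (hTn t ht _ (by omega) (by omega))
      (.inl (hTlo t' ht')) with h' | h' | h' | h'
    · exact h'.symm
    · exact absurd h' (hTn t' ht' _ (by omega) (by omega))
    · exact absurd h'.symm hne
    · exact absurd (h' ▸ hpm (lo + 2) (by omega) (by omega)) ht'.1
  have twT : ∀ t ∈ T, ∀ t' ∈ T, IsTwin G t t' := by
    intro t ht t' ht' z
    rcases hcases z with hz | hz
    · have h1 : z ≠ t := by rintro rfl; exact ht.1 hz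
      have h2 : z ≠ t' := by rintro rfl; exact ht'.1 hz
      simp [h1, h2, ht.2 z hz, ht'.2 z hz]
    · exact ⟨fun _ => (eq_or_ne z t').imp id fun h' => (hTT z hz t' ht' h').symm,
        fun _ => (eq_or_ne z t).imp id fun h' => (hTT z hz t ht h').symm⟩
  have twW : ∀ x ∈ W, ∀ x' ∈ W, f x = f x' → IsTwin G x x' := by
    intro x hx x' hx' hf z
    rcases hcases z with hz | hz
    · rw [h.adj x hx z hz, h.adj x' hx' z hz, hf]
      constructor
      · rintro (rfl | ⟨_, h'⟩)
        · by_cases he : z = x'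
          · exact .inl he
          · exact .inr ⟨fun h' => he h'.symm, by omega, by omega⟩
        · by_cases he : z = x'
          · exact .inl he
          · exact .inr ⟨fun h' => he h'.symm, h'⟩
      · rintro (rfl | ⟨_, h'⟩)
        · by_cases he : z = x
          · exact .inl he
          · exact .inr ⟨fun h' => he h'.symm, by omega, by omega⟩
        · by_cases he : z = x
          · exact .inl he
          · exact .inr ⟨fun h' => he h'.symm, h'⟩
    · have h1 : z ≠ x := by rintro rfl; exact hz.1 hx
      have h2 : z ≠ x' := by rintro rfl; exact hz.1 hx'
      simp [h1, h2, G.adj_comm x z, G.adj_comm x' z, hz.2 x hx, hz.2 x' hx', hf]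
  obtain ⟨j, hj1, hj2, hm1, hm2⟩ := exists_median_label W f (by omega) h.range
  have hWc : W.card ≤ Fintype.card V := Finset.card_le_univ W
  obtain ⟨b, hb⟩ : ∃ b, ∀ t ∈ T, IsTwin G b t := by
    by_cases hTe : ∃ t, t ∈ T
    · obtain ⟨t, ht⟩ := hTe
      exact ⟨t, fun t' ht' => twT t ht t' ht'⟩
    · exact ⟨p₁, fun t ht => absurd ⟨t, ht⟩ hTe⟩
  refine ⟨p j, b, fun C hC hav => ?_⟩
  have hCW : ∀ c ∈ C, c ∈ W ∧ f c ≠ j := fun c hc => by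
    have hcW := (hcases c).resolve_right fun ht => (hav c hc).2 (hb c ht)
    refine ⟨hcW, fun hf => (hav c hc).1 (twW _ (hpm j hj1 hj2) _ hcW ?_)⟩
    rw [hpf j hj1 hj2, hf]
  -- no edge joins labels below `j` to labels above `j`
  have hside : (∀ c ∈ C, f c < j) ∨ (∀ c ∈ C, j < f c) := by
    by_contra hcon
    push Not at hcon
    obtain ⟨⟨c, hc, hcj⟩, ⟨d, hd, hdj⟩⟩ := hcon
    obtain ⟨c', hc', hcY, d', hd', hdY, hadj⟩ := hC {x | f x < j}
      ⟨d, hd, lt_of_le_of_ne hdj (hCW d hd).2⟩ ⟨c, hc, by simpa using hcj⟩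
    have := (h.adj _ (hCW _ hc').1 _ (hCW _ hd').1).1 hadj
    have h2 := (hCW _ hd').2
    simp only [Set.mem_ofPred_eq, not_lt] at hcY hdY
    omega
  rcases hside with hs | hs
  · have : C ⊆ W.filter (fun x => f x < j) := fun c hc =>
      Finset.mem_filter.2 ⟨(hCW c hc).1, hs c hc⟩
    have := Finset.card_le_card this
    omega
  · have : C ⊆ W.filter (fun x => j < f x) := fun c hc =>
      Finset.mem_filter.2 ⟨(hCW c hc).1, hs c hc⟩
    have := Finset.card_le_card this
    omega

end Separators

section Anticomponents

/-! ### Components of the non-neighbours of a vertex -/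
variable {V : Type*} {G : SimpleGraph V}

/-- Some module other than the whole graph contains both `a` and `b`. -/
def SameModule (G : SimpleGraph V) (a b : V) : Prop :=
  ∃ M : Set V, IsModule G M ∧ M ≠ Set.univ ∧ a ∈ M ∧ b ∈ M

theorem CutConnected.insert_of_exists {r : V → V → Prop} (hr : ∀ a b, r a b → r b a) {C : Set V}
    (hC : CutConnected r C) {t q : V} (hq : q ∈ C) (htq : r t q) : CutConnected r (insert t C) := by
  rintro Y ⟨c, hc, hcY⟩ ⟨d, hd, hdY⟩
  by_cases hcr : (∃ c ∈ C, c ∈ Y) ∧ (∃ c ∈ C, c ∉ Y)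
  · obtain ⟨c, hc, hcY, d, hd, hdY, h⟩ := hC Y hcr.1 hcr.2
    exact ⟨c, .inr hc, hcY, d, .inr hd, hdY, h⟩
  · by_cases hqY : q ∈ Y
    · have hall : ∀ c ∈ C, c ∈ Y := fun c hc => by
        by_contra hn
        exact hcr ⟨⟨q, hq, hqY⟩, ⟨c, hc, hn⟩⟩
      rcases hd with rfl | hd
      · exact ⟨q, .inr hq, hqY, d, .inl rfl, hdY, hr _ _ htq⟩
      · exact absurd (hall d hd) hdY
    · have hall : ∀ c ∈ C, c ∉ Y := fun c hc hn => hcr ⟨⟨c, hc, hn⟩, ⟨q, hq, hqY⟩⟩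
      rcases hc with rfl | hc
      · exact ⟨c, .inl rfl, hcY, q, .inr hq, hqY, htq⟩
      · exact absurd hcY (hall c hc)

theorem CutConnected.insert_of_forall {r : V → V → Prop} (hr : ∀ a b, r a b → r b a) {C : Set V}
    {t : V} (ht : ∀ q ∈ C, r t q) : CutConnected r (insert t C) := by
  rintro Y ⟨c, hc, hcY⟩ ⟨d, hd, hdY⟩
  by_cases htY : t ∈ Y
  · rcases hd with rfl | hd
    · exact absurd htY hdY
    · exact ⟨t, .inl rfl, htY, d, .inr hd, hdY, ht d hd⟩
  · rcases hc with rfl | hc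
    · exact absurd hcY htY
    · exact ⟨c, .inr hc, hcY, t, .inl rfl, htY, hr _ _ (ht c hc)⟩

/-- A connected set that does not contain everything, and is not contained in a proper module, has
an edge on which some outside vertex is mixed. -/
theorem CutConnected.exists_mixed {K : Set V} (hK : CutConnected G.Adj K) {u e e' : V}
    (hu : u ∉ K) (he : e ∈ K) (he' : e' ∈ K) (hne : ¬ SameModule G e e') :
    ∃ y ∉ K, ∃ k ∈ K, ∃ k' ∈ K, G.Adj k k' ∧ G.Adj y k ∧ ¬ G.Adj y k' := by
  have hmod : ¬ IsModule G K := fun h =>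
    hne ⟨K, h, fun hK => hu (hK ▸ Set.mem_univ u), he, he'⟩
  simp only [IsModule] at hmod
  push Not at hmod
  obtain ⟨v, hv, x, hx, y, hy, hvx, hvy⟩ := hmod
  obtain ⟨c, hc, hcY, d, hd, hdY, hcd⟩ := hK {z | G.Adj v z} ⟨x, hx, hvx⟩ ⟨y, hy, hvy⟩
  exact ⟨v, hv, c, hc, d, hd, hcd, hcY, hdY⟩

/-- `C` is a component of the graph induced by the non-neighbours of `u` other than `u`. -/
structure IsAnticomponent (G : SimpleGraph V) (u : V) (C : Set V) : Prop where
  not_adj : ∀ c ∈ C, ¬ G.Adj u c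
  not_mem : u ∉ C
  closed : ∀ c ∈ C, ∀ w, G.Adj c w → G.Adj u w ∨ w ∈ C
  conn : CutConnected G.Adj C

theorem isAnticomponent_reachSet {u e : V} (h1 : e ≠ u) (h2 : ¬ G.Adj u e) :
    IsAnticomponent G u (reachSet G.Adj {w | w ≠ u ∧ ¬ G.Adj u w} e) := by
  have hsub := reachSet_subset (r := G.Adj) (P := {w | w ≠ u ∧ ¬ G.Adj u w}) (e := e) ⟨h1, h2⟩
  refine ⟨fun c hc => (hsub hc).2, fun h => (hsub h).1 rfl, fun c hc w hcw => ?_,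
    reachSet_cutConnected (fun _ _ h => h.symm) _ _⟩
  by_cases hw : G.Adj u w
  · exact .inl hw
  · refine .inr (reachSet_closed hc hcw ⟨?_, hw⟩)
    rintro rfl
    exact (hsub hc).2 hcw.symm

theorem IsAnticomponent.subset_of_mem {u c : V} {C D : Set V} (hC : IsAnticomponent G u C)
    (hD : IsAnticomponent G u D) (hc : c ∈ C) (hd : c ∈ D) : C ⊆ D := by
  by_contra hcon
  obtain ⟨d, hdC, hdD⟩ := Set.not_subset.mp hcon
  obtain ⟨a, haC, haD, b, hbC, hbD, hab⟩ := hC.conn D ⟨c, hc, hd⟩ ⟨d, hdC, hdD⟩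
  exact (hD.closed a haD b hab).elim (hC.not_adj b hbC) hbD

theorem IsAnticomponent.subset_of_isModule {u c : V} {C M : Set V} (hC : IsAnticomponent G u C)
    (hM : IsModule G M) (hu : u ∈ M) (hc : c ∈ C) (hcM : c ∈ M) : C ⊆ M := by
  by_contra hcon
  obtain ⟨d, hdC, hdM⟩ := Set.not_subset.mp hcon
  obtain ⟨a, haC, haM, b, hbC, hbM, hab⟩ := hC.conn M ⟨c, hc, hcM⟩ ⟨d, hdC, hdM⟩
  exact hC.not_adj b hbC (hM b hbM a haM u hu hab.symm).symm

/-- Let `x` be a neighbour of `u` that is mixed on an edge `a b` of an anticomponent `C` of `u`.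
Unless there is an induced path on six vertices, the non-neighbour `b` of `x` dominates `C`. -/
theorem IsAnticomponent.dominates (hG : EndsDominate G) {u : V} {C : Set V}
    (hC : IsAnticomponent G u C)
    (hno : ∀ x a b c d, a ∈ C → ¬ IsInducedP6 G u x a b c d) {x a b : V} (hx : G.Adj u x)
    (ha : a ∈ C) (hb : b ∈ C) (hxa : G.Adj x a) (hxb : ¬ G.Adj x b) (hab : G.Adj a b) :
    ∀ w ∈ C, w = b ∨ G.Adj w b := by
  have hne : ∀ c ∈ C, c ≠ u := fun c hc h => hC.not_mem (h ▸ hc)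
  have hxC : x ∉ C := fun h => hC.not_adj x h hx
  have dom : ∀ {a b}, a ∈ C → b ∈ C → G.Adj x a → ¬ G.Adj x b → G.Adj a b → ∀ y ∈ C,
      (G.Adj y x ∨ G.Adj y a) → G.Adj y b ∨ y = b := by
    intro a b ha hb hxa hxb hab y hy hya
    rcases hG hx hxa hab (hC.not_adj a ha) hxb (hC.not_adj b hb) hya with h | h | h | h
    · exact absurd h.symm (hC.not_adj y hy)
    · exact .inl h
    · exact absurd h (hne y hy)
    · exact .inr h
  by_contra hcon
  push Not at hcon
  obtain ⟨w, hw, hwb, hwb'⟩ := hcon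
  obtain ⟨c, hc, hcY, d, hd, hdY, hcd⟩ := hC.conn {w | w = b ∨ G.Adj w b} ⟨b, hb, .inl rfl⟩
    ⟨w, hw, not_or.2 ⟨hwb, hwb'⟩⟩
  rw [Set.mem_ofPred_eq, not_or] at hdY
  obtain ⟨hdb, hdb'⟩ := hdY
  have hcb : G.Adj c b := hcY.resolve_left (by rintro rfl; exact hdb' hcd.symm)
  have hd1 : ¬ G.Adj x d := fun h => (dom ha hb hxa hxb hab d hd (.inl h.symm)).elim hdb' hdb
  have hd2 : ¬ G.Adj a d := fun h => (dom ha hb hxa hxb hab d hd (.inr h.symm)).elim hdb' hdb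
  have hda : a ≠ d := by rintro rfl; exact hd1 hxa
  have hxc : ¬ G.Adj x c := fun h =>
    (dom hc hd h hd1 hcd a ha (.inl hxa.symm)).elim hd2 hda
  by_cases hac : G.Adj a c
  · rcases hG hxa hac hcd hxc hd2 hd1 (x := b) (.inl hab.symm) with h | h | h | h
    · exact hxb h.symm
    · exact hdb' h.symm
    · exact hxC (h ▸ hb)
    · exact hdb h.symm
  · exact hno x a b c d ha ⟨hx, hxa, hab, hcb.symm, hcd, hC.not_adj a ha, hC.not_adj b hb,
      hC.not_adj c hc, hC.not_adj d hd, hxb, hxc, hd1, hac, hd2, fun h => hdb' h.symm⟩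

/-- A neighbour of `u` mixed on one anticomponent is not attached to another one. -/
theorem IsAnticomponent.not_adj_other (hG : EndsDominate G) {u : V} {C D : Set V}
    (hC : IsAnticomponent G u C) (hD : IsAnticomponent G u D) (hCD : ∀ c ∈ C, c ∉ D) {x a b : V}
    (hx : G.Adj u x) (ha : a ∈ C) (hb : b ∈ C) (hxa : G.Adj x a) (hxb : ¬ G.Adj x b)
    (hab : G.Adj a b) : ∀ d ∈ D, ¬ G.Adj x d := by
  intro d hd hxd
  have hnd : ∀ c ∈ C, ¬ G.Adj d c := fun c hc h =>
    (hD.closed d hd c h).elim (hC.not_adj c hc) (hCD c hc)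
  rcases hG hxd.symm hxa hab (hnd a ha) hxb (hnd b hb) (x := u) (.inl hx) with h | h | h | h
  · exact hD.not_adj d hd h
  · exact hC.not_adj b hb h
  · exact hD.not_mem (h ▸ hd)
  · exact hC.not_mem (h ▸ hb)

/-- If all induced paths on six vertices lie in proper modules, then the edges between
non-neighbours of `u` that are not inside a proper module lie in a single anticomponent. -/
theorem IsAnticomponent.mem_of_not_sameModule (hG : EndsDominate G)
    (hP6 : ∀ p₁ p₂ p₃ p₄ p₅ p₆, IsInducedP6 G p₁ p₂ p₃ p₄ p₅ p₆ → ∃ M : Set V, IsModule G M ∧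
      M ≠ Set.univ ∧ p₁ ∈ M ∧ p₂ ∈ M ∧ p₃ ∈ M ∧ p₄ ∈ M ∧ p₅ ∈ M ∧ p₆ ∈ M)
    {u : V} {C : Set V} (hC : IsAnticomponent G u C) {e e' g g' : V} (he : e ∈ C) (he' : e' ∈ C)
    (hee : ¬ SameModule G e e') (hgg : ¬ SameModule G g g') (hadj : G.Adj g g')
    (hg : ¬ G.Adj u g) (hg' : ¬ G.Adj u g') : g ∈ C := by
  by_contra hgC
  have hgu : g ≠ u := by rintro rfl; exact hg' hadj
  have hg'u : g' ≠ u := by rintro rfl; exact hg hadj.symm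
  have hD := isAnticomponent_reachSet hgu hg
  have hgD : g ∈ reachSet G.Adj {w | w ≠ u ∧ ¬ G.Adj u w} g := self_mem_reachSet _ _ _
  have hgD' : g' ∈ reachSet G.Adj {w | w ≠ u ∧ ¬ G.Adj u w} g :=
    reachSet_closed hgD hadj ⟨hg'u, hg'⟩
  generalize reachSet G.Adj {w | w ≠ u ∧ ¬ G.Adj u w} g = D at hD hgD hgD'
  have hDC : ∀ d ∈ D, d ∉ C := fun d hd hdC => hgC (hD.subset_of_mem hC hd hdC hgD)
  have hCD : ∀ c ∈ C, c ∉ D := fun c hc hd => hDC c hd hc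
  obtain ⟨x, hxC, a, ha, b, hb, hab, hxa, hxb⟩ := hC.conn.exists_mixed hC.not_mem he he' hee
  obtain ⟨y, hyD, c, hc, d, hd, hcd, hyc, hyd⟩ := hD.conn.exists_mixed hD.not_mem hgD hgD' hgg
  have hx : G.Adj u x := (hC.closed a ha x hxa.symm).resolve_right hxC
  have hy : G.Adj u y := (hD.closed c hc y hyc.symm).resolve_right hyD
  have hxD := hC.not_adj_other hG hD hCD hx ha hb hxa hxb hab
  have hyC := hD.not_adj_other hG hC hDC hy hc hd hyc hyd hcd
  have hn : ∀ c ∈ C, ∀ d ∈ D, ¬ G.Adj c d := fun c hc d hd h =>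
    (hC.closed c hc d h).elim (hD.not_adj d hd) (hDC d hd)
  have hxy : ¬ G.Adj x y := by
    intro h
    rcases hG hxa.symm h hyc (fun h => hyC a ha h.symm) (hxD c hc) (hn a ha c hc) (x := u)
      (.inl hx) with h | h | h | h
    · exact hC.not_adj a ha h
    · exact hD.not_adj c hc h
    · exact hC.not_mem (h ▸ ha)
    · exact hD.not_mem (h ▸ hc)
  obtain ⟨M, hM, hMu, _, haM, _, huM, _, _⟩ := hP6 b a x u y c
    ⟨hab.symm, hxa.symm, hx.symm, hy, hyc, fun h => hxb h.symm, fun h => hC.not_adj b hb h.symm,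
      fun h => hyC b hb h.symm, hn b hb c hc, fun h => hC.not_adj a ha h.symm,
      fun h => hyC a ha h.symm, hn a ha c hc, hxy, hxD c hc, hD.not_adj c hc⟩
  have := hC.subset_of_isModule hM huM ha haM
  exact hee ⟨M, hM, hMu, this he, this he'⟩

end Anticomponents

section DominatingTriples

/-! ### Three dominating vertices -/
variable {V : Type*} {G : SimpleGraph V}

/-- In a maximal independent set `I`, at most three vertices already dominate every edge that is not
inside a proper module.

The component `C` of the non-neighbours of `u ∈ I` that contains the edges in question splits into
the neighbours of `x` (for a well-chosen neighbour `x` of `u`), the vertices at distance two from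
`x`, each of which dominates `C`, and the rest. One vertex of `I` in the second part is enough;
otherwise one takes a vertex of `I` in the first part and, if there is any, one in the rest. -/
theorem exists_triple_of_maximal_independent [Fintype V] (hG : EndsDominate G)
    (hsep : ¬ HasTwinSeparator G) {I : Finset V}
    (hI : ∀ a ∈ I, ∀ b ∈ I, ¬ G.Adj a b) (hmax : ∀ v, v ∈ I ∨ ∃ i ∈ I, G.Adj v i)
    (hne : I.Nonempty) :
    ∃ J ⊆ I, J.card ≤ 3 ∧ ∀ a b, (∀ j ∈ J, ¬ G.Adj j a) → (∀ j ∈ J, ¬ G.Adj j b) → G.Adj a b →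
      SameModule G a b := by
  classical
  have hP6 : ∀ p₁ p₂ p₃ p₄ p₅ p₆, IsInducedP6 G p₁ p₂ p₃ p₄ p₅ p₆ → ∃ M : Set V, IsModule G M ∧
      M ≠ Set.univ ∧ p₁ ∈ M ∧ p₂ ∈ M ∧ p₃ ∈ M ∧ p₄ ∈ M ∧ p₅ ∈ M ∧ p₆ ∈ M :=
    fun _ _ _ _ _ _ hp => (exists_module_of_inducedP6 hG hp).resolve_left hsep
  obtain ⟨u, hu⟩ := hne
  by_cases hdone : ∀ a b, ¬ G.Adj u a → ¬ G.Adj u b → G.Adj a b → SameModule G a b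
  · exact ⟨{u}, by simpa using hu, by simp, by simpa using hdone⟩
  push Not at hdone
  obtain ⟨e, e', hue, hue', hadj, hee⟩ := hdone
  -- the anticomponent `C` of `u` that contains all critical edges
  have heu : e ≠ u := by rintro rfl; exact hue' hadj
  have he'u : e' ≠ u := by rintro rfl; exact hue hadj.symm
  have hC := isAnticomponent_reachSet heu hue
  have heC : e ∈ reachSet G.Adj {w | w ≠ u ∧ ¬ G.Adj u w} e := self_mem_reachSet _ _ _
  have he'C : e' ∈ reachSet G.Adj {w | w ≠ u ∧ ¬ G.Adj u w} e :=
    reachSet_closed heC hadj ⟨he'u, hue'⟩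
  generalize reachSet G.Adj {w | w ≠ u ∧ ¬ G.Adj u w} e = C at hC heC he'C
  have hcrit : ∀ g g', ¬ SameModule G g g' → G.Adj g g' → ¬ G.Adj u g → ¬ G.Adj u g' → g ∈ C :=
    fun g g' h1 h2 h3 h4 => hC.mem_of_not_sameModule hG hP6 heC he'C hee h1 h2 h3 h4
  have hno : ∀ x a b c d, a ∈ C → ¬ IsInducedP6 G u x a b c d := by
    intro x a b c d ha hp
    obtain ⟨M, hM, hMu, h1, _, h3, _⟩ := hP6 _ _ _ _ _ _ hp
    have := hC.subset_of_isModule hM h1 ha h3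
    exact hee ⟨M, hM, hMu, this heC, this he'C⟩
  have dom := fun {x a b} => hC.dominates hG hno (x := x) (a := a) (b := b)
  -- a neighbour `x` of `u` that is mixed on `C`, with fewest neighbours in `C`
  obtain ⟨x, ⟨hx, a₀, ha₀, b₀, hb₀, hxa₀, hxb₀, hab₀⟩, hxmin⟩ : ∃ x,
      (G.Adj u x ∧ ∃ a ∈ C, ∃ b ∈ C, G.Adj x a ∧ ¬ G.Adj x b ∧ G.Adj a b) ∧
      ∀ t, (G.Adj u t ∧ ∃ a ∈ C, ∃ b ∈ C, G.Adj t a ∧ ¬ G.Adj t b ∧ G.Adj a b) →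
        (Finset.univ.filter fun c => c ∈ C ∧ G.Adj x c).card ≤
          (Finset.univ.filter fun c => c ∈ C ∧ G.Adj t c).card := by
    obtain ⟨y, hyC, a, ha, b, hb, hab, hya, hyb⟩ := hC.conn.exists_mixed hC.not_mem heC he'C hee
    obtain ⟨x, hx1, hx2⟩ := Finset.exists_min_image (Finset.univ.filter fun t =>
      G.Adj u t ∧ ∃ a ∈ C, ∃ b ∈ C, G.Adj t a ∧ ¬ G.Adj t b ∧ G.Adj a b)
      (fun t => (Finset.univ.filter fun c => c ∈ C ∧ G.Adj t c).card)
      ⟨y, by simpa using ⟨(hC.closed a ha y hya.symm).resolve_right hyC, a, ha, b, hb, hya, hyb,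
        hab⟩⟩
    exact ⟨x, by simpa using hx1, fun t ht => hx2 t (by simpa using ht)⟩
  have hxC : x ∉ C := fun h => hC.not_adj x h hx
  -- `B`: the vertices of `C` that are not adjacent to `x` but to a neighbour of `x` in `C`
  have domB : ∀ b ∈ C, ¬ G.Adj x b → (∃ a ∈ C, G.Adj x a ∧ G.Adj a b) → ∀ w ∈ C, w = b ∨ G.Adj w b :=
    fun b hb hxb ⟨a, ha, hxa, hab⟩ => dom hx ha hb hxa hxb hab
  have hIC : ∀ i ∈ I, ∀ c ∈ C, G.Adj c i → i ∈ C := fun i hi c hc h =>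
    (hC.closed c hc i h).resolve_left (hI u hu i hi)
  by_cases hIB : ∃ b ∈ I, b ∈ C ∧ ¬ G.Adj x b ∧ ∃ a ∈ C, G.Adj x a ∧ G.Adj a b
  · obtain ⟨b, hbI, hbC, hxb, hb⟩ := hIB
    refine ⟨{u, b}, by simp [Finset.insert_subset_iff, hu, hbI],
      Finset.card_le_two.trans (by norm_num),
      fun g g' hg hg' hgg => ?_⟩
    simp only [Finset.mem_insert, Finset.mem_singleton, forall_eq_or_imp, forall_eq] at hg hg'
    by_contra hcon
    have hgC := hcrit g g' hcon hgg hg.1 hg'.1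
    rcases domB b hbC hxb hb g hgC with rfl | h
    · exact hg'.2 hgg
    · exact hg.2 h.symm
  push Not at hIB
  obtain ⟨a₁, ha₁I, ha₁C, hxa₁⟩ : ∃ a ∈ I, a ∈ C ∧ G.Adj x a := by
    rcases hmax a₀ with h | ⟨i, hi, h⟩
    · exact ⟨a₀, h, ha₀, hxa₀⟩
    · have hiC := hIC i hi a₀ ha₀ h
      by_contra hcon
      push Not at hcon
      exact hIB i hi hiC (hcon i hi hiC) a₀ ha₀ hxa₀ h
  -- `R` takes care of the vertices of `C` at distance more than two from `x`
  obtain ⟨R, hRI, hRc, hR⟩ : ∃ R ⊆ I, R.card ≤ 1 ∧ ∀ e ∈ C, ¬ G.Adj x e →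
      (∀ a ∈ C, G.Adj x a → ¬ G.Adj a e) → ∃ r ∈ R, r = e ∨ G.Adj r e := by
    by_cases hRe : ∃ r ∈ I, r ∈ C ∧ ¬ G.Adj x r ∧ ∀ a ∈ C, G.Adj x a → ¬ G.Adj a r
    · obtain ⟨r, hrI, hrC, hxr, hr⟩ := hRe
      refine ⟨{r}, by simpa using hrI, by simp, fun e he hxe hae => ⟨r, by simp, ?_⟩⟩
      have hb := domB b₀ hb₀ hxb₀ ⟨a₀, ha₀, hxa₀, hab₀⟩
      have hbr := (hb r hrC).resolve_left (by rintro rfl; exact hr a₀ ha₀ hxa₀ hab₀)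
      have hbe := (hb e he).resolve_left (by rintro rfl; exact hae a₀ ha₀ hxa₀ hab₀)
      rcases hG hxa₀ hab₀ hbr.symm hxb₀ (hr a₀ ha₀ hxa₀) hxr (x := e) (.inr hbe) with h | h | h | h
      · exact absurd h.symm hxe
      · exact .inr h.symm
      · exact absurd (h ▸ he) hxC
      · exact .inl h.symm
    · push Not at hRe
      refine ⟨∅, by simp, by simp, fun e he hxe hae => ?_⟩
      exfalso
      rcases hmax e with h | ⟨i, hi, h⟩
      · obtain ⟨a, ha, hxa, hae'⟩ := hRe e h he hxe
        exact hae a ha hxa hae'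
      · have hiC := hIC i hi e he h
        have hxi : ¬ G.Adj x i := fun hxi => hae i hiC hxi h.symm
        obtain ⟨a, ha, hxa, hai⟩ := hRe i hi hiC hxi
        exact hIB i hi hiC hxi a ha hxa hai
  refine ⟨insert u (insert a₁ R), ?_, ?_, ?_⟩
  · simp [Finset.insert_subset_iff, hu, ha₁I, hRI]
  · have h1 := Finset.card_insert_le u (insert a₁ R)
    have h2 := Finset.card_insert_le a₁ R
    omega
  intro g g' hg hg' hgg
  simp only [Finset.mem_insert, forall_eq_or_imp] at hg hg'
  by_contra hcon
  -- an edge that is left joins neighbours of `x` in `C` that are not adjacent to `a₁`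
  have hA : ∀ g g', ¬ SameModule G g g' → G.Adj g g' → (¬ G.Adj u g ∧ ¬ G.Adj a₁ g ∧
      ∀ r ∈ R, ¬ G.Adj r g) → (¬ G.Adj u g' ∧ ¬ G.Adj a₁ g' ∧ ∀ r ∈ R, ¬ G.Adj r g') →
      g ∈ C ∧ G.Adj x g ∧ g ≠ a₁ ∧ ¬ G.Adj a₁ g := by
    intro g g' hcon hgg hg hg'
    have hgC := hcrit g g' hcon hgg hg.1 hg'.1
    refine ⟨hgC, ?_, ?_, hg.2.1⟩
    · by_contra hxg
      by_cases hB : ∃ a ∈ C, G.Adj x a ∧ G.Adj a g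
      · rcases domB g hgC hxg hB a₁ ha₁C with h | h
        · exact hxg (h ▸ hxa₁)
        · exact hg.2.1 h
      · push Not at hB
        obtain ⟨r, hr, h | h⟩ := hR g hgC hxg hB
        · exact hg'.2.2 r hr (h ▸ hgg)
        · exact hg.2.2 r hr h
    · rintro rfl
      exact hg'.2.1 hgg
  have hgA := hA g g' hcon hgg hg hg'
  have hgA' := hA g' g (fun ⟨M, h1, h2, h3, h4⟩ => hcon ⟨M, h1, h2, h4, h3⟩) hgg.symm hg' hg
  set P : Set V := {w | w ∈ C ∧ G.Adj x w ∧ w ≠ a₁ ∧ ¬ G.Adj a₁ w} with hP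
  have hKsub : reachSet G.Adj P g ⊆ P := reachSet_subset hgA
  have hKconn : CutConnected G.Adj (reachSet G.Adj P g) :=
    reachSet_cutConnected (fun _ _ h => h.symm) _ _
  have hgK : g ∈ reachSet G.Adj P g := self_mem_reachSet _ _ _
  have hgK' : g' ∈ reachSet G.Adj P g := reachSet_closed hgK hgg hgA'
  have hKcl : ∀ k ∈ reachSet G.Adj P g, ∀ w, G.Adj k w → w ∈ P → w ∈ reachSet G.Adj P g :=
    fun k hk w h hw => reachSet_closed hk h hw
  generalize reachSet G.Adj P g = K at hKsub hKconn hgK hgK' hKcl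
  obtain ⟨y, hyK, k, hk, k', hk', hkk, hyk, hyk'⟩ :=
    hKconn.exists_mixed (u := a₁) (fun h => (hKsub h).2.2.1 rfl) hgK hgK' hcon
  have hyP : y ∉ P := fun h => hyK (hKcl k hk y hyk.symm h)
  have hyC : y ∈ C := by
    by_contra hyC
    have huy := (hC.closed k (hKsub hk).1 y hyk.symm).resolve_right hyC
    rcases dom huy (hKsub hk).1 (hKsub hk').1 hyk hyk' hkk a₁ ha₁C with h | h
    · exact (hKsub hk').2.2.1 h.symm
    · exact (hKsub hk').2.2.2 h
  have hxy : G.Adj x y := by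
    by_contra hxy
    rcases domB y hyC hxy ⟨k, (hKsub hk).1, (hKsub hk).2.1, hyk.symm⟩ k' (hKsub hk').1 with h | h
    · exact hxy (h ▸ (hKsub hk').2.1)
    · exact hyk' h.symm
  have hya₁ : G.Adj a₁ y := by
    by_contra h
    refine hyP ⟨hyC, hxy, ?_, h⟩
    rintro rfl
    exact (hKsub hk).2.2.2 hyk
  -- a maximal connected and co-connected set `Q` of neighbours of `x` in `C`; it contains the edge
  -- `g g'`, so some vertex `t` is mixed on it, and `t` contradicts the choice of `x`
  have hQ₀ : CutConnected G.Adj (insert a₁ (insert y K)) ∧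
      CutConnected Gᶜ.Adj (insert a₁ (insert y K)) ∧
      insert a₁ (insert y K) ⊆ {w | w ∈ C ∧ G.Adj x w} := by
    refine ⟨(hKconn.insert_of_exists (fun _ _ h => h.symm) hk hyk).insert_of_exists
      (fun _ _ h => h.symm) (.inl rfl) hya₁, ?_, ?_⟩
    · rw [Set.insert_comm]
      refine CutConnected.insert_of_exists (fun _ _ h => h.symm)
        (CutConnected.insert_of_forall (fun _ _ h => h.symm) fun q hq => ?_) (q := k') (.inr hk') ?_
      · exact (SimpleGraph.compl_adj _ _ _).2 ⟨(hKsub hq).2.2.1.symm, (hKsub hq).2.2.2⟩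
      · refine (SimpleGraph.compl_adj _ _ _).2 ⟨?_, hyk'⟩
        rintro rfl
        exact hyK hk'
    · rintro w (rfl | rfl | hw)
      · exact ⟨ha₁C, hxa₁⟩
      · exact ⟨hyC, hxy⟩
      · exact ⟨(hKsub hw).1, (hKsub hw).2.1⟩
  obtain ⟨Q, hQQ, ⟨hQ1, hQ2, hQA⟩, hQmax⟩ := Finite.exists_le_maximal (p := fun Q : Set V =>
    CutConnected G.Adj Q ∧ CutConnected Gᶜ.Adj Q ∧ Q ⊆ {w | w ∈ C ∧ G.Adj x w}) hQ₀
  have hgQ : g ∈ Q := hQQ (.inr (.inr hgK))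
  have hgQ' : g' ∈ Q := hQQ (.inr (.inr hgK'))
  obtain ⟨t, htQ, q, hq, q', hq', hqq, htq, htq'⟩ :=
    hQ1.exists_mixed (fun h => hxC (hQA h).1) hgQ hgQ' hcon
  have htC : t ∉ C := by
    intro htC
    by_cases hxt : G.Adj x t
    · refine htQ (hQmax (y := insert t Q) ⟨hQ1.insert_of_exists (fun _ _ h => h.symm) hq htq,
        hQ2.insert_of_exists (fun _ _ h => h.symm) hq' ((SimpleGraph.compl_adj _ _ _).2
          ⟨?_, htq'⟩), ?_⟩ (Set.subset_insert _ _) (.inl rfl))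
      · rintro rfl
        exact htQ hq'
      · rintro w (rfl | hw)
        · exact ⟨htC, hxt⟩
        · exact hQA hw
    · rcases domB t htC hxt ⟨q, (hQA hq).1, (hQA hq).2, htq.symm⟩ q' (hQA hq').1 with h | h
      · exact hxt (h ▸ (hQA hq').2)
      · exact htq' h.symm
  have hut : G.Adj u t := (hC.closed q (hQA hq).1 t htq.symm).resolve_right htC
  -- the neighbourhood of `t` in `C` is a proper subset of that of `x`
  obtain ⟨α, hα, htα, ρ, hρ, htρ, hαρ⟩ := hQ2 {w | G.Adj t w} ⟨q, hq, htq⟩ ⟨q', hq', htq'⟩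
  have hρA : ∀ a ∈ C, G.Adj t a → ¬ G.Adj a ρ := fun a ha hta haρ => by
    rcases dom hut ha (hQA hρ).1 hta htρ haρ α (hQA hα).1 with h | h
    · exact hαρ.ne h
    · exact ((SimpleGraph.compl_adj _ _ _).1 hαρ).2 h
  have hsub : (Finset.univ.filter fun c => c ∈ C ∧ G.Adj t c) ⊂
      (Finset.univ.filter fun c => c ∈ C ∧ G.Adj x c) := by
    rw [Finset.ssubset_iff_of_subset]
    · exact ⟨ρ, by simpa using ⟨(hQA hρ).1, (hQA hρ).2⟩, by
        rw [Finset.mem_filter]; rintro ⟨_, _, h⟩; exact htρ h⟩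
    · intro c hc
      obtain ⟨-, hcC, htc⟩ := Finset.mem_filter.1 hc
      refine Finset.mem_filter.2 ⟨Finset.mem_univ _, hcC, ?_⟩
      by_contra hxc
      by_cases hB : ∃ a ∈ C, G.Adj x a ∧ G.Adj a c
      · rcases domB c hcC hxc hB ρ (hQA hρ).1 with h | h
        · exact hxc (h ▸ (hQA hρ).2)
        · exact hρA c hcC htc h.symm
      · rcases dom hut (hQA hq).1 (hQA hq').1 htq htq' hqq c hcC with h | h
        · exact hxc (h ▸ (hQA hq').2)
        · exact hB ⟨q', (hQA hq').1, (hQA hq').2, h.symm⟩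
  exact absurd (hxmin t ⟨hut, q, (hQA hq).1, q', (hQA hq').1, htq, htq', hqq⟩)
    (not_le.2 (Finset.card_lt_card hsub))

/-- In a connected and co-connected graph, overlapping proper modules have a proper union. -/
theorem IsModule.union (hconn : CutConnected G.Adj Set.univ) (hco : CutConnected Gᶜ.Adj Set.univ)
    {M N : Set V} (hM : IsModule G M) (hN : IsModule G N) (hM' : M ≠ Set.univ) (hN' : N ≠ Set.univ)
    {z : V} (hzM : z ∈ M) (hzN : z ∈ N) : IsModule G (M ∪ N) ∧ M ∪ N ≠ Set.univ := by
  constructor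
  · intro v hv
    rw [Set.mem_union, not_or] at hv
    have h : ∀ x ∈ M ∪ N, G.Adj v x ↔ G.Adj v z := by
      rintro x (hx | hx)
      · exact ⟨hM v hv.1 x hx z hzM, hM v hv.1 z hzM x hx⟩
      · exact ⟨hN v hv.2 x hx z hzN, hN v hv.2 z hzN x hx⟩
    intro x hx y hy hvx
    rwa [h y hy, ← h x hx]
  · intro huniv
    obtain ⟨p, hp⟩ := (Set.ne_univ_iff_exists_notMem N).1 hN'
    obtain ⟨q, hq⟩ := (Set.ne_univ_iff_exists_notMem M).1 hM'
    have hor : ∀ v, v ∈ M ∨ v ∈ N := fun v => by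
      have : v ∈ M ∪ N := huniv ▸ Set.mem_univ v
      simpa using this
    have hqN := (hor q).resolve_left hq
    have key : ∀ a ∉ N, ∀ b ∈ N, (G.Adj a b ↔ G.Adj p q) := by
      intro a ha b hb
      have haM := (hor a).resolve_right ha
      have hpM := (hor p).resolve_right hp
      have h1 : G.Adj a b ↔ G.Adj a q := ⟨hN a ha b hb q hqN, hN a ha q hqN b hb⟩
      rw [h1, G.adj_comm a, G.adj_comm p]
      exact ⟨hM q hq a haM p hpM, hM q hq p hpM a haM⟩
    by_cases hpq : G.Adj p q
    · obtain ⟨c, _, hc, d, _, hd, hcd⟩ := hco N ⟨q, trivial, hqN⟩ ⟨p, trivial, hp⟩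
      exact ((SimpleGraph.compl_adj _ _ _).1 hcd).2 ((key d hd c hc).2 hpq).symm
    · obtain ⟨c, _, hc, d, _, hd, hcd⟩ := hconn N ⟨q, trivial, hqN⟩ ⟨p, trivial, hp⟩
      exact hpq ((key d hd c hc).1 hcd.symm)

/-- The structure theorem. A connected graph with `EndsDominate` either has a balanced separator
made of two twin classes, or its vertices can be partitioned into classes, each of which has a
complete vertex outside it, such that in every maximal independent set at most three vertices
already dominate all edges between different classes. -/
theorem hasTwinSeparator_or_exists_classes [Fintype V] (hG : EndsDominate G)
    (hconn : CutConnected G.Adj Set.univ) (hcard : 2 ≤ Fintype.card V) :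
    HasTwinSeparator G ∨ ∃ r : V → V → Prop, Equivalence r ∧
      (∀ v, ∃ x, ∀ w, r v w → G.Adj x w) ∧
      ∀ I : Finset V, (∀ a ∈ I, ∀ b ∈ I, ¬ G.Adj a b) → (∀ v, v ∈ I ∨ ∃ i ∈ I, G.Adj v i) →
        ∃ J ⊆ I, J.card ≤ 3 ∧ ∀ a b, (∀ j ∈ J, ¬ G.Adj j a) → (∀ j ∈ J, ¬ G.Adj j b) →
          G.Adj a b → r a b := by
  classical
  by_cases hsep : HasTwinSeparator G
  · exact .inl hsep
  right
  have : Nontrivial V := Fintype.one_lt_card_iff_nontrivial.1 hcard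
  have hne : ∀ I : Finset V, (∀ v, v ∈ I ∨ ∃ i ∈ I, G.Adj v i) → I.Nonempty := fun I hI => by
    obtain ⟨v, -⟩ := exists_pair_ne V
    rcases hI v with h | ⟨i, h, -⟩
    · exact ⟨v, h⟩
    · exact ⟨i, h⟩
  -- if the complement is connected, the classes are the maximal proper modules
  by_cases hco : CutConnected Gᶜ.Adj Set.univ
  · refine ⟨SameModule G, ⟨?_, ?_, ?_⟩, ?_, fun I hI hmax =>
      exists_triple_of_maximal_independent hG hsep hI hmax (hne I hmax)⟩
    · intro v
      refine ⟨{v}, ?_, ?_, rfl, rfl⟩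
      · rintro w - x rfl y rfl h
        exact h
      · intro h
        obtain ⟨w, hw⟩ := exists_ne v
        exact hw (by have : w ∈ ({v} : Set V) := h ▸ Set.mem_univ w
                     simpa using this)
    · rintro a b ⟨M, h1, h2, h3, h4⟩
      exact ⟨M, h1, h2, h4, h3⟩
    · rintro a b c ⟨M, h1, h2, h3, h4⟩ ⟨N, k1, k2, k3, k4⟩
      obtain ⟨h, h'⟩ := h1.union hconn hco k1 h2 k2 h4 k3
      exact ⟨M ∪ N, h, h', .inl h3, .inr k4⟩
    · intro v
      have h0 : (fun M : Set V => IsModule G M ∧ M ≠ Set.univ ∧ v ∈ M) {v} := by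
        refine ⟨?_, ?_, rfl⟩
        · rintro w - x rfl y rfl h
          exact h
        · intro h
          obtain ⟨w, hw⟩ := exists_ne v
          exact hw (by have : w ∈ ({v} : Set V) := h ▸ Set.mem_univ w
                       simpa using this)
      obtain ⟨M, -, hM₀, hmax⟩ := Finite.exists_le_maximal
        (p := fun M : Set V => IsModule G M ∧ M ≠ Set.univ ∧ v ∈ M) h0
      obtain ⟨hM, hMu, hv⟩ := hM₀
      obtain ⟨p, hp⟩ := (Set.ne_univ_iff_exists_notMem M).1 hMu
      obtain ⟨c, _, hc, x, _, hx, hcx⟩ := hconn M ⟨v, trivial, hv⟩ ⟨p, trivial, hp⟩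
      refine ⟨x, fun w hvw => ?_⟩
      obtain ⟨N, hN, hNu, hvN, hwN⟩ := hvw
      obtain ⟨h, h'⟩ := hM.union hconn hco hN hMu hNu hv hvN
      have hw : w ∈ M := hmax (y := M ∪ N) ⟨h, h', .inl hv⟩ Set.subset_union_left (.inr hwN)
      exact hM x hx c hc w hw hcx.symm
  · -- the graph is the join of `Y` and its complement, which serve as classes
    simp only [CutConnected] at hco
    push Not at hco
    obtain ⟨Y, ⟨p, _, hp⟩, ⟨q, _, hq⟩, hY⟩ := hco
    have hadj : ∀ a ∈ Y, ∀ b ∉ Y, G.Adj a b := by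
      intro a ha b hb
      by_contra h
      exact hY a trivial ha b trivial hb ((SimpleGraph.compl_adj _ _ _).2
        ⟨by rintro rfl; exact hb ha, h⟩)
    refine ⟨fun a b => a ∈ Y ↔ b ∈ Y, ⟨fun _ => Iff.rfl, fun h => h.symm, fun h h' => h.trans h'⟩,
      fun v => ?_, fun I hI hmax => ?_⟩
    · by_cases hv : v ∈ Y
      · exact ⟨q, fun w hw => (hadj w (hw.1 hv) q hq).symm⟩
      · exact ⟨p, fun w hw => hadj p hp w fun h => hv (hw.2 h)⟩
    · obtain ⟨u, hu⟩ := hne I hmax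
      refine ⟨{u}, by simpa using hu, by simp, fun a b ha hb _ => ?_⟩
      simp only [Finset.mem_singleton, forall_eq] at ha hb
      have key : ∀ a, ¬ G.Adj u a → (a ∈ Y ↔ u ∈ Y) := fun a ha =>
        ⟨fun h => by_contra fun h' => ha (hadj a h u h').symm,
          fun h => by_contra fun h' => ha (hadj u h a h')⟩
      exact (key a ha).trans (key b hb).symm

end DominatingTriples

section ConflictGraph

/-! ### The conflict graph -/

/-- The pairs (vertex, color) are coded by natural numbers: for `0 < k`, the number `p` stands for
the vertex `p / k` and the color `p % k`. Two pairs clash if they have the same color and adjacent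
vertices. -/
def Clash (G : SimpleGraph ℕ) (k p q : ℕ) : Prop := p % k = q % k ∧ G.Adj (p / k) (q / k)

/-- Two pairs are in conflict if they have the same vertex or clash, that is, if (unless they are
equal) they cannot both be part of a partial coloring. -/
def Conflict (G : SimpleGraph ℕ) (k p q : ℕ) : Prop := p / k = q / k ∨ Clash G k p q

/-- A set of pairs that encodes a partial coloring. -/
def IsIndep (G : SimpleGraph ℕ) (k : ℕ) (I : Finset ℕ) : Prop :=
  ∀ p ∈ I, ∀ q ∈ I, p ≠ q → ¬ Conflict G k p q

open Classical in
/-- The largest weight of a partial coloring that uses only pairs from `Q`. -/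
noncomputable def opt (G : SimpleGraph ℕ) (k : ℕ) (w : ℕ → ℚ≥0) (Q : Finset ℕ) : ℚ≥0 :=
  (Q.powerset.filter (IsIndep G k)).sup fun I => ∑ p ∈ I, w p

/-- The vertices that occur in a set of pairs. -/
def verts (k : ℕ) (Q : Finset ℕ) : Finset ℕ := Q.image (· / k)

open Classical in
/-- The component of `r` in the conflict graph restricted to `P`. -/
noncomputable def comp (G : SimpleGraph ℕ) (k : ℕ) (P : Finset ℕ) (r : ℕ) : Finset ℕ :=
  P.filter (· ∈ reachSet (Conflict G k) (P : Set ℕ) r)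

open Classical in
/-- What remains of `Q` after a guess `J`: pairs that clash with `J` are deleted, and on `S` only
the pairs from `J` are kept if `e` holds. For the right guess, `J` is the part of the
solution in `S` if `e` holds; otherwise `J` consists of pairs that clash with nothing in the
solution, but need not belong to it. -/
noncomputable def restrict (G : SimpleGraph ℕ) (k : ℕ) (Q S J : Finset ℕ) (e : Prop) : Finset ℕ :=
  Q.filter fun q => (e → q ∈ S → q ∈ J) ∧ ∀ j ∈ J, ¬ Clash G k j q

/-- The vertices of `p` and `q` are equal or adjacent. -/
def Near (G : SimpleGraph ℕ) (k p q : ℕ) : Prop := p / k = q / k ∨ G.Adj (p / k) (q / k)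

open Classical in
/-- The pairs in `Q` whose vertex has the same closed neighbourhood, within `Q`, as that of `p`. -/
noncomputable def twins (G : SimpleGraph ℕ) (k : ℕ) (Q : Finset ℕ) (p : ℕ) : Finset ℕ :=
  Q.filter fun r => ∀ z ∈ Q, (Near G k p z ↔ Near G k r z)

/-- All components of `Q \ S` have at most half of the vertices of `Q`. -/
def IsBalanced (G : SimpleGraph ℕ) (k : ℕ) (Q S : Finset ℕ) : Prop :=
  ∀ r ∈ Q \ S, 2 * (verts k (comp G k (Q \ S) r)).card ≤ (verts k Q).card

/-- All cliques inside `D` have at most `c` vertices. -/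
def CliqueLE (G : SimpleGraph ℕ) (D : Finset ℕ) (c : ℕ) : Prop :=
  ∀ K ⊆ D, G.IsClique (K : Set ℕ) → K.card ≤ c

variable {G : SimpleGraph ℕ} {k : ℕ} {w : ℕ → ℚ≥0}

theorem Clash.symm {p q : ℕ} (h : Clash G k p q) : Clash G k q p := ⟨h.1.symm, h.2.symm⟩

theorem Conflict.symm {p q : ℕ} (h : Conflict G k p q) : Conflict G k q p :=
  h.imp Eq.symm Clash.symm

theorem IsIndep.mono {I I' : Finset ℕ} (h : IsIndep G k I) (hI : I' ⊆ I) : IsIndep G k I' :=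
  fun p hp q hq => h p (hI hp) q (hI hq)

theorem le_opt {I Q : Finset ℕ} (hI : IsIndep G k I) (hIQ : I ⊆ Q) :
    ∑ p ∈ I, w p ≤ opt G k w Q := by
  classical
  exact Finset.le_sup (f := fun I => ∑ p ∈ I, w p)
    (Finset.mem_filter.2 ⟨Finset.mem_powerset.2 hIQ, hI⟩)

theorem opt_le {Q : Finset ℕ} {x : ℚ≥0} (h : ∀ I ⊆ Q, IsIndep G k I → ∑ p ∈ I, w p ≤ x) :
    opt G k w Q ≤ x := by
  classical
  refine Finset.sup_le fun I hI => ?_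
  rw [Finset.mem_filter, Finset.mem_powerset] at hI
  exact h I hI.1 hI.2

theorem exists_eq_opt (G : SimpleGraph ℕ) (k : ℕ) (w : ℕ → ℚ≥0) (Q : Finset ℕ) :
    ∃ I ⊆ Q, IsIndep G k I ∧ ∑ p ∈ I, w p = opt G k w Q := by
  classical
  obtain ⟨I, hI, h⟩ := Finset.exists_mem_eq_sup (Q.powerset.filter (IsIndep G k))
    ⟨∅, by simp [IsIndep]⟩ fun I => ∑ p ∈ I, w p
  rw [Finset.mem_filter, Finset.mem_powerset] at hI
  exact ⟨I, hI.1, hI.2, h.symm⟩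

theorem opt_mono {P Q : Finset ℕ} (h : P ⊆ Q) : opt G k w P ≤ opt G k w Q :=
  opt_le fun _ hI hI' => le_opt hI' (hI.trans h)

theorem opt_empty : opt G k w ∅ = 0 := by
  refine le_antisymm (opt_le fun I hI _ => ?_) zero_le
  rw [Finset.subset_empty.1 hI]
  simp

/-- Without conflicts between `C` and `P \ C`, the two parts can be solved independently. -/
theorem opt_eq_add {P C : Finset ℕ} (hC : C ⊆ P) (h : ∀ p ∈ C, ∀ q ∈ P \ C, ¬ Conflict G k p q) :
    opt G k w P = opt G k w C + opt G k w (P \ C) := by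
  apply le_antisymm
  · refine opt_le fun I hI hI' => ?_
    rw [← Finset.sum_inter_add_sum_sdiff I C]
    exact add_le_add (le_opt (hI'.mono Finset.inter_subset_left) Finset.inter_subset_right)
      (le_opt (hI'.mono Finset.sdiff_subset) (Finset.sdiff_subset_sdiff hI subset_rfl))
  · obtain ⟨I, hI, hI', e⟩ := exists_eq_opt G k w C
    obtain ⟨K, hK, hK', e'⟩ := exists_eq_opt G k w (P \ C)
    have hd : Disjoint I K := Finset.disjoint_of_subset_left hI
      (Finset.disjoint_of_subset_right hK Finset.disjoint_sdiff)
    rw [← e, ← e', ← Finset.sum_union hd]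
    refine le_opt ?_ (Finset.union_subset (hI.trans hC) (hK.trans Finset.sdiff_subset))
    intro p hp q hq hpq
    rcases Finset.mem_union.1 hp with hp | hp <;> rcases Finset.mem_union.1 hq with hq | hq
    · exact hI' p hp q hq hpq
    · exact h p (hI hp) q (hK hq)
    · exact fun hc => h q (hI hq) p (hK hp) hc.symm
    · exact hK' p hp q hq hpq

theorem opt_of_subsingleton_verts {Q : Finset ℕ} (h : (verts k Q).card ≤ 1) {b : ℚ≥0}
    (hb : ∀ p ∈ Q, w p ≤ b) : opt G k w Q ≤ b := by
  refine opt_le fun I hI hI' => ?_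
  have : I.card ≤ 1 := by
    refine Finset.card_le_one.2 fun p hp q hq => ?_
    by_contra hpq
    exact hI' p hp q hq hpq (.inl (Finset.card_le_one.1 h _ (Finset.mem_image_of_mem _ (hI hp)) _
      (Finset.mem_image_of_mem _ (hI hq))))
  rcases Finset.card_le_one_iff_subset_singleton.1 this with ⟨p, hp⟩
  rcases Finset.subset_singleton_iff.1 hp with rfl | rfl
  · simp
  · simpa using hb p (hI (Finset.mem_singleton_self p))

theorem weight_le_opt {Q : Finset ℕ} {p : ℕ} (hp : p ∈ Q) : w p ≤ opt G k w Q := by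
  have := le_opt (G := G) (k := k) (w := w) (I := {p}) (Q := Q) (by
    intro a ha b hb hab
    rw [Finset.mem_singleton] at ha hb
    exact absurd (ha.trans hb.symm) hab) (by simpa using hp)
  simpa using this

/-! ### Components -/

theorem comp_subset (P : Finset ℕ) (r : ℕ) : comp G k P r ⊆ P := by
  classical
  exact Finset.filter_subset _ _

theorem mem_comp {P : Finset ℕ} {r q : ℕ} (hr : r ∈ P) :
    q ∈ comp G k P r ↔ q ∈ reachSet (Conflict G k) (P : Set ℕ) r := by
  classical
  rw [comp, Finset.mem_filter, and_iff_right_iff_imp]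
  exact fun h => reachSet_subset (P := (P : Set ℕ)) hr h

theorem self_mem_comp {P : Finset ℕ} {r : ℕ} (hr : r ∈ P) : r ∈ comp G k P r :=
  (mem_comp hr).2 (self_mem_reachSet _ _ _)

theorem comp_subset_of_closed {P C : Finset ℕ} {r : ℕ} (hr : r ∈ P) (hrC : r ∈ C)
    (h : ∀ x ∈ C, ∀ p ∈ P, Conflict G k x p → p ∈ C) : comp G k P r ⊆ C := by
  intro q hq
  rw [mem_comp hr] at hq
  induction hq with
  | refl => exact hrC
  | tail _ h' ih => exact h _ ih _ h'.2 h'.1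

theorem comp_cutConnected {P : Finset ℕ} {r : ℕ} (hr : r ∈ P) :
    CutConnected (Conflict G k) (comp G k P r : Set ℕ) := by
  have : (comp G k P r : Set ℕ) = reachSet (Conflict G k) (P : Set ℕ) r := by
    ext q
    exact mem_comp hr
  rw [this]
  exact reachSet_cutConnected (fun _ _ => Conflict.symm) _ _

theorem not_conflict_of_comp {P : Finset ℕ} {r : ℕ} (hr : r ∈ P) :
    ∀ p ∈ comp G k P r, ∀ q ∈ P \ comp G k P r, ¬ Conflict G k p q := by
  intro p hp q hq h
  rw [Finset.mem_sdiff] at hq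
  exact hq.2 ((mem_comp hr).2 (reachSet_closed ((mem_comp hr).1 hp) h hq.1))

theorem comp_eq_of_mem {P : Finset ℕ} {r q : ℕ} (hr : r ∈ P) (hq : q ∈ comp G k P r) :
    comp G k P q = comp G k P r := by
  have hqP := comp_subset P r hq
  have h1 : comp G k P r ⊆ comp G k P q := fun x hx => (mem_comp hqP).2
    ((comp_cutConnected hr).subset_reachSet (Finset.coe_subset.2 (comp_subset P r)) hq hx)
  refine Finset.Subset.antisymm (fun x hx => (mem_comp hr).2 ?_) h1
  exact (comp_cutConnected hqP).subset_reachSet (Finset.coe_subset.2 (comp_subset P q))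
    (h1 (self_mem_comp hr)) hx

/-- Deleting one component does not change the others. -/
theorem comp_sdiff_comp {P : Finset ℕ} {r r' : ℕ} (hr : r ∈ P) (hr' : r' ∈ P \ comp G k P r) :
    comp G k (P \ comp G k P r) r' = comp G k P r' := by
  have hr'P := (Finset.mem_sdiff.1 hr').1
  apply Finset.Subset.antisymm
  · intro q hq
    rw [mem_comp hr'P]
    rw [mem_comp hr'] at hq
    induction hq with
    | refl => exact self_mem_reachSet _ _ _
    | tail _ h ih => exact reachSet_closed ih h.1 (Finset.mem_sdiff.1 h.2).1
  · intro q hq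
    rw [mem_comp hr'P] at hq
    rw [mem_comp hr']
    induction hq with
    | refl => exact self_mem_reachSet _ _ _
    | tail _ h ih =>
      refine reachSet_closed ih h.1 ?_
      have hb := reachSet_subset (P := ((P \ comp G k P r : Finset ℕ) : Set ℕ)) hr' ih
      refine Finset.mem_coe.2 (Finset.mem_sdiff.2 ⟨h.2, fun hc => ?_⟩)
      exact not_conflict_of_comp hr _ hc _ hb h.1.symm

/-- `R` is a union of components of `P` without elements below `i`; it is what remains of `P` after
the components that meet `0, …, i - 1` have been deleted. -/
structure IsRest (G : SimpleGraph ℕ) (k : ℕ) (P : Finset ℕ) (i : ℕ) (R : Finset ℕ) : Prop where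
  subset : R ⊆ P
  le : ∀ r ∈ R, i ≤ r
  comp_eq : ∀ r ∈ R, comp G k R r = comp G k P r

theorem IsRest.refl (P : Finset ℕ) : IsRest G k P 0 P :=
  ⟨subset_rfl, fun _ _ => Nat.zero_le _, fun _ _ => rfl⟩

theorem IsRest.next {P R : Finset ℕ} {i : ℕ} (h : IsRest G k P i R) (hi : i ∉ R) :
    IsRest G k P (i + 1) R :=
  ⟨h.subset, fun r hr => Nat.lt_of_le_of_ne (h.le r hr) fun e => hi (e ▸ hr), h.comp_eq⟩

theorem IsRest.next_sdiff {P R : Finset ℕ} {i : ℕ} (h : IsRest G k P i R) (hi : i ∈ R) :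
    IsRest G k P (i + 1) (R \ comp G k R i) := by
  refine ⟨Finset.sdiff_subset.trans h.subset, fun r hr => ?_, fun r hr => ?_⟩
  · have h' := Finset.mem_sdiff.1 hr
    refine Nat.lt_of_le_of_ne (h.le r h'.1) ?_
    rintro rfl
    exact h'.2 (self_mem_comp hi)
  · rw [comp_sdiff_comp hi hr, h.comp_eq r (Finset.mem_sdiff.1 hr).1]

theorem IsRest.eq_empty {P R : Finset ℕ} {i : ℕ} (h : IsRest G k P i R)
    (hP : P ⊆ Finset.range i) : R = ∅ :=
  Finset.eq_empty_of_forall_notMem fun r hr => by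
    have := h.le r hr
    have := Finset.mem_range.1 (hP (h.subset hr))
    omega

theorem card_verts_eq_add {P : Finset ℕ} {r : ℕ} (hr : r ∈ P) :
    (verts k P).card = (verts k (comp G k P r)).card + (verts k (P \ comp G k P r)).card := by
  rw [← Finset.card_union_of_disjoint, verts, verts, verts, ← Finset.image_union,
    Finset.union_sdiff_of_subset (comp_subset P r)]
  rw [Finset.disjoint_left]
  intro v hv hv'
  obtain ⟨p, hp, rfl⟩ := Finset.mem_image.1 hv
  obtain ⟨q, hq, hpq⟩ := Finset.mem_image.1 hv'
  exact not_conflict_of_comp hr p hp q hq (.inl hpq.symm)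

/-- A connected set of pairs occupies a connected set of vertices. -/
theorem CutConnected.verts {C : Finset ℕ} (hC : CutConnected (Conflict G k) (C : Set ℕ)) :
    CutConnected G.Adj (verts k C : Set ℕ) := by
  rintro Y ⟨c, hc, hcY⟩ ⟨d, hd, hdY⟩
  obtain ⟨p, hp, rfl⟩ := Finset.mem_image.1 hc
  obtain ⟨q, hq, rfl⟩ := Finset.mem_image.1 hd
  obtain ⟨a, ha, haY, b, hb, hbY, hab⟩ := hC {p | p / k ∈ Y} ⟨p, hp, hcY⟩ ⟨q, hq, hdY⟩
  rcases hab with h | h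
  · exact absurd (show b / k ∈ Y from h ▸ haY) hbY
  · exact ⟨_, Finset.mem_image_of_mem _ ha, haY, _, Finset.mem_image_of_mem _ hb, hbY, h.2⟩

theorem mem_restrict {Q S J : Finset ℕ} {e : Prop} {q : ℕ} : q ∈ restrict G k Q S J e ↔
    q ∈ Q ∧ (e → q ∈ S → q ∈ J) ∧ ∀ j ∈ J, ¬ Clash G k j q := by
  classical
  rw [restrict, Finset.mem_filter]

theorem subset_restrict {Q S J I : Finset ℕ} {e : Prop} (hIQ : I ⊆ Q)
    (h1 : e → ∀ q ∈ I, q ∈ S → q ∈ J) (h2 : ∀ q ∈ I, ∀ j ∈ J, ¬ Clash G k j q) :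
    I ⊆ restrict G k Q S J e :=
  fun q hq => mem_restrict.2 ⟨hIQ hq, fun he => h1 he q hq, h2 q hq⟩

theorem restrict_subset {Q S J : Finset ℕ} {e : Prop} : restrict G k Q S J e ⊆ Q :=
  fun _ hq => (mem_restrict.1 hq).1

/-! ### The guesses -/

/-- Guessing the solution on a balanced set of twin classes leaves small components: a guessed pair
has no conflicts left and is a component by itself, and all other components avoid `S`. Only that
`S` is closed under changing the color is used of the twin classes. -/
theorem restrict_balanced {Q S I : Finset ℕ} (hcard : 2 ≤ (verts k Q).card)
    (hS : ∀ p ∈ S, ∀ q ∈ Q, p / k = q / k → q ∈ S)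
    (hbal : IsBalanced G k Q S) (hIQ : I ⊆ Q) (hI : IsIndep G k I) :
    I ⊆ restrict G k Q S (I ∩ S) True ∧ ∀ r ∈ restrict G k Q S (I ∩ S) True,
      2 * (verts k (comp G k (restrict G k Q S (I ∩ S) True) r)).card ≤ (verts k Q).card := by
  classical
  constructor
  · refine subset_restrict hIQ (fun _ q hq hqS => Finset.mem_inter.2 ⟨hq, hqS⟩) fun q hq j hj h => ?_
    rw [Finset.mem_inter] at hj
    refine hI j hj.1 q hq ?_ (.inr h)
    rintro rfl
    exact h.2.ne rfl
  · intro r hr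
    set P := restrict G k Q S (I ∩ S) True with hP
    have hPm : ∀ q ∈ P, q ∈ Q ∧ (q ∈ S → q ∈ I) ∧ ∀ j ∈ I, j ∈ S → ¬ Clash G k j q := by
      intro q hq
      obtain ⟨h1, h2, h3⟩ := mem_restrict.1 hq
      exact ⟨h1, fun h => (Finset.mem_inter.1 (h2 trivial h)).1,
        fun j hj hjS => h3 j (Finset.mem_inter.2 ⟨hj, hjS⟩)⟩
    have hCP : comp G k P r ⊆ P := comp_subset P r
    have hconn := comp_cutConnected (G := G) (k := k) hr
    by_cases hCS : ∃ p ∈ comp G k P r, p ∈ S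
    · obtain ⟨p, hp, hpS⟩ := hCS
      have hpI := (hPm p (hCP hp)).2.1 hpS
      have hsing : comp G k P r ⊆ {p} := by
        by_contra hcon
        obtain ⟨q, hq, hqp⟩ := Finset.not_subset.1 hcon
        obtain ⟨c, hc, hcp, d, hd, hdp, hcd⟩ := hconn {p} ⟨p, hp, rfl⟩
          ⟨q, hq, by simpa using hqp⟩
        obtain rfl : c = p := hcp
        rcases hcd with h | h
        · have hdS := hS c hpS d (hPm d (hCP hd)).1 h
          exact hI c hpI d ((hPm d (hCP hd)).2.1 hdS) (fun h => hdp h.symm) (.inl h)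
        · exact (hPm d (hCP hd)).2.2 c hpI hpS h
      have : (verts k (comp G k P r)).card ≤ 1 :=
        (Finset.card_image_le).trans ((Finset.card_le_card hsing).trans (by simp))
      omega
    · push Not at hCS
      have hsub : (comp G k P r : Set ℕ) ⊆ ((Q \ S : Finset ℕ) : Set ℕ) := fun q hq =>
        Finset.mem_coe.2 (Finset.mem_sdiff.2 ⟨(hPm q (hCP hq)).1, hCS q hq⟩)
      have hrC := self_mem_comp (G := G) (k := k) hr
      have hrQ := Finset.mem_coe.1 (hsub hrC)
      have h1 := hconn.subset_reachSet hsub hrC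
      refine le_trans ?_ (hbal r hrQ)
      refine Nat.mul_le_mul_left _ (Finset.card_le_card (Finset.image_subset_image fun q hq => ?_))
      exact (mem_comp hrQ).2 (h1 hq)

theorem mul_add_div_of_lt {v c : ℕ} (hc : c < k) : (v * k + c) / k = v := by
  rw [mul_comm, Nat.mul_add_div (by omega), Nat.div_eq_of_lt hc, add_zero]

theorem mul_add_mod_of_lt {v c : ℕ} (hc : c < k) : (v * k + c) % k = c := by
  rw [mul_comm, Nat.mul_add_mod, Nat.mod_eq_of_lt hc]

theorem EndsDominate.induce {V : Type*} {G : SimpleGraph V} (hG : EndsDominate G) (s : Set V) :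
    EndsDominate (G.induce s) := by
  intro a b c d h1 h2 h3 h4 h5 h6 x hx
  rcases hG (a := a) (b := b) (c := c) (d := d) h1 h2 h3 h4 h5 h6 (x := x) hx with h | h | h | h
  · exact .inl h
  · exact .inr (.inl h)
  · exact .inr (.inr (.inl (Subtype.ext h)))
  · exact .inr (.inr (.inr (Subtype.ext h)))

/-- The structure theorem for connected sets of pairs: if no two twin classes form a balanced
separator, then a guess of at most three vertices per color leaves only components that are
dominated by a single vertex. The guess consists of vertices of maximal independent sets that
contain the color classes of the solution `I`, hence `I` itself survives. -/
theorem exists_guess (hG : EndsDominate G) (hk : 0 < k) {Q I : Finset ℕ}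
    (hQ : CutConnected (Conflict G k) (Q : Set ℕ)) (hcard : 2 ≤ (verts k Q).card)
    (hsep : ¬ ∃ p ∈ Q, ∃ p' ∈ Q, IsBalanced G k Q (twins G k Q p ∪ twins G k Q p'))
    (hIQ : I ⊆ Q) (hI : IsIndep G k I) :
    ∃ J : Finset ℕ, (∀ j ∈ J, j / k ∈ verts k Q) ∧ (∀ c, (J.filter (· % k = c)).card ≤ 3) ∧
      ∀ S, I ⊆ restrict G k Q S J False ∧ ∀ r ∈ restrict G k Q S J False,
        ∃ x ∈ Q, ∀ q ∈ comp G k (restrict G k Q S J False) r, G.Adj (x / k) (q / k) := by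
  classical
  set D := verts k Q with hD
  set H := G.induce (D : Set ℕ) with hH
  have hHadj : ∀ a b : (D : Set ℕ), H.Adj a b ↔ G.Adj a b := fun _ _ => Iff.rfl
  have hDQ : ∀ v ∈ D, ∃ p ∈ Q, p / k = v := fun v hv => by
    simpa [hD, verts] using hv
  have hQD : ∀ q ∈ Q, q / k ∈ D := fun q hq => Finset.mem_image_of_mem _ hq
  have hconn : CutConnected H.Adj Set.univ := by
    rintro Y ⟨c, -, hc⟩ ⟨d, -, hd⟩
    obtain ⟨a, ha, ⟨ha', haY⟩, b, hb, hbY, hab⟩ := hQ.verts {v | ∃ h : v ∈ D, ⟨v, h⟩ ∈ Y}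
      ⟨c, c.2, c.2, hc⟩ ⟨d, d.2, fun ⟨_, h⟩ => hd h⟩
    exact ⟨⟨a, ha⟩, trivial, haY, ⟨b, hb⟩, trivial, fun h => hbY ⟨hb, h⟩, hab⟩
  have hHcard : Fintype.card (D : Set ℕ) = D.card := by simp
  rcases hasTwinSeparator_or_exists_classes (hG.induce (D : Set ℕ)) hconn
    (by rw [hHcard]; exact hcard) with
    ⟨a, b, hab⟩ | ⟨r, hr, hdom, hguess⟩
  · exfalso
    obtain ⟨p, hp, hpa⟩ := hDQ a a.2
    obtain ⟨p', hp', hpb⟩ := hDQ b b.2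
    refine hsep ⟨p, hp, p', hp', fun q hq => ?_⟩
    set S := twins G k Q p ∪ twins G k Q p'
    set C := comp G k (Q \ S) q with hCdef
    have hCQ : ∀ c ∈ C, c ∈ Q ∧ c ∉ S := fun c hc => Finset.mem_sdiff.1 (comp_subset _ _ hc)
    have hCc := (comp_cutConnected (G := G) (k := k) hq).verts
    have key := hab ((verts k C).subtype (· ∈ (D : Set ℕ))) ?_ ?_
    · rw [hHcard, Finset.card_subtype, Finset.filter_true_of_mem] at key
      · exact key
      · intro v hv
        obtain ⟨c, hc, rfl⟩ := Finset.mem_image.1 hv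
        exact hQD c (hCQ c hc).1
    · rintro Y ⟨c, hc, hcY⟩ ⟨d, hd, hdY⟩
      obtain ⟨a, ha, ⟨ha', haY⟩, b, hb, hbY, hab⟩ := hCc {v | ∃ h : v ∈ D, ⟨v, h⟩ ∈ Y}
        ⟨c, by simpa using hc, c.2, hcY⟩ ⟨d, by simpa using hd, fun ⟨_, h⟩ => hdY h⟩
      have hbD : b ∈ D := by
        obtain ⟨c, hc, rfl⟩ := Finset.mem_image.1 hb
        exact hQD c (hCQ c hc).1
      exact ⟨⟨a, ha'⟩, by simpa using ha, haY, ⟨b, hbD⟩, by simpa using hb,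
        fun h => hbY ⟨hbD, h⟩, hab⟩
    · intro c hc
      obtain ⟨c', hc', hcc⟩ := Finset.mem_image.1 (Finset.mem_subtype.1 hc)
      have tw : ∀ (a : (D : Set ℕ)) (p : ℕ), p / k = a → IsTwin H a c → c' ∈ twins G k Q p := by
        intro a p hpa h
        refine Finset.mem_filter.2 ⟨(hCQ c' hc').1, fun z hz => ?_⟩
        have := h ⟨z / k, hQD z hz⟩
        simp only [Near, hpa, hcc]
        rw [hHadj, hHadj, Subtype.ext_iff, Subtype.ext_iff] at this
        rw [eq_comm, this, eq_comm]
      exact ⟨fun h => (hCQ c' hc').2 (Finset.mem_union_left _ (tw a p hpa h)),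
        fun h => (hCQ c' hc').2 (Finset.mem_union_right _ (tw b p' hpb h))⟩
  · -- extend every color class to a maximal independent set
    have hcol : ∀ c, ∃ J : Finset (D : Set ℕ), J.card ≤ 3 ∧
        (∀ i ∈ I, i % k = c → ∀ j ∈ J, ¬ G.Adj j (i / k)) ∧
        ∀ a b, (∀ j ∈ J, ¬ H.Adj j a) → (∀ j ∈ J, ¬ H.Adj j b) → H.Adj a b → r a b := by
      intro c
      have h0 : ∀ a ∈ Finset.univ.filter (fun v : (D : Set ℕ) => ∃ i ∈ I, i % k = c ∧ i / k = v),
          ∀ b ∈ Finset.univ.filter (fun v : (D : Set ℕ) => ∃ i ∈ I, i % k = c ∧ i / k = v),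
          ¬ H.Adj a b := by
        intro a ha b hb hab
        obtain ⟨i, hi, hic, hia⟩ := (Finset.mem_filter.1 ha).2
        obtain ⟨i', hi', hic', hib⟩ := (Finset.mem_filter.1 hb).2
        rw [hHadj, ← hia, ← hib] at hab
        refine hI i hi i' hi' ?_ (.inr ⟨hic.trans hic'.symm, hab⟩)
        rintro rfl
        exact hab.ne rfl
      obtain ⟨M, hsub, hM, hMmax⟩ := Finite.exists_le_maximal
        (p := fun M : Finset (D : Set ℕ) => ∀ a ∈ M, ∀ b ∈ M, ¬ H.Adj a b) h0
      obtain ⟨J, hJM, hJc, hJ⟩ := hguess M hM (by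
        intro v
        by_contra hcon
        push Not at hcon
        refine hcon.1 (hMmax (y := insert v M) ?_ (Finset.subset_insert _ _)
          (Finset.mem_insert_self _ _))
        intro a ha₀ b hb₀
        rcases Finset.mem_insert.1 ha₀ with rfl | ha <;>
          rcases Finset.mem_insert.1 hb₀ with rfl | hb
        · exact H.irrefl
        · exact hcon.2 b hb
        · exact fun h => hcon.2 a ha h.symm
        · exact hM a ha b hb)
      refine ⟨J, hJc, fun i hi hic j hj => ?_, hJ⟩
      exact hM j (hJM hj) ⟨i / k, hQD i (hIQ hi)⟩ (hsub (Finset.mem_filter.2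
        ⟨Finset.mem_univ _, i, hi, hic, rfl⟩))
    choose J hJ1 hJ2 hJ3 using hcol
    set JJ : Finset ℕ := (Finset.range k).biUnion fun c =>
      (J c).image fun j : (D : Set ℕ) => (j : ℕ) * k + c with hJJ
    have hmem : ∀ c < k, ∀ j ∈ J c, (j : ℕ) * k + c ∈ JJ := fun c hc j hj =>
      Finset.mem_biUnion.2 ⟨c, Finset.mem_range.2 hc, Finset.mem_image_of_mem _ hj⟩
    have hmem' : ∀ p ∈ JJ, ∃ j ∈ J (p % k), p / k = (j : ℕ) := by
      intro p hp
      obtain ⟨c, hc, hp⟩ := Finset.mem_biUnion.1 hp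
      obtain ⟨j, hj, rfl⟩ := Finset.mem_image.1 hp
      rw [Finset.mem_range] at hc
      rw [mul_add_mod_of_lt hc, mul_add_div_of_lt hc]
      exact ⟨j, hj, rfl⟩
    refine ⟨JJ, ?_, ?_, fun S => ⟨?_, ?_⟩⟩
    · intro p hp
      obtain ⟨j, _, h⟩ := hmem' p hp
      rw [h]
      exact j.2
    · intro c
      refine le_trans ?_ (hJ1 c)
      have : JJ.filter (· % k = c) ⊆ (J c).image fun j : (D : Set ℕ) => (j : ℕ) * k + c := by
        intro p hp
        obtain ⟨hp, hpc⟩ := Finset.mem_filter.1 hp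
        obtain ⟨c', hc, hp⟩ := Finset.mem_biUnion.1 hp
        obtain ⟨j, hj, rfl⟩ := Finset.mem_image.1 hp
        rw [Finset.mem_range] at hc
        rw [mul_add_mod_of_lt hc] at hpc
        subst hpc
        exact Finset.mem_image_of_mem _ hj
      exact (Finset.card_le_card this).trans Finset.card_image_le
    · refine subset_restrict hIQ (fun h => h.elim) fun q hq p hp h => ?_
      obtain ⟨j, hj, hpj⟩ := hmem' p hp
      refine hJ2 (p % k) q hq h.1.symm j hj ?_
      rw [← hpj]
      exact h.2
    · intro q hq
      set P := restrict G k Q S JJ False with hP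
      have hPQ : P ⊆ Q := restrict_subset
      have hCP : comp G k P q ⊆ P := comp_subset P q
      have hqQ := hPQ hq
      obtain ⟨x, hx⟩ := hdom ⟨q / k, hQD q hqQ⟩
      obtain ⟨x', hx', hxx⟩ := hDQ x x.2
      -- a component of the restricted set stays inside one class
      have hclass : ∀ p ∈ comp G k P q, ∃ h : p / k ∈ D, r ⟨q / k, hQD q hqQ⟩ ⟨p / k, h⟩ := by
        by_contra hcon
        push Not at hcon
        obtain ⟨p, hp, hpr⟩ := hcon
        obtain ⟨c, hc, ⟨hcD, hcr⟩, d, hd, hdr, hcd⟩ := comp_cutConnected (G := G) (k := k) hq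
          {p | ∃ h : p / k ∈ D, r ⟨q / k, hQD q hqQ⟩ ⟨p / k, h⟩}
          ⟨q, self_mem_comp hq, hQD q hqQ, hr.refl _⟩ ⟨p, hp, fun ⟨h, h'⟩ => hpr h h'⟩
        have hdD := hQD d (hPQ (hCP hd))
        refine hdr ⟨hdD, hr.trans hcr ?_⟩
        rcases hcd with h | h
        · have : (⟨c / k, hcD⟩ : (D : Set ℕ)) = ⟨d / k, hdD⟩ := Subtype.ext h
          rw [this]
          exact hr.refl _
        · have hna : ∀ p ∈ P, ∀ (hp : p / k ∈ D), ∀ j ∈ J (p % k), ¬ H.Adj j ⟨p / k, hp⟩ := by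
            intro p hp hpD j hj hadj
            have hck : p % k < k := Nat.mod_lt _ hk
            refine (mem_restrict.1 hp).2.2 _ (hmem _ hck j hj) ⟨?_, ?_⟩
            · rw [mul_add_mod_of_lt hck]
            · rw [mul_add_div_of_lt hck]
              exact hadj
          refine hJ3 (c % k) _ _ (hna c (hCP hc) hcD) ?_ h.2
          have := hna d (hCP hd) hdD
          rwa [← h.1] at this
      refine ⟨x', hx', fun p hp => ?_⟩
      obtain ⟨h, hpr⟩ := hclass p hp
      have := hx _ hpr
      rw [hHadj] at this
      rwa [hxx]

end ConflictGraph

section Machine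

/-! ### Weakest preconditions for the machine -/

namespace RAM

/-- `s` with the value of the local variable `x` replaced by `v`. -/
def State.setVar (s : State) (x v : ℕ) : State := { s with var := Function.update s.var x v }

/-- `s` with cell `i` of the integer array `a` replaced by `v`. -/
def State.setNat (s : State) (a i v : ℕ) : State :=
  { s with nat := Function.update s.nat a (Function.update (s.nat a) i v) }

/-- `s` with cell `i` of the rational array `a` replaced by `v`. -/
def State.setRat (s : State) (a i : ℕ) (v : ℚ≥0) : State :=
  { s with rat := Function.update s.rat a (Function.update (s.rat a) i v) }

attribute [simp] NExp.eval NExp.cost QExp.eval QExp.cost Test.eval Test.cost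

variable {procs : List Stmt} {s : State}

@[simp] theorem State.setVar_var (x v y : ℕ) :
    (s.setVar x v).var y = if y = x then v else s.var y := by
  simp [State.setVar, Function.update_apply]

@[simp] theorem State.setVar_nat (x v : ℕ) : (s.setVar x v).nat = s.nat := rfl

@[simp] theorem State.setVar_rat (x v : ℕ) : (s.setVar x v).rat = s.rat := rfl

@[simp] theorem State.setNat_var (a i v : ℕ) : (s.setNat a i v).var = s.var := rfl

@[simp] theorem State.setNat_nat (a i v a' i' : ℕ) :
    (s.setNat a i v).nat a' i' = if a' = a ∧ i' = i then v else s.nat a' i' := by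
  by_cases h : a' = a
  · subst h
    simp [State.setNat, Function.update_apply]
  · simp [State.setNat, h]

@[simp] theorem State.setNat_rat (a i v : ℕ) : (s.setNat a i v).rat = s.rat := rfl

@[simp] theorem State.setRat_var (a i : ℕ) (v : ℚ≥0) : (s.setRat a i v).var = s.var := rfl

@[simp] theorem State.setRat_nat (a i : ℕ) (v : ℚ≥0) : (s.setRat a i v).nat = s.nat := rfl

@[simp] theorem State.setRat_rat (a i : ℕ) (v : ℚ≥0) (a' i' : ℕ) :
    (s.setRat a i v).rat a' i' = if a' = a ∧ i' = i then v else s.rat a' i' := by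
  by_cases h : a' = a
  · subst h
    simp [State.setRat, Function.update_apply]
  · simp [State.setRat, h]

/-- Started in `s`, the statement `c` halts, and the number of operations and the final state
satisfy `Q`. Reasoning about programs is by computing weakest preconditions. -/
def Runs (procs : List Stmt) (c : Stmt) (s : State) (Q : ℕ → State → Prop) : Prop :=
  ∃ t s', Exec procs c s t s' ∧ Q t s'

theorem Runs.mono {c : Stmt} {Q Q' : ℕ → State → Prop} (h : Runs procs c s Q)
    (hQ : ∀ t s', Q t s' → Q' t s') : Runs procs c s Q' := by
  obtain ⟨t, s', h, h'⟩ := h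
  exact ⟨t, s', h, hQ t s' h'⟩

variable {Q : ℕ → State → Prop}

@[simp] theorem runs_skip : Runs procs .skip s Q ↔ Q 1 s :=
  ⟨fun ⟨_, _, h, h'⟩ => by cases h; exact h', fun h => ⟨_, _, .skip s, h⟩⟩

@[simp] theorem runs_set {x : ℕ} {e : NExp} :
    Runs procs (.set x e) s Q ↔ Q (e.cost + 1) (s.setVar x (e.eval s)) :=
  ⟨fun ⟨_, _, h, h'⟩ => by cases h; exact h', fun h => ⟨_, _, .set x e s, h⟩⟩

@[simp] theorem runs_put {a : ℕ} {i e : NExp} : Runs procs (.put a i e) s Q ↔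
    Q (i.cost + e.cost + 1) (s.setNat a (i.eval s) (e.eval s)) :=
  ⟨fun ⟨_, _, h, h'⟩ => by cases h; exact h', fun h => ⟨_, _, .put a i e s, h⟩⟩

@[simp] theorem runs_putRat {a : ℕ} {i : NExp} {q : QExp} : Runs procs (.putRat a i q) s Q ↔
    Q (i.cost + q.cost + 1) (s.setRat a (i.eval s) (q.eval s)) :=
  ⟨fun ⟨_, _, h, h'⟩ => by cases h; exact h', fun h => ⟨_, _, .putRat a i q s, h⟩⟩

@[simp] theorem runs_seq {c d : Stmt} : Runs procs (.seq c d) s Q ↔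
    Runs procs c s fun t s' => Runs procs d s' fun t' s'' => Q (t + t') s'' := by
  constructor
  · rintro ⟨_, _, h, h'⟩
    cases h with
    | seq h1 h2 => exact ⟨_, _, h1, _, _, h2, h'⟩
  · rintro ⟨t, s', h1, t', s'', h2, h3⟩
    exact ⟨_, _, .seq h1 h2, h3⟩

@[simp] theorem runs_ite {b : Test} {c d : Stmt} : Runs procs (.ite b c d) s Q ↔
    (b.eval s → Runs procs c s fun t s' => Q (b.cost + t) s') ∧
    (¬ b.eval s → Runs procs d s fun t s' => Q (b.cost + t) s') := by
  constructor
  · rintro ⟨_, _, h, h'⟩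
    cases h with
    | iteTrue h1 h2 => exact ⟨fun _ => ⟨_, _, h2, h'⟩, fun h => absurd h1 h⟩
    | iteFalse h1 h2 => exact ⟨fun h => absurd h h1, fun _ => ⟨_, _, h2, h'⟩⟩
  · rintro ⟨h1, h2⟩
    by_cases h : b.eval s
    · obtain ⟨t, s', h1, h3⟩ := h1 h
      exact ⟨_, _, .iteTrue h h1, h3⟩
    · obtain ⟨t, s', h1, h3⟩ := h2 h
      exact ⟨_, _, .iteFalse h h1, h3⟩

/-- The state in which the body of a procedure starts. -/
def State.enter (s : State) (args : List ℕ) : State := { s with var := fun i => args.getD i 0 }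

@[simp] theorem State.enter_var (args : List ℕ) (i : ℕ) :
    (s.enter args).var i = args.getD i 0 := rfl

@[simp] theorem State.enter_nat (args : List ℕ) : (s.enter args).nat = s.nat := rfl

@[simp] theorem State.enter_rat (args : List ℕ) : (s.enter args).rat = s.rat := rfl

/-- The state after the return from a procedure that has ended in `s'`: the caller gets its local
variables back, and the result is stored in `x`. -/
def State.leave (s : State) (x : ℕ) (s' : State) : State :=
  { s' with var := Function.update s.var x (s'.var 0) }

@[simp] theorem State.leave_var (x : ℕ) (s' : State) (y : ℕ) :
    (s.leave x s').var y = if y = x then s'.var 0 else s.var y := by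
  simp [State.leave, Function.update_apply]

@[simp] theorem State.leave_nat (x : ℕ) (s' : State) : (s.leave x s').nat = s'.nat := rfl

@[simp] theorem State.leave_rat (x : ℕ) (s' : State) : (s.leave x s').rat = s'.rat := rfl

theorem runs_call {x p : ℕ} {args : List NExp} {body : Stmt} (hp : procs[p]? = some body)
    (h : Runs procs body (s.enter (args.map (NExp.eval s))) fun t s' =>
      Q ((args.map NExp.cost).sum + t + 1) (s.leave x s')) :
    Runs procs (.call x p args) s Q := by
  obtain ⟨t, s', h1, h2⟩ := h
  exact ⟨_, _, .call hp h1, h2⟩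

/-- The procedure call leaves the arrays as they are and only stores the result. -/
theorem State.leave_eq_setVar {x : ℕ} {s' : State} (h1 : s'.nat = s.nat) (h2 : s'.rat = s.rat) :
    s.leave x s' = s.setVar x (s'.var 0) := by
  simp only [State.leave, State.setVar, ← h1, ← h2]

/-- `for x := 0 to e - 1 do c`. -/
def forLoop (x : ℕ) (e : NExp) (c : Stmt) : Stmt :=
  .seq (.set x (.const 0)) (.loop (.natLt (.var x) e) (.seq c (.set x (.add (.var x) (.const 1)))))

/-- The rule for for-loops, with an invariant that may mention the number of operations spent
so far. -/
theorem runs_forLoop {x : ℕ} {e : NExp} {c : Stmt} {N : ℕ} (Inv : ℕ → ℕ → State → Prop)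
    (h0 : Inv 2 0 (s.setVar x 0))
    (hx : ∀ t i s, Inv t i s → s.var x = i ∧ e.eval s = N)
    (hc : ∀ t i s, i < N → Inv t i s → Runs procs c s fun t' s' =>
      s'.var x = i ∧ Inv (t + t' + (e.cost + 6)) (i + 1) (s'.setVar x (i + 1)))
    (hQ : ∀ t s, Inv t N s → Q (t + (e.cost + 2)) s) :
    Runs procs (forLoop x e c) s Q := by
  have key : ∀ j t s i, N = i + j → Inv t i s → ∃ t' s',
      Exec procs (.loop (.natLt (.var x) e) (.seq c (.set x (.add (.var x) (.const 1))))) s t' s' ∧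
      Q (t + t') s' := by
    intro j
    induction j with
    | zero =>
      intro t s i hN hI
      obtain rfl : N = i := hN
      obtain ⟨h1, h2⟩ := hx t N s hI
      refine ⟨_, _, .loopFalse (b := .natLt (.var x) e) ?_, ?_⟩
      · simp [Test.eval, NExp.eval, h1, h2]
      · have := hQ t s hI
        convert this using 1
        simp only [Test.cost, NExp.cost]
        ring
    | succ j ih =>
      intro t s i hN hI
      obtain ⟨h1, h2⟩ := hx t i s hI
      obtain ⟨t1, s1, h3, h4, h5⟩ := hc t i s (by omega) hI
      obtain ⟨t2, s2, h6, h7⟩ := ih _ _ (i + 1) (by omega) h5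
      have e1 : s1.setVar x (i + 1) =
          s1.setVar x ((NExp.add (.var x) (.const 1)).eval s1) := by
        simp [NExp.eval, h4]
      rw [e1] at h6
      refine ⟨_, _, .loopTrue (b := .natLt (.var x) e) ?_ (.seq h3 (.set x _ s1)) h6, ?_⟩
      · simp only [Test.eval, NExp.eval, h1, h2]
        omega
      · convert h7 using 1
        simp only [Test.cost, NExp.cost]
        ring
  obtain ⟨t, s', h1, h2⟩ := key N 2 _ 0 (by omega) h0
  exact ⟨_, _, .seq (.set x (.const 0) s) h1, h2⟩

/-- The rule for for-loops whose body takes at most `T` operations. -/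
theorem runs_for {x : ℕ} {e : NExp} {c : Stmt} {N T : ℕ} (Inv : ℕ → State → Prop)
    (h0 : Inv 0 (s.setVar x 0))
    (hx : ∀ i s, Inv i s → s.var x = i ∧ e.eval s = N)
    (hc : ∀ i s, i < N → Inv i s → Runs procs c s fun t' s' =>
      t' ≤ T ∧ s'.var x = i ∧ Inv (i + 1) (s'.setVar x (i + 1)))
    (hQ : ∀ t s, t ≤ (N + 1) * (T + e.cost + 6) → Inv N s → Q t s) :
    Runs procs (forLoop x e c) s Q := by
  refine runs_forLoop (N := N) (fun t i s => t ≤ i * (T + e.cost + 6) + 2 ∧ Inv i s)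
    ⟨by omega, h0⟩ (fun t i s h => hx i s h.2) (fun t i s hi h => ?_) (fun t s h => ?_)
  · refine (hc i s hi h.2).mono fun t' s' h' => ⟨h'.2.1, ?_, h'.2.2⟩
    have := h.1
    rw [add_mul]
    omega
  · refine hQ _ _ ?_ h.2
    have := h.1
    rw [add_mul]
    omega

end RAM

end Machine

section Tables

/-! ### Memory contents -/

namespace RAM

/-- `s'` differs from `s` at most in the local variables, in the cells of the integer arrays
described by `W`, and in the cells of the rational arrays described by `W'`. -/
def Frame (W W' : ℕ → ℕ → Prop) (s s' : State) : Prop :=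
  (∀ a i, ¬ W a i → s'.nat a i = s.nat a i) ∧ ∀ a i, ¬ W' a i → s'.rat a i = s.rat a i

section

variable {W W' V V' : ℕ → ℕ → Prop} {s s' s'' : State}

theorem Frame.refl (W W' : ℕ → ℕ → Prop) (s : State) : Frame W W' s s :=
  ⟨fun _ _ _ => rfl, fun _ _ _ => rfl⟩

theorem Frame.trans (h : Frame W W' s s') (h' : Frame W W' s' s'') : Frame W W' s s'' :=
  ⟨fun a i hw => (h'.1 a i hw).trans (h.1 a i hw), fun a i hw => (h'.2 a i hw).trans (h.2 a i hw)⟩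

theorem Frame.mono (h : Frame W W' s s') (hV : ∀ a i, W a i → V a i)
    (hV' : ∀ a i, W' a i → V' a i) : Frame V V' s s' :=
  ⟨fun a i hw => h.1 a i fun h => hw (hV a i h), fun a i hw => h.2 a i fun h => hw (hV' a i h)⟩

theorem Frame.setVar (h : Frame W W' s s') (x v : ℕ) : Frame W W' s (s'.setVar x v) := h

theorem Frame.setNat (h : Frame W W' s s') {a i : ℕ} (hw : W a i) (v : ℕ) :
    Frame W W' s (s'.setNat a i v) := by
  refine ⟨fun a' i' hw' => ?_, h.2⟩
  rw [State.setNat_nat, if_neg, h.1 a' i' hw']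
  rintro ⟨rfl, rfl⟩
  exact hw' hw

theorem Frame.setRat (h : Frame W W' s s') {a i : ℕ} (hw : W' a i) (v : ℚ≥0) :
    Frame W W' s (s'.setRat a i v) := by
  refine ⟨h.1, fun a' i' hw' => ?_⟩
  rw [State.setRat_rat, if_neg, h.2 a' i' hw']
  rintro ⟨rfl, rfl⟩
  exact hw' hw

end

/-- The cells `b, …, b + N - 1` of the integer array `a` hold the characteristic function of `Q`. -/
def Holds (a b N : ℕ) (Q : Finset ℕ) (s : State) : Prop :=
  ∀ i < N, s.nat a (b + i) = if i ∈ Q then 1 else 0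

section

variable {a b N : ℕ} {Q : Finset ℕ} {s s' : State}

theorem Holds.of_eq (h : Holds a b N Q s) (hs : ∀ i < N, s'.nat a (b + i) = s.nat a (b + i)) :
    Holds a b N Q s' := fun i hi => (hs i hi).trans (h i hi)

theorem Holds.pos_iff (h : Holds a b N Q s) {i : ℕ} (hi : i < N) :
    0 < s.nat a (b + i) ↔ i ∈ Q := by
  rw [h i hi]
  split <;> simp_all

theorem Holds.setVar (h : Holds a b N Q s) (x v : ℕ) : Holds a b N Q (s.setVar x v) := h

theorem Holds.setNat_of_ne (h : Holds a b N Q s) {a' : ℕ} (ha : a' ≠ a) (i v : ℕ) :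
    Holds a b N Q (s.setNat a' i v) :=
  h.of_eq fun j _ => by rw [State.setNat_nat, if_neg fun h => ha h.1.symm]

theorem Holds.insert (h : Holds a b N Q s) (i : ℕ) :
    Holds a b N (insert i Q) (s.setNat a (b + i) 1) := by
  intro j hj
  rw [State.setNat_nat, h j hj]
  by_cases hji : j = i
  · simp [hji]
  · simp [hji]

theorem Holds.erase (h : Holds a b N Q s) (i : ℕ) :
    Holds a b N (Q.erase i) (s.setNat a (b + i) 0) := by
  intro j hj
  rw [State.setNat_nat, h j hj]
  by_cases hji : j = i
  · simp [hji]
  · simp [hji]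

end

/-- The precomputed tables for the recursive procedures: the adjacency matrix of the graph (array
`0`), the vertex and the color of every pair `p < N` (arrays `9` and `10`), the multiples of `n`
(array `11`), and the weights (rational array `0`). -/
structure Tables (G : SimpleGraph ℕ) (k n N : ℕ) (w : ℕ → ℚ≥0) (s : State) : Prop where
  lt : ∀ p < N, p / k < n
  vertex : ∀ p < N, s.nat 9 p = p / k
  color : ∀ p < N, s.nat 10 p = p % k
  row : ∀ v < n, s.nat 11 v = v * n
  adj : ∀ u < n, ∀ v < n, (G.Adj u v → s.nat 0 (u * n + v) = 1) ∧
    (¬ G.Adj u v → s.nat 0 (u * n + v) = 0)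
  weight : ∀ p < N, s.rat 0 p = w p

section

variable {G : SimpleGraph ℕ} {k n N : ℕ} {w : ℕ → ℚ≥0} {s s' : State}

theorem Tables.frame {W W' : ℕ → ℕ → Prop} (h : Tables G k n N w s) (hs : Frame W W' s s')
    (hW : ∀ a i, W a i → a ≠ 0 ∧ a ≠ 9 ∧ a ≠ 10 ∧ a ≠ 11) (hW' : ∀ a i, W' a i → a ≠ 0) :
    Tables G k n N w s' where
  lt := h.lt
  vertex p hp := (hs.1 _ _ fun h => by simpa using hW _ _ h).trans (h.vertex p hp)
  color p hp := (hs.1 _ _ fun h => by simpa using hW _ _ h).trans (h.color p hp)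
  row p hp := (hs.1 _ _ fun h => by simpa using hW _ _ h).trans (h.row p hp)
  adj u hu v hv := by
    rw [hs.1 _ _ fun h => by simpa using hW _ _ h]
    exact h.adj u hu v hv
  weight p hp := (hs.2 _ _ fun h => by simpa using hW' _ _ h).trans (h.weight p hp)

/-- Cell `b + i` of array `a`, where `b` and `i` are local variables. -/
@[simp] def cell (a b i : ℕ) : NExp := .get a (.add (.var b) (.var i))

/-- Is the vertex of the pair `x` adjacent to that of `y`? (`x` and `y` are local variables.) -/
def adjE (x y : ℕ) : NExp := .get 0 (.add (.get 11 (.get 9 (.var x))) (.get 9 (.var y)))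

/-- Do the pairs `x` and `y` have the same entry in the table `a`? (One minus the distance of the
entries, by truncated subtraction.) -/
def sameE (a x y : ℕ) : NExp :=
  .sub (.const 1) (.add (.sub (.get a (.var x)) (.get a (.var y)))
    (.sub (.get a (.var y)) (.get a (.var x))))

/-- Do the pairs `x` and `y` clash? -/
def clashE (x y : ℕ) : NExp := .sub (.add (sameE 10 x y) (adjE x y)) (.const 1)

/-- Are the pairs `x` and `y` in conflict? -/
def conflictE (x y : ℕ) : NExp := .add (sameE 9 x y) (clashE x y)

/-- Are the vertices of the pairs `x` and `y` equal or adjacent? -/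
def nearE (x y : ℕ) : NExp := .add (sameE 9 x y) (adjE x y)

/-- `if e > 0 then c else d`. -/
def ifPos (e : NExp) (c d : Stmt) : Stmt := .ite (.natLt (.const 0) e) c d

@[simp] theorem runs_ifPos {procs : List Stmt} {e : NExp} {c d : Stmt} {Q : ℕ → State → Prop} :
    Runs procs (ifPos e c d) s Q ↔
    (0 < e.eval s → Runs procs c s fun t s' => Q (e.cost + 2 + t) s') ∧
    (¬ 0 < e.eval s → Runs procs d s fun t s' => Q (e.cost + 2 + t) s') := by
  rw [ifPos, runs_ite]
  simp only [Test.eval, Test.cost, NExp.eval, NExp.cost, show 1 + e.cost + 1 = e.cost + 2 by ring]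

theorem sameE_eval (a x y : ℕ) :
    (s.nat a (s.var x) = s.nat a (s.var y) → (sameE a x y).eval s = 1) ∧
    (s.nat a (s.var x) ≠ s.nat a (s.var y) → (sameE a x y).eval s = 0) := by
  simp only [sameE, NExp.eval]
  omega

variable (h : Tables G k n N w s) {x y : ℕ} (hx : s.var x < N) (hy : s.var y < N)
include h hx hy

theorem adjE_eval :
    (G.Adj (s.var x / k) (s.var y / k) → (adjE x y).eval s = 1) ∧
    (¬ G.Adj (s.var x / k) (s.var y / k) → (adjE x y).eval s = 0) := by
  simp only [adjE, NExp.eval, h.vertex _ hx, h.vertex _ hy, h.row _ (h.lt _ hx)]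
  exact h.adj _ (h.lt _ hx) _ (h.lt _ hy)

theorem clashE_eval :
    0 < (clashE x y).eval s ↔ Clash G k (s.var x) (s.var y) := by
  have h1 := adjE_eval h hx hy
  have h2 := sameE_eval (s := s) 10 x y
  rw [h.color _ hx, h.color _ hy] at h2
  simp only [clashE, NExp.eval, Clash]
  by_cases e1 : s.var x % k = s.var y % k <;>
    by_cases e2 : G.Adj (s.var x / k) (s.var y / k) <;>
    simp only [e1, e2, true_implies, not_true, false_implies, not_false_iff, ne_eq] at h1 h2 ⊢ <;>
    simp [h1, h2]

theorem conflictE_eval :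
    0 < (conflictE x y).eval s ↔ Conflict G k (s.var x) (s.var y) := by
  have h1 := clashE_eval h hx hy
  have h2 := sameE_eval (s := s) 9 x y
  rw [h.vertex _ hx, h.vertex _ hy] at h2
  simp only [conflictE, NExp.eval, Conflict]
  by_cases e1 : s.var x / k = s.var y / k
  · simp [h2.1 e1, e1]
  · simp [h2.2 e1, e1, h1]

theorem nearE_eval : (Near G k (s.var x) (s.var y) → (nearE x y).eval s = 1) ∧
    (¬ Near G k (s.var x) (s.var y) → (nearE x y).eval s = 0) := by
  have h1 := adjE_eval h hx hy
  have h2 := sameE_eval (s := s) 9 x y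
  rw [h.vertex _ hx, h.vertex _ hy] at h2
  have h3 : s.var x / k = s.var y / k → ¬ G.Adj (s.var x / k) (s.var y / k) := fun e h => h.ne e
  simp only [nearE, NExp.eval, Near]
  by_cases e1 : s.var x / k = s.var y / k
  · simp [h2.1 e1, e1, h1.2 (h3 e1)]
  · simpa [h2.2 e1, e1] using h1

end

end RAM

end Tables

section Solver

/-! ### The procedures

Sets of pairs are stored as characteristic functions in blocks of `N` cells. A call of `solve` finds
its set in a block that starts at cell `q` of array `2`, and may use the cells from `b ≥ q + N` on
of the working arrays; it passes `b` and `b + N` to the calls for the components, so that the arrays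
serve as stacks. In the block at `b`, array `2` holds the current component, array `5` what is left
of a set while its components are removed, array `6` the pairs among which is guessed, array `7` the
guess, and array `8` the number of guessed pairs of each color. Cell `b` of the rational arrays `1`
and `2` holds the best value found so far, and the sum over the components. -/

namespace RAM

/-- `closure(N, b, r)`: moves the component of `r` in the conflict graph of the set in array `5` to
array `2`. Each of the `N` rounds adds all elements in conflict with one that is already there. -/
def closureBody : Stmt :=
  .seq (forLoop 4 (.var 0) (.put 2 (.add (.var 1) (.var 4)) (.const 0)))
  (.seq (.put 2 (.add (.var 1) (.var 2)) (.const 1))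
  (.seq (.put 5 (.add (.var 1) (.var 2)) (.const 0))
  (forLoop 3 (.var 0)
    (forLoop 5 (.var 0)
      (ifPos (cell 2 1 5)
        (forLoop 4 (.var 0)
          (ifPos (cell 5 1 4)
            (ifPos (conflictE 5 4)
              (.seq (.put 2 (.add (.var 1) (.var 4)) (.const 1))
                (.put 5 (.add (.var 1) (.var 4)) (.const 0)))
              .skip)
            .skip))
        .skip)))))

/-- `count(N, b)`: the number of vertices of the set in array `2`. The variable `4` holds the last
vertex found, plus one; the pairs of one vertex are consecutive. -/
def countBody : Stmt :=
  .seq (forLoop 2 (.var 0)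
    (ifPos (cell 2 1 2)
      (.ite (.natLt (.var 4) (.add (.get 9 (.var 2)) (.const 1)))
        (.seq (.set 3 (.add (.var 3) (.const 1)))
          (.set 4 (.add (.get 9 (.var 2)) (.const 1))))
        .skip)
      .skip))
  (.set 0 (.var 3))

/-- `dominated(N, q, b)`: is there a pair in the set at `q` whose vertex is adjacent to all vertices
of the set at `b`? -/
def dominatedBody : Stmt :=
  .seq (forLoop 3 (.var 0)
    (ifPos (cell 2 1 3)
      (.seq (.set 6 (.const 1))
      (.seq (forLoop 4 (.var 0)
        (ifPos (cell 2 2 4) (ifPos (adjE 3 4) .skip (.set 6 (.const 0))) .skip))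
      (ifPos (.var 6) (.set 5 (.const 1)) .skip)))
      .skip))
  (.set 0 (.var 5))

/-- `twin(N, q, p, r)`: do `p` and `r` have the same closed neighbourhood in the set at `q`? -/
def twinBody : Stmt :=
  .seq (.set 5 (.const 1))
  (.seq (forLoop 4 (.var 0)
    (ifPos (cell 2 1 4)
      (ifPos (.add (.sub (nearE 2 4) (nearE 3 4)) (.sub (nearE 3 4) (nearE 2 4)))
        (.set 5 (.const 0)) .skip)
      .skip))
  (.set 0 (.var 5)))

/-- `separates(N, q, b, h, p, p')`: do the twin classes of `p` and `p'` leave only components with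
at most `h / 2` vertices? Array `6` receives the union of the two classes. -/
def separatesBody : Stmt :=
  .seq (forLoop 6 (.var 0)
    (.seq (.put 6 (.add (.var 2) (.var 6)) (.const 0))
    (.seq (.put 5 (.add (.var 2) (.var 6)) (.const 0))
    (ifPos (cell 2 1 6)
      (.seq (.call 7 3 [.var 0, .var 1, .var 4, .var 6])
      (.seq (.call 8 3 [.var 0, .var 1, .var 5, .var 6])
      (ifPos (.add (.var 7) (.var 8))
        (.put 6 (.add (.var 2) (.var 6)) (.const 1))
        (.put 5 (.add (.var 2) (.var 6)) (.const 1)))))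
      .skip))))
  (.seq (.set 9 (.const 1))
  (.seq (forLoop 6 (.var 0)
    (ifPos (cell 5 2 6)
      (.seq (.call 7 0 [.var 0, .var 2, .var 6])
      (.seq (.call 7 1 [.var 0, .var 2])
      (.ite (.natLt (.var 3) (.add (.var 7) (.var 7))) (.set 9 (.const 0)) .skip)))
      .skip))
  (.set 0 (.var 9))))

/-- `solve(N, q, b)`: computes the optimum for the connected set at `q` and stores it in cell `b` of
the rational array `1`. The variable `4` remembers whether a balanced separator was found, and `8`
is the bound on the number of guessed pairs of each color (no restriction, or three). The single
pairs settle the case of a single vertex. -/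
def solveBody : Stmt :=
  .seq (.putRat 1 (.var 2) .zero)
  (.seq (forLoop 5 (.var 0)
    (ifPos (cell 2 1 5)
      (.ite (.ratLt (.get 1 (.var 2)) (.get 0 (.var 5)))
        (.putRat 1 (.var 2) (.get 0 (.var 5))) .skip)
      .skip))
  (.seq (.call 3 1 [.var 0, .var 1])
  (.seq (forLoop 5 (.var 0)
    (ifPos (cell 2 1 5)
      (forLoop 6 (.var 0)
        (ifPos (cell 2 1 6)
          (ifPos (.var 4) .skip
            (.call 4 4 [.var 0, .var 1, .var 2, .var 3, .var 5, .var 6]))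
          .skip))
      .skip))
  (.seq (ifPos (.var 4) (.set 8 (.var 0))
    (.seq (.set 8 (.const 3))
      (forLoop 5 (.var 0) (.put 6 (.add (.var 2) (.var 5)) (.const 1)))))
  (.seq (forLoop 5 (.var 0)
    (.seq (.put 7 (.add (.var 2) (.var 5)) (.const 0))
      (.put 8 (.add (.var 2) (.var 5)) (.const 0))))
  (.call 7 6 [.var 0, .var 1, .var 2, .var 3, .var 4, .var 8, .const 0]))))))

/-- `guess(N, q, b, h, e, cap, pos)`: runs through all ways to extend the set in array `7` by pairs
from `pos` on that belong to the set in array `6`, with at most `cap` pairs of each color. Array `8`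
counts the pairs of each color. -/
def guessBody : Stmt :=
  .ite (.natLt (.var 6) (.var 0))
    (.seq (.call 7 6 [.var 0, .var 1, .var 2, .var 3, .var 4, .var 5, .add (.var 6) (.const 1)])
    (ifPos (cell 6 2 6)
      (.ite (.natLt (.get 8 (.add (.var 2) (.get 10 (.var 6)))) (.var 5))
        (.seq (.put 7 (.add (.var 2) (.var 6)) (.const 1))
        (.seq (.put 8 (.add (.var 2) (.get 10 (.var 6)))
          (.add (.get 8 (.add (.var 2) (.get 10 (.var 6)))) (.const 1)))
        (.seq (.call 7 6
          [.var 0, .var 1, .var 2, .var 3, .var 4, .var 5, .add (.var 6) (.const 1)])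
        (.seq (.put 7 (.add (.var 2) (.var 6)) (.const 0))
        (.put 8 (.add (.var 2) (.get 10 (.var 6)))
          (.sub (.get 8 (.add (.var 2) (.get 10 (.var 6)))) (.const 1)))))))
        .skip)
      .skip))
    (.call 7 7 [.var 0, .var 1, .var 2, .var 3, .var 4])

/-- `evaluate(N, q, b, h, e)`: computes what is left of the set at `q` after the guess in array `7`,
solves its components, and updates the best value found so far. -/
def evaluateBody : Stmt :=
  .seq (forLoop 5 (.var 0)
    (.seq (.put 5 (.add (.var 2) (.var 5)) (cell 2 1 5))
    (.seq (ifPos (.var 4)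
      (ifPos (cell 6 2 5) (ifPos (cell 7 2 5) .skip (.put 5 (.add (.var 2) (.var 5)) (.const 0)))
        .skip)
      .skip)
    (forLoop 6 (.var 0)
      (ifPos (cell 7 2 6)
        (ifPos (clashE 6 5) (.put 5 (.add (.var 2) (.var 5)) (.const 0)) .skip)
        .skip)))))
  (.seq (.call 7 8 [.var 0, .var 1, .var 2, .var 3, .var 4])
  (.ite (.ratLt (.get 1 (.var 2)) (.get 2 (.var 2)))
    (.putRat 1 (.var 2) (.get 2 (.var 2))) .skip))

/-- `total(N, q, b, h, e)`: adds up the optima of those components of the set in array `5` that are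
small, if `e > 0`, or dominated by a vertex of the set at `q`, if `e = 0`. -/
def totalBody : Stmt :=
  .seq (.putRat 2 (.var 2) .zero)
  (forLoop 5 (.var 0)
    (ifPos (cell 5 2 5)
      (.seq (.call 7 0 [.var 0, .var 2, .var 5])
      (.seq (ifPos (.var 4)
        (.seq (.call 7 1 [.var 0, .var 2])
          (.ite (.natLt (.var 3) (.add (.var 7) (.var 7))) (.set 6 (.const 0)) (.set 6 (.const 1))))
        (.call 6 2 [.var 0, .var 1, .var 2]))
      (ifPos (.var 6)
        (.seq (.call 7 5 [.var 0, .var 2, .add (.var 2) (.var 0)])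
          (.putRat 2 (.var 2) (.add (.get 2 (.var 2)) (.get 1 (.add (.var 2) (.var 0))))))
        .skip)))
      .skip))

/-- `value(N)`: stores the optimum for the set at `0` in cell `N` of the rational array `2`. -/
def valueBody : Stmt :=
  .seq (forLoop 1 (.var 0) (.put 5 (.add (.var 0) (.var 1)) (.get 2 (.var 1))))
  (.call 2 8 [.var 0, .const 0, .var 0, .add (.var 0) (.var 0), .const 1])

/-- The procedures of the program. -/
def solver : List Stmt :=
  [closureBody, countBody, dominatedBody, twinBody, separatesBody, solveBody, guessBody,
    evaluateBody, totalBody, valueBody]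

variable {G : SimpleGraph ℕ} {k n N : ℕ} {w : ℕ → ℚ≥0} {s : State} {P : ℕ → State → Prop}

theorem runs_count {x : ℕ} {eN eb : NExp} {b : ℕ} {Q : Finset ℕ} (hN : eN.eval s = N)
    (hb : eb.eval s = b) (ht : Tables G k n N w s) (hQN : Q ⊆ Finset.range N)
    (hQ : Holds 2 b N Q s)
    (hP : ∀ t ≤ eN.cost + eb.cost + 60 * (N + 1), P t (s.setVar x (verts k Q).card)) :
    Runs solver (.call x 1 [eN, eb]) s P := by
  refine runs_call (body := countBody) rfl ?_
  simp only [List.map_cons, List.map_nil, hN, hb, List.sum_cons, List.sum_nil, add_zero]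
  rw [countBody, runs_seq]
  refine runs_for (N := N) (T := 40) (fun i s' => s'.nat = s.nat ∧ s'.rat = s.rat ∧ s'.var 0 = N ∧
    s'.var 1 = b ∧ s'.var 2 = i ∧ s'.var 3 = (verts k (Q.filter (· < i))).card ∧
    (∀ p ∈ Q, p < i → p / k + 1 ≤ s'.var 4) ∧
    (s'.var 4 = 0 ∨ ∃ p ∈ Q, p < i ∧ s'.var 4 = p / k + 1)) ?_ ?_ ?_ ?_
  · simp [verts]
  · intro i s' h
    exact ⟨h.2.2.2.2.1, h.2.2.1⟩
  · rintro i s' hi ⟨h1, h2, h3, h4, h5, h6, h7, h8⟩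
    have hv : s'.nat 9 i = i / k := by rw [h1]; exact ht.vertex i hi
    have hpos := hQ.pos_iff hi
    have hm : ∀ p ≤ i, p / k ≤ i / k := fun p hp => Nat.div_le_div_right hp
    have e1 : i ∈ Q → verts k (Q.filter (· ≤ i)) = insert (i / k) (verts k (Q.filter (· < i))) := by
      intro h
      have : Q.filter (· ≤ i) = insert i (Q.filter (· < i)) := by
        ext p
        simp only [Finset.mem_filter, Finset.mem_insert]
        grind
      rw [verts, verts, this, Finset.image_insert]
    have e2 : i ∉ Q → Q.filter (· ≤ i) = Q.filter (· < i) := fun h => by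
      ext p
      simp only [Finset.mem_filter]
      grind
    have e3 : i / k ∈ verts k (Q.filter (· < i)) ↔ ∃ p ∈ Q, p < i ∧ p / k = i / k := by
      simp [verts, and_assoc]
    simp [h1, h2, h3, h4, h5, hpos, hv]
    refine ⟨fun hiQ => ⟨fun hlt => ⟨?_, fun p _ hp => hm p hp, i, hiQ, le_rfl, rfl⟩, fun hlt => ?_⟩,
      fun hiQ => ⟨?_, fun p hp hpi => ?_, ?_⟩⟩
    · rw [e1 hiQ, Finset.card_insert_of_notMem, h6]
      rw [e3]
      rintro ⟨p, hp, hpi, e⟩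
      have := h7 p hp hpi
      omega
    · obtain ⟨p, hp, hpi, e⟩ := h8.resolve_left (by omega)
      have := hm p hpi.le
      refine ⟨?_, fun q hq hqi => ?_, .inr ⟨p, hp, hpi.le, e⟩⟩
      · rw [e1 hiQ, Finset.insert_eq_of_mem, h6]
        exact e3.2 ⟨p, hp, hpi, by omega⟩
      · have := hm q hqi
        omega
    · rw [e2 hiQ, h6]
    · exact h7 p hp (lt_of_le_of_ne hpi fun h => hiQ (h ▸ hp))
    · exact h8.imp_right fun ⟨p, hp, hpi, e⟩ => ⟨p, hp, hpi.le, e⟩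
  · rintro t s' ht ⟨h1, h2, h3, h4, h5, h6, h7, h8⟩
    rw [runs_set, State.leave_eq_setVar (by simpa using h1) (by simpa using h2)]
    have e : Q.filter (· < N) = Q := Finset.filter_true_of_mem fun p hp =>
      Finset.mem_range.1 (hQN hp)
    rw [e] at h6
    simp only [State.setVar_var, if_true, NExp.eval, h6]
    apply hP
    simp at ht ⊢
    omega

theorem runs_dominated {x : ℕ} {eN eq eb : NExp} {q b : ℕ} {Q C : Finset ℕ} (hN : eN.eval s = N)
    (hq : eq.eval s = q) (hb : eb.eval s = b) (ht : Tables G k n N w s)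
    (hQN : Q ⊆ Finset.range N) (hCN : C ⊆ Finset.range N) (hQ : Holds 2 q N Q s)
    (hC : Holds 2 b N C s)
    (hP : ∀ t ≤ eN.cost + eq.cost + eb.cost + 100 * (N + 1) ^ 2, ∀ v,
      (0 < v ↔ ∃ x ∈ Q, ∀ p ∈ C, G.Adj (x / k) (p / k)) → P t (s.setVar x v)) :
    Runs solver (.call x 2 [eN, eq, eb]) s P := by
  refine runs_call (body := dominatedBody) rfl ?_
  simp only [List.map_cons, List.map_nil, hN, hq, hb, List.sum_cons, List.sum_nil, add_zero]
  rw [dominatedBody, runs_seq]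
  refine runs_for (N := N) (T := 70 * (N + 1)) (fun i s' => s'.nat = s.nat ∧ s'.rat = s.rat ∧
    s'.var 0 = N ∧ s'.var 1 = q ∧ s'.var 2 = b ∧ s'.var 3 = i ∧
    (0 < s'.var 5 ↔ ∃ x ∈ Q, x < i ∧ ∀ p ∈ C, G.Adj (x / k) (p / k))) ?_ ?_ ?_ ?_
  · simp
  · intro i s' h
    exact ⟨h.2.2.2.2.2.1, h.2.2.1⟩
  · rintro i s' hi ⟨h1, h2, h3, h4, h5, h6, h7⟩
    have hpos := hQ.pos_iff hi
    rw [runs_ifPos]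
    simp only [cell, NExp.eval, h1, h4, h6, hpos]
    refine ⟨fun hiQ => ?_, fun hiQ => ?_⟩
    · rw [runs_seq, runs_set, runs_seq]
      refine runs_for (N := N) (T := 40) (fun j s'' => s''.nat = s.nat ∧ s''.rat = s.rat ∧
        s''.var 0 = N ∧ s''.var 1 = q ∧ s''.var 2 = b ∧ s''.var 3 = i ∧ s''.var 5 = s'.var 5 ∧
        s''.var 4 = j ∧ (0 < s''.var 6 ↔ ∀ p ∈ C, p < j → G.Adj (i / k) (p / k))) ?_ ?_ ?_ ?_
      · simp [h1, h2, h3, h4, h5, h6]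
      · intro j s'' h
        exact ⟨h.2.2.2.2.2.2.2.1, h.2.2.1⟩
      · rintro j s'' hj ⟨g1, g2, g3, g4, g5, g6, g7, g8, g9⟩
        have hpos := hC.pos_iff hj
        have hadj := adjE_eval (ht.frame (s' := s'') (W := fun _ _ => False)
          (W' := fun _ _ => False) ⟨by simp [g1], by simp [g2]⟩ (by simp) (by simp))
          (x := 3) (y := 4) (by omega) (by omega)
        have hadj' : 0 < (adjE 3 4).eval s'' ↔ G.Adj (i / k) (j / k) := by
          rw [g6, g8] at hadj
          by_cases h : G.Adj (i / k) (j / k)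
          · simp [hadj.1 h, h]
          · simp [hadj.2 h, h]
        have hcost : (adjE 3 4).cost = 7 := rfl
        simp only [runs_ifPos, runs_set, runs_skip, hadj', NExp.eval, g1, g5, g8, hpos]
        simp [g1, g2, g3, g4, g5, g6, g7, g8, hcost]
        grind
      · rintro t s'' ht ⟨g1, g2, g3, g4, g5, g6, g7, g8, g9⟩
        have hcond : (∀ p ∈ C, p < N → G.Adj (i / k) (p / k)) ↔ ∀ p ∈ C, G.Adj (i / k) (p / k) :=
          ⟨fun h p hp => h p hp (Finset.mem_range.1 (hCN hp)), fun h p hp _ => h p hp⟩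
        rw [hcond] at g9
        have hT : (N + 1) * (40 + (NExp.var 0).cost + 6) = 47 * (N + 1) := by simp; ring
        rw [hT] at ht
        simp only [runs_ifPos, runs_set, runs_skip, NExp.eval, g9]
        simp [g1, g2, g3, g4, g5, g6, g7, h7]
        grind
    · simp [h1, h2, h3, h4, h5, h6, h7]
      grind
  · rintro t s' ht ⟨h1, h2, h3, h4, h5, h6, h7⟩
    rw [runs_set, State.leave_eq_setVar (by simpa using h1) (by simpa using h2)]
    apply hP
    · simp at ht ⊢
      nlinarith
    · simp only [State.setVar_var, if_true, NExp.eval, h7]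
      exact ⟨fun ⟨x, hx, _, h⟩ => ⟨x, hx, h⟩, fun ⟨x, hx, h⟩ =>
        ⟨x, hx, Finset.mem_range.1 (hQN hx), h⟩⟩

end RAM

end Solver

section Subroutines

/-! ### Correctness of the subroutines -/

namespace RAM

variable {G : SimpleGraph ℕ} {k n N : ℕ} {w : ℕ → ℚ≥0} {s : State} {P : ℕ → State → Prop}

theorem Tables.of_eq {s' : State} (h : Tables G k n N w s) (h1 : s'.nat = s.nat)
    (h2 : s'.rat = s.rat) : Tables G k n N w s' :=
  h.frame (W := fun _ _ => False) (W' := fun _ _ => False) ⟨by simp [h1], by simp [h2]⟩ (by simp)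
    (by simp)

theorem runs_twin {x : ℕ} {eN eq ep er : NExp} {q p r : ℕ} {Q : Finset ℕ} (hN : eN.eval s = N)
    (hq : eq.eval s = q) (hp : ep.eval s = p) (hr : er.eval s = r) (ht : Tables G k n N w s)
    (hpN : p < N) (hrN : r < N) (hQN : Q ⊆ Finset.range N) (hQ : Holds 2 q N Q s)
    (hP : ∀ t ≤ eN.cost + eq.cost + ep.cost + er.cost + 200 * (N + 1), ∀ v,
      (0 < v ↔ ∀ z ∈ Q, (Near G k p z ↔ Near G k r z)) → P t (s.setVar x v)) :
    Runs solver (.call x 3 [eN, eq, ep, er]) s P := by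
  refine runs_call (body := twinBody) rfl ?_
  simp only [List.map_cons, List.map_nil, hN, hq, hp, hr, List.sum_cons, List.sum_nil, add_zero]
  rw [twinBody, runs_seq, runs_set, runs_seq]
  refine runs_for (N := N) (T := 120) (fun i s' => s'.nat = s.nat ∧ s'.rat = s.rat ∧
    s'.var 0 = N ∧ s'.var 1 = q ∧ s'.var 2 = p ∧ s'.var 3 = r ∧ s'.var 4 = i ∧
    (0 < s'.var 5 ↔ ∀ z ∈ Q, z < i → (Near G k p z ↔ Near G k r z))) ?_ ?_ ?_ ?_
  · simp
  · intro i s' h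
    exact ⟨h.2.2.2.2.2.2.1, h.2.2.1⟩
  · rintro i s' hi ⟨h1, h2, h3, h4, h5, h6, h7, h8⟩
    have hpos := hQ.pos_iff hi
    have ht' := ht.of_eq h1 h2
    have n1 := nearE_eval ht' (x := 2) (y := 4) (by omega) (by omega)
    have n2 := nearE_eval ht' (x := 3) (y := 4) (by omega) (by omega)
    rw [h5, h7] at n1
    rw [h6, h7] at n2
    have hcost : ∀ x y, (nearE x y).cost = 21 := fun _ _ => rfl
    have hne : 0 < ((nearE 2 4).eval s' - (nearE 3 4).eval s') +
        ((nearE 3 4).eval s' - (nearE 2 4).eval s') ↔ ¬ (Near G k p i ↔ Near G k r i) := by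
      by_cases a1 : Near G k p i <;> by_cases a2 : Near G k r i
      · simp [n1.1 a1, n2.1 a2, a1, a2]
      · simp [n1.1 a1, n2.2 a2, a1, a2]
      · simp [n1.2 a1, n2.1 a2, a1, a2]
      · simp [n1.2 a1, n2.2 a2, a1, a2]
    simp only [runs_ifPos, runs_set, runs_skip, cell, NExp.eval, h1, h4, h7, hpos, hne]
    simp [h1, h2, h3, h4, h5, h6, h7, hcost]
    grind
  · rintro t s' ht ⟨h1, h2, h3, h4, h5, h6, h7, h8⟩
    rw [runs_set, State.leave_eq_setVar (by simpa using h1) (by simpa using h2)]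
    apply hP
    · simp at ht ⊢
      omega
    · simp only [State.setVar_var, if_true, NExp.eval, h8]
      exact ⟨fun h z hz => h z hz (Finset.mem_range.1 (hQN hz)), fun h z hz _ => h z hz⟩

/-- The cells from `b` on of the integer arrays in `A`. -/
def cells (A : Finset ℕ) (b : ℕ) : ℕ → ℕ → Prop := fun a i => a ∈ A ∧ b ≤ i

theorem Holds.frame {A A' : Finset ℕ} {a b b' N : ℕ} {Q : Finset ℕ} {s s' : State}
    (h : Holds a b N Q s) (hf : Frame (cells A b') (cells A' b') s s')
    (hab : a ∉ A ∨ b + N ≤ b') : Holds a b N Q s' := by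
  refine h.of_eq fun i hi => hf.1 _ _ fun ⟨h1, h2⟩ => ?_
  rcases hab with h | h
  · exact h h1
  · omega

theorem Tables.cells {s' : State} {A A' : Finset ℕ} {b : ℕ} (h : Tables G k n N w s)
    (hf : Frame (cells A b) (cells A' b) s s') (hA : Disjoint A {0, 9, 10, 11}) (hA' : 0 ∉ A') :
    Tables G k n N w s' := by
  refine h.frame hf (fun a i hai => ?_) fun a i hai h0 => hA' (h0 ▸ hai.1)
  have := Finset.disjoint_left.1 hA hai.1
  simpa using this

/-- After each round, the part of the component found so far has grown or is closed under conflicts;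
so `N` rounds suffice. -/
theorem runs_closure {x : ℕ} {eN eb er : NExp} {b r : ℕ} {R : Finset ℕ} (hN : eN.eval s = N)
    (hb : eb.eval s = b) (hr : er.eval s = r) (ht : Tables G k n N w s) (hrR : r ∈ R)
    (hRN : R ⊆ Finset.range N) (hR : Holds 5 b N R s)
    (hP : ∀ t ≤ eN.cost + eb.cost + er.cost + 200 * (N + 1) ^ 3, ∀ s',
      s'.var = s.var → Frame (cells {2, 5} b) (cells ∅ b) s s' → Holds 2 b N (comp G k R r) s' →
      Holds 5 b N (R \ comp G k R r) s' → ∀ v, P t (s'.setVar x v)) :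
    Runs solver (.call x 0 [eN, eb, er]) s P := by
  have hrN : r < N := Finset.mem_range.1 (hRN hrR)
  refine runs_call (body := closureBody) rfl ?_
  simp only [List.map_cons, List.map_nil, hN, hb, hr, List.sum_cons, List.sum_nil, add_zero]
  rw [closureBody, runs_seq]
  refine runs_for (N := N) (T := 10) (fun i s' => Frame (cells {2, 5} b) (cells ∅ b) s s' ∧
    s'.var 0 = N ∧ s'.var 1 = b ∧ s'.var 2 = r ∧ s'.var 4 = i ∧
    (∀ j < i, s'.nat 2 (b + j) = 0) ∧ Holds 5 b N R s') ?_ ?_ ?_ ?_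
  · refine ⟨Frame.refl _ _ s, ?_⟩
    simp [Holds]
    exact hR
  · intro i s' h
    exact ⟨h.2.2.2.2.1, h.2.1⟩
  · rintro i s' hi ⟨h1, h2, h3, h4, h5, h6, h7⟩
    rw [runs_put]
    refine ⟨by simp, by simpa using h5, ?_⟩
    simp only [NExp.eval, h3, h5]
    refine ⟨(h1.setNat (by simp [cells]) _).setVar _ _, ?_⟩
    refine ⟨by simpa using h2, by simpa using h3, by simpa using h4, by simp, ?_,
      (h7.setNat_of_ne (by decide) _ _).setVar _ _⟩
    intro j hj
    simp
    grind
  rintro t₁ s₁ ht₁ ⟨f1, v0, v1, v2, -, z, h5⟩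
  rw [runs_seq, runs_put, runs_seq, runs_put]
  simp only [NExp.eval, v1, v2, State.setNat_var]
  -- The invariant: array `2` holds a part `C` of the component, and array `5` the rest of `R`.
  let Inv : Finset ℕ → State → Prop := fun C s' => Frame (cells {2, 5} b) (cells ∅ b) s s' ∧
    s'.var 0 = N ∧ s'.var 1 = b ∧ s'.var 2 = r ∧ Holds 2 b N C s' ∧ Holds 5 b N (R \ C) s' ∧
    r ∈ C ∧ C ⊆ comp G k R r
  have hInv : ∀ C s', Inv C s' → ∀ x v, 3 ≤ x → Inv C (s'.setVar x v) := by
    rintro C s' ⟨h1, h2, h3, h4, h5, h6, h7, h8⟩ x v hx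
    refine ⟨h1, ?_, ?_, ?_, h5, h6, h7, h8⟩ <;> rw [State.setVar_var, if_neg (by omega)] <;>
      assumption
  have hconf : ∀ x y, (conflictE x y).cost = 37 := fun _ _ => rfl
  refine runs_for (N := N) (T := 150 * (N + 1) ^ 2) (fun i s' => s'.var 3 = i ∧ ∃ C, Inv C s' ∧
    (i < C.card ∨ ∀ x ∈ C, ∀ p ∈ R, Conflict G k x p → p ∈ C)) ?_ ?_ ?_ ?_
  · refine ⟨by simp, {r}, ?_, by simp⟩
    refine hInv _ _ ⟨?_, by simpa using v0, by simpa using v1, by simpa using v2, ?_, ?_, by simp,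
      by simpa using self_mem_comp hrR⟩ 3 0 le_rfl
    · exact (f1.setNat (by simp [cells]) _).setNat (by simp [cells]) _
    · refine Holds.setNat_of_ne ?_ (by decide) _ _
      have : Holds 2 b N ∅ s₁ := fun j hj => by simpa using z j hj
      simpa using this.insert r
    · rw [Finset.sdiff_singleton_eq_erase]
      exact (h5.setNat_of_ne (by decide) _ _).erase r
  · rintro i s' ⟨h, C, hC, -⟩
    exact ⟨h, hC.2.1⟩
  · rintro i s' hi ⟨hv, C₀, hC₀, hcard⟩
    refine runs_for (N := N) (T := 120 * (N + 1)) (fun x s' => s'.var 3 = i ∧ s'.var 5 = x ∧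
      ∃ C, Inv C s' ∧ C₀ ⊆ C ∧ ∀ y ∈ C₀, y < x → ∀ p ∈ R, Conflict G k y p → p ∈ C) ?_ ?_ ?_ ?_
    · exact ⟨by simpa using hv, by simp, C₀, hInv _ _ hC₀ _ _ (by decide), subset_rfl, by simp⟩
    · rintro i s' ⟨h, h', C, hC, -⟩
      exact ⟨h', hC.2.1⟩
    · rintro x s' hx ⟨hv, hv5, C₁, hC₁, hC01, hx₁⟩
      have hpos := hC₁.2.2.2.2.1.pos_iff hx
      rw [runs_ifPos]
      simp only [cell, NExp.eval, hC₁.2.2.1, hv5, hpos]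
      refine ⟨fun hxC => ?_, fun hxC => ?_⟩
      · refine runs_for (N := N) (T := 100) (fun p s' => s'.var 3 = i ∧ s'.var 5 = x ∧
          s'.var 4 = p ∧ ∃ C, Inv C s' ∧ C₁ ⊆ C ∧ ∀ q ∈ R, q < p → Conflict G k x q → q ∈ C)
          ?_ ?_ ?_ ?_
        · exact ⟨by simpa using hv, by simpa using hv5, by simp, C₁, hInv _ _ hC₁ _ _ (by decide),
            subset_rfl, by simp⟩
        · rintro i s' ⟨-, -, h', C, hC, -⟩
          exact ⟨h', hC.2.1⟩
        · rintro p s' hp ⟨hv, hv5, hv4, C, hC, hC1, hq⟩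
          obtain ⟨g1, g2, g3, g4, g5, g6, g7, g8⟩ := id hC
          have hpos := g6.pos_iff hp
          have hcf := conflictE_eval (ht.cells g1 (by decide) (by decide))
            (x := 5) (y := 4) (by omega) (by omega)
          rw [hv5, hv4] at hcf
          have hmono : ∀ C', C ⊆ C' → (p ∈ R → Conflict G k x p → p ∈ C') →
              ∀ q ∈ R, q < p + 1 → Conflict G k x q → q ∈ C' := by
            intro C' hC' h q hqR hqp hc
            rcases Nat.lt_succ_iff_lt_or_eq.1 hqp with h' | rfl
            · exact hC' (hq q hqR h' hc)
            · exact h hqR hc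
          simp only [runs_ifPos, runs_skip, runs_seq, runs_put, NExp.eval, g3, hv4, hpos, hcf,
            State.setNat_var]
          refine ⟨fun h1 => ⟨fun h2 => ⟨by simp [hconf], by simp, by simpa using hv,
            by simpa using hv5, by simp, insert p C, hInv _ _ ?_ _ _ (by decide),
              hC1.trans (Finset.subset_insert _ _), hmono _ (Finset.subset_insert _ _) fun _ _ =>
                Finset.mem_insert_self _ _⟩,
            fun h2 => ⟨by simp [hconf], by simp, by simpa using hv,
            by simpa using hv5, by simp, C, hInv _ _ hC _ _ (by decide), hC1,
              hmono _ subset_rfl fun _ h => absurd h h2⟩⟩,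
            fun h1 => ⟨by simp, by simp, by simpa using hv,
            by simpa using hv5, by simp, C, hInv _ _ hC _ _ (by decide), hC1,
              hmono _ subset_rfl fun h _ => by_contra fun h' => h1 (Finset.mem_sdiff.2 ⟨h, h'⟩)⟩⟩
          rw [Finset.mem_sdiff] at h1
          refine ⟨(g1.setNat (by simp [cells]) _).setNat (by simp [cells]) _, g2, g3, g4,
            (g5.insert p).setNat_of_ne (by decide) _ _, ?_, Finset.mem_insert_of_mem g7, ?_⟩
          · rw [Finset.sdiff_insert]
            exact (g6.setNat_of_ne (by decide) _ _).erase p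
          · refine Finset.insert_subset ((mem_comp hrR).2 ?_) g8
            exact reachSet_closed ((mem_comp hrR).1 (g8 (hC1 hxC))) h2 h1.1
        · rintro t s' ht ⟨hv, hv5, -, C, hC, hC1, hq⟩
          refine ⟨by simp at ht ⊢; omega, hv5, by simpa using hv, by simp, C,
            hInv _ _ hC _ _ (by decide), hC01.trans hC1, fun y hy hyx p hp hc => ?_⟩
          rcases Nat.lt_succ_iff_lt_or_eq.1 hyx with h' | rfl
          · exact hC1 (hx₁ y hy h' p hp hc)
          · exact hq p hp (Finset.mem_range.1 (hRN hp)) hc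
      · rw [runs_skip]
        refine ⟨by simp; omega, hv5, by simpa using hv, by simp, C₁, hInv _ _ hC₁ _ _ (by decide),
          hC01, fun y hy hyx p hp hc => ?_⟩
        rcases Nat.lt_succ_iff_lt_or_eq.1 hyx with h' | rfl
        · exact hx₁ y hy h' p hp hc
        · exact absurd (hC01 hy) hxC
    · rintro t s' ht ⟨hv, -, C, hC, hC0, hcl⟩
      refine ⟨by simp at ht ⊢; nlinarith, hv, by simp, C, hInv _ _ hC _ _ (by decide), ?_⟩
      have hsub : C₀ ⊆ R := hC₀.2.2.2.2.2.2.2.trans (comp_subset R r)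
      have hcl' : ∀ y ∈ C₀, ∀ p ∈ R, Conflict G k y p → p ∈ C := fun y hy =>
        hcl y hy (Finset.mem_range.1 (hRN (hsub hy)))
      by_cases hCC : C = C₀
      · right
        rw [hCC] at hcl' ⊢
        exact hcl'
      · rcases hcard with h | h
        · left
          have := Finset.card_lt_card (hC0.ssubset_of_ne fun h => hCC h.symm)
          omega
        · exact absurd (Finset.Subset.antisymm (hC.2.2.2.2.2.2.2.trans
            (comp_subset_of_closed hrR hC₀.2.2.2.2.2.2.1 h)) hC0) hCC
  · rintro t s' ht ⟨-, C, ⟨g1, g2, g3, g4, g5, g6, g7, g8⟩, hcard⟩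
    have hCR := g8.trans (comp_subset R r)
    have hC : C = comp G k R r := by
      refine Finset.Subset.antisymm g8 (comp_subset_of_closed hrR g7 ?_)
      rcases hcard with h | h
      · have := Finset.card_le_card (hCR.trans hRN)
        rw [Finset.card_range] at this
        omega
      · exact h
    subst hC
    refine hP _ ?_ { s' with var := s.var } rfl g1 g5 g6 (s'.var 0)
    simp at ht ht₁ ⊢
    have : (N + 1) ^ 3 = (N + 1) * (N + 1) ^ 2 := by ring
    nlinarith

end RAM

end Subroutines

section Separates

/-! ### Testing a pair of twin classes -/

namespace RAM

variable {G : SimpleGraph ℕ} {k n N : ℕ} {w : ℕ → ℚ≥0} {s : State} {P : ℕ → State → Prop}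

theorem mem_twins {Q : Finset ℕ} {p r : ℕ} : r ∈ twins G k Q p ↔
    r ∈ Q ∧ ∀ z ∈ Q, (Near G k p z ↔ Near G k r z) := by
  classical
  rw [twins, Finset.mem_filter]

theorem State.leave_eq_setVar_of_var_zero (s s' : State) (x v : ℕ) (h : s'.var 0 = v) :
    s.leave x s' = ({ s' with var := s.var } : State).setVar x v := by
  simp [State.leave, State.setVar, h]

theorem runs_separates {x : ℕ} {eN eq eb eh ep ep' : NExp} {q b h p p' : ℕ} {Q : Finset ℕ}
    (hN : eN.eval s = N) (hq : eq.eval s = q) (hb : eb.eval s = b) (hh : eh.eval s = h)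
    (hp : ep.eval s = p) (hp' : ep'.eval s = p') (ht : Tables G k n N w s) (hpN : p < N)
    (hpN' : p' < N) (hQN : Q ⊆ Finset.range N) (hQ : Holds 2 q N Q s) (hqb : q + N ≤ b)
    (hcard : h = (verts k Q).card)
    (hP : ∀ t ≤ eN.cost + eq.cost + eb.cost + eh.cost + ep.cost + ep'.cost + 1000 * (N + 1) ^ 4,
      ∀ s', s'.var = s.var → Frame (cells {2, 5, 6} b) (cells ∅ b) s s' →
      Holds 6 b N (twins G k Q p ∪ twins G k Q p') s' → ∀ v,
      (0 < v ↔ IsBalanced G k Q (twins G k Q p ∪ twins G k Q p')) → P t (s'.setVar x v)) :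
    Runs solver (.call x 4 [eN, eq, eb, eh, ep, ep']) s P := by
  refine runs_call (body := separatesBody) rfl ?_
  simp only [List.map_cons, List.map_nil, hN, hq, hb, hh, hp, hp', List.sum_cons, List.sum_nil,
    add_zero]
  set S := twins G k Q p ∪ twins G k Q p' with hS
  rw [separatesBody, runs_seq]
  refine runs_for (N := N) (T := 500 * (N + 1)) (fun i s' =>
    Frame (cells {2, 5, 6} b) (cells ∅ b) s s' ∧ s'.var 0 = N ∧ s'.var 1 = q ∧ s'.var 2 = b ∧
    s'.var 3 = h ∧ s'.var 4 = p ∧ s'.var 5 = p' ∧ s'.var 6 = i ∧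
    (∀ j < i, s'.nat 6 (b + j) = if j ∈ S then 1 else 0) ∧
    ∀ j < i, s'.nat 5 (b + j) = if j ∈ Q \ S then 1 else 0) ?_ ?_ ?_ ?_
  · refine ⟨Frame.refl _ _ s, ?_⟩
    simp
  · intro i s' h
    exact ⟨h.2.2.2.2.2.2.2.1, h.2.1⟩
  · rintro i s' hi ⟨h1, v0, v1, v2, v3, v4, v5, v6, h6, h5⟩
    rw [runs_seq, runs_put, runs_seq, runs_put]
    simp only [NExp.eval, v2, v6, State.setNat_var]
    set s₁ := (s'.setNat 6 (b + i) 0).setNat 5 (b + i) 0 with hs₁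
    have f₁ : Frame (cells {2, 5, 6} b) (cells ∅ b) s s₁ :=
      (h1.setNat (by simp [cells]) _).setNat (by simp [cells]) _
    have hQ₁ : Holds 2 q N Q s₁ := hQ.frame f₁ (.inr hqb)
    have hv₁ : s₁.var = s'.var := rfl
    rw [runs_ifPos]
    simp only [cell, NExp.eval, hv₁, v1, v6, hQ₁.pos_iff hi]
    refine ⟨fun hiQ => ?_, fun hiQ => ?_⟩
    · rw [runs_seq]
      refine runs_twin (p := p) (r := i) (q := q) (by simpa [hv₁] using v0)
        (by simpa [hv₁] using v1) (by simpa [hv₁] using v4)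
        (by simpa [hv₁] using v6) (ht.cells f₁ (by decide) (by decide)) hpN hi hQN hQ₁ ?_
      intro t₁ ht₁ a ha
      rw [runs_seq]
      refine runs_twin (p := p') (r := i) (q := q) (by simpa [hv₁] using v0)
        (by simpa [hv₁] using v1) (by simpa [hv₁] using v5)
        (by simpa [hv₁] using v6) (ht.cells (f₁.setVar _ _) (by decide) (by decide)) hpN' hi hQN
        (hQ₁.setVar _ _) ?_
      intro t₂ ht₂ c hc
      have hiS : 0 < a + c ↔ i ∈ S := by
        rw [hS, Finset.mem_union, mem_twins, mem_twins, ← ha, ← hc]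
        simp only [hiQ, true_and]
        omega
      simp only [runs_ifPos, runs_put]
      simp only [NExp.eval, State.setVar_var, hv₁, v2, v6, Nat.reduceEqDiff, if_true, if_false, hiS]
      simp only [NExp.cost] at ht₁ ht₂
      refine ⟨fun h => ⟨by simp; omega, by simpa [hv₁] using v6, ?_⟩,
        fun h => ⟨by simp; omega, by simpa [hv₁] using v6, ?_⟩⟩
      · refine ⟨f₁.setNat (by simp [cells]) _, ?_⟩
        simp only [State.setVar_var, State.setNat_var, State.setVar_nat, State.setNat_nat, hs₁]
        simp only [v0, v1, v2, v3, v4, v5]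
        simp
        grind
      · refine ⟨f₁.setNat (by simp [cells]) _, ?_⟩
        simp only [State.setVar_var, State.setNat_var, State.setVar_nat, State.setNat_nat, hs₁]
        simp only [v0, v1, v2, v3, v4, v5]
        simp
        grind
    · rw [runs_skip]
      have hiS : i ∉ S := fun h => hiQ <| by
        rcases Finset.mem_union.1 h with h | h <;> exact (mem_twins.1 h).1
      refine ⟨by simp; omega, v6, f₁, ?_⟩
      simp only [State.setVar_var, State.setNat_var, State.setVar_nat, State.setNat_nat, hs₁]
      simp only [v0, v1, v2, v3, v4, v5]
      simp
      grind
  rintro t₁ s₁ ht₁ ⟨f₁, v0, v1, v2, v3, v4, v5, -, h6, h5⟩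
  rw [runs_seq, runs_set, runs_seq]
  refine runs_for (N := N) (T := 400 * (N + 1) ^ 3) (fun i s' =>
    Frame (cells {2, 5, 6} b) (cells ∅ b) s s' ∧ s'.var 0 = N ∧ s'.var 1 = q ∧ s'.var 2 = b ∧
    s'.var 3 = h ∧ s'.var 6 = i ∧ Holds 6 b N S s' ∧
    ∃ R, IsRest G k (Q \ S) i R ∧ Holds 5 b N R s' ∧ (0 < s'.var 9 ↔
      ∀ r ∈ Q \ S, r ∉ R → 2 * (verts k (comp G k (Q \ S) r)).card ≤ h)) ?_ ?_ ?_ ?_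
  · refine ⟨f₁, by simpa using v0, by simpa using v1, by simpa using v2, by simpa using v3,
      by simp, h6, _, .refl _, h5, ?_⟩
    simp
    grind
  · intro i s' h
    exact ⟨h.2.2.2.2.2.1, h.2.1⟩
  · rintro i s' hi ⟨f', v0, v1, v2, v3, v6, h6', R, hR, h5', h9⟩
    rw [runs_ifPos]
    simp only [cell, NExp.eval, v2, v6, h5'.pos_iff hi]
    have hRN : R ⊆ Finset.range N := hR.subset.trans (Finset.sdiff_subset.trans hQN)
    refine ⟨fun hiR => ?_, fun hiR => ?_⟩
    · rw [runs_seq]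
      refine runs_closure (b := b) (r := i) v0 v2 v6 (ht.cells f' (by decide) (by decide)) hiR hRN
        h5' ?_
      intro t₂ ht₂ s₂ hv₂ f₂ g2 g5 a
      have f₂' := f'.trans (f₂.mono (V := cells {2, 5, 6} b) (V' := cells ∅ b)
        (by simp only [cells]; grind) (by simp [cells]))
      rw [runs_seq]
      refine runs_count (b := b) (by simpa [hv₂] using v0) (by simpa [hv₂] using v2)
        (ht.cells (f₂'.setVar _ _) (by decide) (by decide))
        ((comp_subset R i).trans hRN) (g2.setVar _ _) ?_
      intro t₃ ht₃
      have hN3 : N + 1 ≤ (N + 1) ^ 3 := Nat.le_self_pow (by decide) _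
      have hh6 := h6'.frame f₂ (.inl (by decide))
      have hc := hR.comp_eq i hiR
      have hbad : (∀ r ∈ Q \ S, r ∉ R \ comp G k R i →
          2 * (verts k (comp G k (Q \ S) r)).card ≤ h) ↔
          (∀ r ∈ Q \ S, r ∉ R → 2 * (verts k (comp G k (Q \ S) r)).card ≤ h) ∧
          2 * (verts k (comp G k R i)).card ≤ h := by
        constructor
        · intro hb
          refine ⟨fun r hr hrR => hb r hr fun h => hrR (Finset.mem_sdiff.1 h).1, ?_⟩
          rw [hc]
          exact hb i (hR.subset hiR) fun h => (Finset.mem_sdiff.1 h).2 (self_mem_comp hiR)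
        · rintro ⟨hb1, hb2⟩ r hr hrR
          by_cases hrR' : r ∈ R
          · have : r ∈ comp G k R i := by_contra fun h => hrR (Finset.mem_sdiff.2 ⟨hrR', h⟩)
            rw [hc] at this hb2
            rw [comp_eq_of_mem (hR.subset hiR) this]
            exact hb2
          · exact hb1 r hr hrR'
      simp only [runs_ite, runs_set, runs_skip, Test.eval, NExp.eval, State.setVar_var, hv₂, v3,
        Nat.reduceEqDiff, if_true, if_false]
      simp only [NExp.cost] at ht₂ ht₃
      refine ⟨fun h => ⟨by simp; omega, v6, f₂', by simpa [hv₂] using v0,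
        by simpa [hv₂] using v1, by simpa [hv₂] using v2, by simp, by simp,
        hh6, _, hR.next_sdiff hiR, g5, ?_⟩, fun h => ⟨by simp; omega, v6, f₂',
        by simpa [hv₂] using v0,
        by simpa [hv₂] using v1, by simpa [hv₂] using v2, by simp, by simp,
        hh6, _, hR.next_sdiff hiR, g5, ?_⟩⟩
      · rw [hbad]
        simp
        omega
      · rw [hbad, ← h9]
        simp
        omega
    · rw [runs_skip]
      have hN3 : N + 1 ≤ (N + 1) ^ 3 := Nat.le_self_pow (by decide) _
      refine ⟨by simp; omega, v6, f', v0, v1, v2, v3,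
        by simp, h6', R, hR.next hiR, h5', ?_⟩
      simpa using h9
  · rintro t s' ht ⟨f', v0, v1, v2, v3, v6, h6', R, hR, h5', h9⟩
    have hRe := hR.eq_empty (Finset.sdiff_subset.trans hQN)
    rw [runs_set, State.leave_eq_setVar_of_var_zero _ _ _ (s'.var 9) (by simp)]
    refine hP _ ?_ { s' with var := s.var } rfl f' h6' (s'.var 9) ?_
    · simp at ht ht₁ ⊢
      have e4 : (N + 1) ^ 4 = (N + 1) * (N + 1) ^ 3 := by ring
      have e3 : (N + 1) ^ 3 = (N + 1) * (N + 1) ^ 2 := by ring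
      have : 1 ≤ (N + 1) ^ 2 := Nat.one_le_pow _ _ (by omega)
      nlinarith
    · rw [h9, hRe, hcard, IsBalanced]
      simp

end RAM

end Separates

section Total

/-! ### Summing over the components -/

namespace RAM

variable {G : SimpleGraph ℕ} {k n N : ℕ} {w : ℕ → ℚ≥0} {s : State} {P : ℕ → State → Prop}

/-- The procedure `solve` computes the optimum for `C` with at most `T` operations, and writes only
to cells from `b` on of its working arrays. -/
def Solves (G : SimpleGraph ℕ) (k n N : ℕ) (w : ℕ → ℚ≥0) (C : Finset ℕ) (T : ℕ) : Prop :=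
  ∀ s q b, Tables G k n N w s → Holds 2 q N C s → q + N ≤ b →
    Runs solver solveBody (s.enter [N, q, b]) fun t s' => t ≤ T ∧
      Frame (cells {2, 5, 6, 7, 8} b) (cells {1, 2} b) s s' ∧ s'.rat 1 b = opt G k w C

/-- The components that are solved recursively: those with at most `h / 2` vertices, if `e` holds,
and otherwise those that are dominated by a vertex of `Q`. -/
def Accepted (G : SimpleGraph ℕ) (k : ℕ) (Q : Finset ℕ) (h : ℕ) (e : Prop) (C : Finset ℕ) : Prop :=
  (e → 2 * (verts k C).card ≤ h) ∧ (¬ e → ∃ x ∈ Q, ∀ p ∈ C, G.Adj (x / k) (p / k))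

/-- All accepted connected subsets `C` of `R` are solved within `Y` operations per vertex. -/
def SolvesAccepted (G : SimpleGraph ℕ) (k n N : ℕ) (w : ℕ → ℚ≥0) (Q R : Finset ℕ) (h : ℕ) (e : Prop)
    (Y : ℕ) : Prop :=
  ∀ C ⊆ R, C.Nonempty → CutConnected (Conflict G k) (C : Set ℕ) → Accepted G k Q h e C →
    Solves G k n N w C ((verts k C).card * Y)

/-- The procedure `total` never exceeds the optimum for `R`, and attains it if all components of `R`
are accepted. As the components have disjoint sets of vertices, the costs per vertex add up. -/
theorem runs_total {q b h e Y : ℕ} {Q R : Finset ℕ} (ht : Tables G k n N w s)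
    (hQN : Q ⊆ Finset.range N) (hQ : Holds 2 q N Q s) (hqb : q + N ≤ b) (hRN : R ⊆ Finset.range N)
    (hR : Holds 5 b N R s) (hY : SolvesAccepted G k n N w Q R h (0 < e) Y) :
    Runs solver totalBody (s.enter [N, q, b, h, e]) fun t s' =>
      t ≤ 1000 * (N + 1) ^ 4 + (verts k R).card * Y ∧
      Frame (fun a i => (cells {2, 5} b) a i ∨ (cells {6, 7, 8} (b + N)) a i)
        (fun a i => (cells {2} b) a i ∨ (cells {1} (b + N)) a i) s s' ∧
      s'.rat 2 b ≤ opt G k w R ∧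
      ((∀ r ∈ R, Accepted G k Q h (0 < e) (comp G k R r)) → s'.rat 2 b = opt G k w R) := by
  set W : ℕ → ℕ → Prop := fun a i => (cells {2, 5} b) a i ∨ (cells {6, 7, 8} (b + N)) a i with hW
  set W' : ℕ → ℕ → Prop := fun a i => (cells {2} b) a i ∨ (cells {1} (b + N)) a i with hW'
  have hWc : ∀ {s s' : State}, Frame W W' s s' →
      Frame (cells {2, 5, 6, 7, 8} b) (cells {1, 2} b) s s' := fun hf => hf.mono
    (by simp only [hW, cells, Finset.mem_insert, Finset.mem_singleton]; omega)
    (by simp only [hW', cells, Finset.mem_insert, Finset.mem_singleton]; omega)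
  rw [totalBody, runs_seq, runs_putRat]
  refine runs_forLoop (N := N) (fun t i s' => Frame W W' s s' ∧ s'.var 0 = N ∧ s'.var 1 = q ∧
    s'.var 2 = b ∧ s'.var 3 = h ∧ s'.var 4 = e ∧ s'.var 5 = i ∧
    ∃ R', IsRest G k R i R' ∧ Holds 5 b N R' s' ∧
      t + (verts k R').card * Y ≤ 2 + i * (900 * (N + 1) ^ 3) + (verts k R).card * Y ∧
      s'.rat 2 b + opt G k w R' ≤ opt G k w R ∧
      ((∀ r ∈ R, Accepted G k Q h (0 < e) (comp G k R r)) →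
        s'.rat 2 b + opt G k w R' = opt G k w R)) ?_ ?_ ?_ ?_
  · refine ⟨(Frame.refl _ _ s).setRat (by simp [hW', cells]) _, by simp, by simp, by simp, by simp,
      by simp, by simp, R, .refl R, hR, by simp, ?_, fun _ => ?_⟩ <;> simp
  · intro t i s' h
    exact ⟨h.2.2.2.2.2.2.1, h.2.1⟩
  · rintro t i s' hi ⟨f', v0, v1, v2, v3, v4, v5, R', hR', h5, hT, hle, hall⟩
    have hM1 : 1 ≤ (N + 1) ^ 3 := Nat.one_le_pow _ _ (by omega)
    rw [runs_ifPos]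
    simp only [cell, NExp.eval, v2, v5, h5.pos_iff hi]
    refine ⟨fun hiR => ?_, fun hiR => ?_⟩
    · have hR'N : R' ⊆ Finset.range N := hR'.subset.trans hRN
      set C := comp G k R' i with hC
      have hCR : C ⊆ R := (comp_subset R' i).trans hR'.subset
      have hce := hR'.comp_eq i hiR
      have hcard := card_verts_eq_add (G := G) (k := k) hiR
      rw [← hC] at hce hcard
      have hopt : opt G k w R' = opt G k w C + opt G k w (R' \ C) :=
        opt_eq_add (comp_subset R' i) (not_conflict_of_comp hiR)
      rw [runs_seq]
      refine runs_closure (b := b) (r := i) v0 v2 v5 (ht.cells (hWc f') (by decide) (by decide)) hiR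
        hR'N h5 ?_
      intro t₁ ht₁ s₁ hv₁ f₁ g2 g5 a
      have f₁' : Frame W W' s (s₁.setVar 7 a) := f'.trans (f₁.mono
        (by simp only [hW]; exact fun _ _ h => .inl h) (by simp [cells]))
      have ht₁' := ht.cells (hWc f₁') (by decide) (by decide)
      have g2' : Holds 2 b N C (s₁.setVar 7 a) := g2
      have hrat : s₁.rat 2 b = s'.rat 2 b := f₁.2 _ _ (by simp [cells])
      -- both versions of the acceptance test decide `Accepted`
      have hacc : ∀ P' : ℕ → State → Prop,
          (∀ t ≤ 300 * (N + 1) ^ 2, ∀ s₂ : State, s₂.nat = s₁.nat → s₂.rat = s₁.rat →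
            (∀ y ≤ 5, s₂.var y = s'.var y) →
            (0 < s₂.var 6 ↔ Accepted G k Q h (0 < e) C) → P' t s₂) →
          Runs solver (ifPos (.var 4)
            (.seq (.call 7 1 [.var 0, .var 2])
              (.ite (.natLt (.var 3) (.add (.var 7) (.var 7)))
                (.set 6 (.const 0)) (.set 6 (.const 1))))
            (.call 6 2 [.var 0, .var 1, .var 2])) (s₁.setVar 7 a) P' := by
        intro P' hP'
        rw [runs_ifPos]
        have he : NExp.eval (s₁.setVar 7 a) (.var 4) = e := by simpa [hv₁] using v4
        rw [he]
        have hM2 : N + 1 ≤ (N + 1) ^ 2 := Nat.le_self_pow (by decide) _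
        refine ⟨fun he => ?_, fun he => ?_⟩
        · rw [runs_seq]
          refine runs_count (b := b) (Q := C) (by simpa [hv₁] using v0) (by simpa [hv₁] using v2)
            ht₁'
            ((comp_subset R' i).trans hR'N) g2' ?_
          intro t₂ ht₂
          simp only [NExp.cost] at ht₂
          simp only [runs_ite, runs_set, Test.eval, NExp.eval, State.setVar_var, hv₁, v3,
            Nat.reduceEqDiff, if_true, if_false]
          refine ⟨fun hlt => hP' _ (by simp; omega) _ rfl rfl (fun y hy => ?_) ?_,
            fun hlt => hP' _ (by simp; omega) _ rfl rfl (fun y hy => ?_) ?_⟩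
          · simp [hv₁, show y ≠ 6 by omega, show y ≠ 7 by omega]
          · simp only [Accepted, he, not_true, State.setVar_var, if_true, true_implies,
              false_implies, and_true]
            omega
          · simp [hv₁, show y ≠ 6 by omega, show y ≠ 7 by omega]
          · simp only [Accepted, he, not_true, State.setVar_var, if_true, true_implies,
              false_implies, and_true]
            omega
        · refine runs_dominated (q := q) (b := b) (Q := Q) (C := C) (by simpa [hv₁] using v0)
            (by simpa [hv₁] using v1) (by simpa [hv₁] using v2) ht₁' hQN
            ((comp_subset R' i).trans hR'N) (hQ.frame (hWc f₁') (.inr hqb)) g2' ?_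
          intro t₂ ht₂ v hv
          simp only [NExp.cost] at ht₂
          refine hP' _ (by simp; omega) _ rfl rfl (fun y hy => ?_) ?_
          · simp [hv₁, show y ≠ 6 by omega, show y ≠ 7 by omega]
          · simp only [Accepted, he, not_false_iff, State.setVar_var, if_true, true_implies,
              false_implies, true_and, hv]
      rw [runs_seq]
      refine hacc _ fun t₂ ht₂ s₂ n₂ r₂ v₂ h6 => ?_
      have f₂ : Frame W W' s s₂ := f₁'.trans ⟨fun _ _ _ => by simp [n₂], fun _ _ _ => by simp [r₂]⟩
      have hM3 : (N + 1) ^ 2 ≤ (N + 1) ^ 3 := Nat.pow_le_pow_right (by omega) (by omega)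
      rw [runs_ifPos]
      simp only [NExp.eval, h6]
      simp only [NExp.cost] at ht₁
      have hi1 : (i + 1) * (900 * (N + 1) ^ 3) = i * (900 * (N + 1) ^ 3) + 900 * (N + 1) ^ 3 := by
        ring
      have g5₂ : Holds 5 b N (R' \ C) s₂ := g5.of_eq fun j _ => by rw [n₂]
      refine ⟨fun hA => ?_, fun hA => ?_⟩
      · have hsol := hY C hCR ⟨i, self_mem_comp hiR⟩ (comp_cutConnected hiR) hA
        rw [runs_seq]
        refine runs_call (body := solveBody) rfl ?_
        simp only [List.map_cons, List.map_nil, NExp.eval, v₂ 0 (by omega), v₂ 2 (by omega), v0, v2,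
          List.sum_cons, List.sum_nil, add_zero]
        refine (hsol s₂ b (b + N) (ht.cells (hWc f₂) (by decide) (by decide))
          (g2.of_eq fun j _ => by rw [n₂]) le_rfl).mono ?_
        rintro t₃ s₃ ⟨ht₃, f₃, hr₃⟩
        rw [runs_putRat]
        have f₃' : Frame W W' s s₃ := f₂.trans (f₃.mono
          (by simp only [hW, cells, Finset.mem_insert, Finset.mem_singleton]; omega)
          (by simp only [hW', cells, Finset.mem_insert, Finset.mem_singleton]; omega))
        have hv : ∀ y ≤ 5, (s₂.leave 7 s₃).var y = s'.var y := fun y hy => by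
          rw [State.leave_var, if_neg (by omega), v₂ y hy]
        have hr : ((s₂.leave 7 s₃).setRat 2 (NExp.eval (s₂.leave 7 s₃) (.var 2))
            (QExp.eval (s₂.leave 7 s₃) (.add (.get 2 (.var 2))
              (.get 1 (.add (.var 2) (.var 0)))))).rat 2 b = s'.rat 2 b + opt G k w C := by
          have hb := f₃.2 2 b (by simp only [cells]; omega)
          simp only [NExp.eval, QExp.eval, hv 2 (by omega), hv 0 (by omega), v2, v0,
            State.setRat_rat, and_self, if_true, State.leave_rat]
          rw [hr₃, f₃.2 2 b (by simp only [cells]; omega), r₂, hrat]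
        refine ⟨?_, ?_, ?_, ?_, ?_, ?_, ?_, ?_, R' \ C, hR'.next_sdiff hiR, ?_, ?_, ?_, ?_⟩
        · simp only [State.setRat_var]
          rw [hv 5 le_rfl, v5]
        · have := fun v => (Frame.setRat (i := b) (a := 2) (s' := s₂.leave 7 s₃) f₃'
            (by simp [hW', cells]) v).setVar 5 (i + 1)
          simp only [NExp.eval, hv 2 (by omega), v2]
          exact this _
        · simpa [v0] using hv 0 (by omega)
        · simpa [v1] using hv 1 (by omega)
        · simpa [v2] using hv 2 (by omega)
        · simpa [v3] using hv 3 (by omega)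
        · simpa [v4] using hv 4 (by omega)
        · simp
        · exact Holds.frame (s' := s₃) g5₂ f₃ (.inr le_rfl)
        · rw [hcard, add_mul] at hT
          rw [hi1]
          simp
          omega
        · rw [State.setVar_rat, hr, add_assoc, ← hopt]
          exact hle
        · rw [State.setVar_rat, hr, add_assoc, ← hopt]
          exact hall
      · rw [runs_skip]
        refine ⟨by rw [v₂ 5 le_rfl, v5], f₂.setVar _ _, ?_, ?_, ?_, ?_, ?_, by simp, R' \ C,
          hR'.next_sdiff hiR, g5₂, ?_, ?_, fun h => absurd (hce ▸ h i (hR'.subset hiR)) hA⟩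
        · simpa [v0] using v₂ 0 (by omega)
        · simpa [v1] using v₂ 1 (by omega)
        · simpa [v2] using v₂ 2 (by omega)
        · simpa [v3] using v₂ 3 (by omega)
        · simpa [v4] using v₂ 4 (by omega)
        · rw [hcard, add_mul] at hT
          rw [hi1]
          simp
          omega
        · rw [State.setVar_rat, r₂, hrat]
          refine le_trans ?_ hle
          rw [hopt]
          exact add_le_add le_rfl le_add_self
    · rw [runs_skip]
      refine ⟨v5, f'.setVar _ _, v0, v1, v2, v3, v4, by simp, R', hR'.next hiR, h5, ?_, hle, hall⟩
      simp
      nlinarith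
  · rintro t s' ⟨f', -, -, -, -, -, -, R', hR', -, hT, hle, hall⟩
    have hRe := hR'.eq_empty hRN
    rw [hRe, opt_empty, add_zero] at hle hall
    refine ⟨?_, f', hle, hall⟩
    rw [hRe] at hT
    simp [verts] at hT ⊢
    have e4 : (N + 1) ^ 4 = (N + 1) * (N + 1) ^ 3 := by ring
    have hM1 : 1 ≤ (N + 1) ^ 3 := Nat.one_le_pow _ _ (by omega)
    nlinarith

end RAM

end Total

section Evaluate

/-! ### Evaluating a guess -/

namespace RAM

variable {G : SimpleGraph ℕ} {k n N : ℕ} {w : ℕ → ℚ≥0} {s : State} {P : ℕ → State → Prop}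

/-- The procedure `evaluate` raises the best value found so far to the total of the accepted
components for the guess `J`, if this is larger. The total is never more than the optimum for `Q`.
-/
theorem runs_evaluate {q b h e Y : ℕ} {Q S J : Finset ℕ} (hN : 0 < N) (ht : Tables G k n N w s)
    (hQN : Q ⊆ Finset.range N) (hQ : Holds 2 q N Q s) (hqb : q + N ≤ b) (hJN : J ⊆ Finset.range N)
    (hS : Holds 6 b N S s) (hJ : Holds 7 b N J s)
    (hY : SolvesAccepted G k n N w Q Q h (0 < e) Y) :
    Runs solver evaluateBody (s.enter [N, q, b, h, e]) fun t s' =>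
      t ≤ 2000 * (N + 1) ^ 4 + (verts k Q).card * Y ∧
      Frame (fun a i => (cells {2, 5} b) a i ∨ (cells {6, 7, 8} (b + N)) a i)
        (cells {1, 2} b) s s' ∧
      s.rat 1 b ≤ s'.rat 1 b ∧ (s.rat 1 b ≤ opt G k w Q → s'.rat 1 b ≤ opt G k w Q) ∧
      ((∀ r ∈ restrict G k Q S J (0 < e),
        Accepted G k Q h (0 < e) (comp G k (restrict G k Q S J (0 < e)) r)) →
        opt G k w (restrict G k Q S J (0 < e)) ≤ s'.rat 1 b) := by
  set R := restrict G k Q S J (0 < e) with hR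
  have hRQ : R ⊆ Q := restrict_subset
  have hcost : ∀ x y, (clashE x y).cost = 23 := fun _ _ => rfl
  rw [evaluateBody, runs_seq]
  refine runs_for (N := N) (T := 200 * (N + 1)) (fun i s' => Frame (cells {5} b) (cells ∅ b) s s' ∧
    s'.var 0 = N ∧ s'.var 1 = q ∧ s'.var 2 = b ∧ s'.var 3 = h ∧ s'.var 4 = e ∧ s'.var 5 = i ∧
    ∀ j < i, s'.nat 5 (b + j) = if j ∈ R then 1 else 0) ?_ ?_ ?_ ?_
  · refine ⟨Frame.refl _ _ s, ?_⟩
    simp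
  · intro i s' h
    exact ⟨h.2.2.2.2.2.2.1, h.2.1⟩
  · rintro i s' hi ⟨f', v0, v1, v2, v3, v4, v5, h5⟩
    have hQ' : Holds 2 q N Q s' := hQ.frame f' (.inl (by decide))
    have hS' : Holds 6 b N S s' := hS.frame f' (.inl (by decide))
    have hJ' : Holds 7 b N J s' := hJ.frame f' (.inl (by decide))
    -- the loop over the pairs of the guess
    have hloop : ∀ s₁ : State, Frame (cells {5} b) (cells ∅ b) s s₁ → s₁.var = s'.var →
        (∀ j < i, s₁.nat 5 (b + j) = if j ∈ R then 1 else 0) →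
        (i ∈ Q ∧ (0 < e → i ∈ S → i ∈ J) → s₁.nat 5 (b + i) = 1) →
        (¬ (i ∈ Q ∧ (0 < e → i ∈ S → i ∈ J)) → s₁.nat 5 (b + i) = 0) →
        ∀ P' : ℕ → State → Prop, (∀ t s₂, t ≤ 100 * (N + 1) → s₂.var 5 = i ∧
          Frame (cells {5} b) (cells ∅ b) s s₂ ∧
          s₂.var 0 = N ∧ s₂.var 1 = q ∧ s₂.var 2 = b ∧ s₂.var 3 = h ∧ s₂.var 4 = e ∧
          (∀ j < i + 1, s₂.nat 5 (b + j) = if j ∈ R then 1 else 0) → P' t s₂) →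
        Runs solver (forLoop 6 (.var 0)
          (ifPos (cell 7 2 6)
            (ifPos (clashE 6 5) (.put 5 (.add (.var 2) (.var 5)) (.const 0)) .skip)
            .skip)) s₁ P' := by
      intro s₁ f₁ hv₁ h5₁ hi1 hi0 P' hP'
      refine runs_for (N := N) (T := 60) (fun j s₂ => Frame (cells {5} b) (cells ∅ b) s s₂ ∧
        s₂.var 0 = N ∧ s₂.var 1 = q ∧ s₂.var 2 = b ∧ s₂.var 3 = h ∧ s₂.var 4 = e ∧ s₂.var 5 = i ∧
        s₂.var 6 = j ∧ (∀ j < i, s₂.nat 5 (b + j) = if j ∈ R then 1 else 0) ∧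
        ((i ∈ Q ∧ (0 < e → i ∈ S → i ∈ J)) ∧ (∀ j' ∈ J, j' < j → ¬ Clash G k j' i) →
          s₂.nat 5 (b + i) = 1) ∧
        (¬ ((i ∈ Q ∧ (0 < e → i ∈ S → i ∈ J)) ∧ ∀ j' ∈ J, j' < j → ¬ Clash G k j' i) →
          s₂.nat 5 (b + i) = 0)) ?_ ?_ ?_ ?_
      · refine ⟨f₁.setVar _ _, ?_⟩
        simp [hv₁, v0, v1, v2, v3, v4, v5]
        exact ⟨h5₁, fun h1 h2 => hi1 ⟨h1, h2⟩, fun h => hi0 fun h' => by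
          obtain ⟨h1, h2, h3⟩ := h h'.1
          exact h3 (h'.2 h1 h2)⟩
      · intro j s₂ h
        exact ⟨h.2.2.2.2.2.2.2.1, h.2.1⟩
      · rintro j s₂ hj ⟨f₂, w0, w1, w2, w3, w4, w5, w6, g5, g1, g0⟩
        have hpos := (hJ.frame f₂ (.inl (by decide))).pos_iff hj
        have hcl := clashE_eval (ht.cells f₂ (by decide) (by decide)) (x := 6) (y := 5)
          (by omega) (by omega)
        rw [w5, w6] at hcl
        simp only [runs_ifPos, runs_skip, runs_put, cell, NExp.eval, w2, w6, w5, hpos, hcl]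
        have hsucc : ∀ p : ℕ → Prop, (∀ j' ∈ J, j' < j + 1 → p j') ↔
            (∀ j' ∈ J, j' < j → p j') ∧ (j ∈ J → p j) := fun p =>
          ⟨fun h => ⟨fun j' h1 h2 => h j' h1 (by omega), fun h1 => h j h1 (by omega)⟩,
            fun h j' h1 h2 => (Nat.lt_succ_iff_lt_or_eq.1 h2).elim (h.1 j' h1)
              fun h3 => h3 ▸ h.2 (h3 ▸ h1)⟩
        rw [hsucc]
        refine ⟨fun hjJ => ⟨fun hc => ?_, fun hc => ?_⟩, fun hjJ => ?_⟩
        · refine ⟨by simp [hcost], by simpa using w6, (f₂.setNat (by simp [cells]) _).setVar _ _,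
            by simpa using w0, by simpa using w1, by simpa using w2, by simpa using w3,
            by simpa using w4, by simpa using w5, by simp, fun j' hj' => ?_,
            fun h => absurd hc (h.2.2 hjJ), fun _ => by simp⟩
          have hne : j' ≠ i := by omega
          simpa [hne] using g5 j' hj'
        · refine ⟨by simp [hcost], trivial, f₂.setVar _ _,
            by simpa using w0, by simpa using w1, by simpa using w2, by simpa using w3,
            by simpa using w4, by simpa using w5, by simp, g5, fun h => g1 ⟨h.1, h.2.1⟩,
            fun h => g0 fun h' => h ⟨h'.1, h'.2, fun _ => hc⟩⟩
        · refine ⟨by simp, trivial, f₂.setVar _ _,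
            by simpa using w0, by simpa using w1, by simpa using w2, by simpa using w3,
            by simpa using w4, by simpa using w5, by simp, g5, fun h => g1 ⟨h.1, h.2.1⟩,
            fun h => g0 fun h' => h ⟨h'.1, h'.2, fun h => absurd h hjJ⟩⟩
      · rintro t s₂ ht ⟨f₂, w0, w1, w2, w3, w4, w5, w6, g5, g1, g0⟩
        refine hP' t s₂ (by simp at ht; omega) ⟨w5, f₂, w0, w1, w2, w3, w4, fun j hj => ?_⟩
        have hiR : i ∈ R ↔ ((i ∈ Q ∧ (0 < e → i ∈ S → i ∈ J)) ∧
            ∀ j' ∈ J, j' < N → ¬ Clash G k j' i) := by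
          rw [hR, mem_restrict, and_assoc]
          refine and_congr_right fun _ => and_congr_right fun _ => ?_
          exact ⟨fun h j' hj' _ => h j' hj', fun h j' hj' => h j' hj' (Finset.mem_range.1 (hJN hj'))⟩
        rcases Nat.lt_succ_iff_lt_or_eq.1 hj with h' | rfl
        · exact g5 j h'
        · split_ifs with hjR
          · exact g1 (hiR.1 hjR)
          · exact g0 fun h => hjR (hiR.2 h)
    have hfin : ∀ (c t : ℕ) (s₂ : State), c ≤ 50 → t ≤ 100 * (N + 1) → s₂.var 5 = i ∧
          Frame (cells {5} b) (cells ∅ b) s s₂ ∧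
          s₂.var 0 = N ∧ s₂.var 1 = q ∧ s₂.var 2 = b ∧ s₂.var 3 = h ∧ s₂.var 4 = e ∧
          (∀ j < i + 1, s₂.nat 5 (b + j) = if j ∈ R then 1 else 0) →
        c + t ≤ 200 * (N + 1) ∧ s₂.var 5 = i ∧
        Frame (cells {5} b) (cells ∅ b) s (s₂.setVar 5 (i + 1)) ∧
        (s₂.setVar 5 (i + 1)).var 0 = N ∧ (s₂.setVar 5 (i + 1)).var 1 = q ∧
        (s₂.setVar 5 (i + 1)).var 2 = b ∧ (s₂.setVar 5 (i + 1)).var 3 = h ∧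
        (s₂.setVar 5 (i + 1)).var 4 = e ∧ (s₂.setVar 5 (i + 1)).var 5 = i + 1 ∧
        ∀ j < i + 1, (s₂.setVar 5 (i + 1)).nat 5 (b + j) = if j ∈ R then 1 else 0 := by
      rintro c t s₂ hc ht₂ ⟨g1, g2, g3, g4, g5, g6, g7, g8⟩
      refine ⟨by omega, g1, g2.setVar _ _, ?_⟩
      simpa [g3, g4, g5, g6, g7] using g8
    rw [runs_seq, runs_put]
    simp only [cell, NExp.eval, v1, v2, v5, hQ' i hi]
    set s₁ := s'.setNat 5 (b + i) (if i ∈ Q then 1 else 0) with hs₁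
    have f₁ : Frame (cells {5} b) (cells ∅ b) s s₁ := f'.setNat (by simp [cells]) _
    have hv₁ : s₁.var = s'.var := rfl
    have hS₁ := (hS.frame f₁ (.inl (by decide))).pos_iff hi
    have hJ₁ := (hJ.frame f₁ (.inl (by decide))).pos_iff hi
    have h5₁ : ∀ v, ∀ j < i, (s₁.setNat 5 (b + i) v).nat 5 (b + j) = if j ∈ R then 1 else 0 := by
      intro v j hj
      have := h5 j hj
      have hne : j ≠ i := by omega
      simpa [hs₁, hne] using this
    have h5₁' : ∀ j < i, s₁.nat 5 (b + j) = if j ∈ R then 1 else 0 := by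
      intro j hj
      have := h5 j hj
      have hne : j ≠ i := by omega
      simpa [hs₁, hne] using this
    have hval : s₁.nat 5 (b + i) = if i ∈ Q then 1 else 0 := by simp [hs₁]
    rw [runs_seq]
    simp only [runs_ifPos, runs_skip, runs_put, NExp.eval, hv₁, v2, v4, v5, hS₁, hJ₁]
    refine ⟨fun he => ⟨fun hiS => ⟨fun hiJ => ?_, fun hiJ => ?_⟩, fun hiS => ?_⟩, fun he => ?_⟩
    · refine hloop s₁ f₁ hv₁ h5₁' (fun h => by rw [hval, if_pos h.1])
        (fun h => by rw [hval, if_neg fun h' => h ⟨h', fun _ _ => hiJ⟩]) _ fun t s₂ ht₂ hs₂ => ?_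
      rw [← add_assoc]
      exact hfin _ _ _ (by simp) ht₂ hs₂
    · refine hloop (s₁.setNat 5 (b + i) 0) (f₁.setNat (by simp [cells]) _) hv₁ (h5₁ 0)
        (fun h => absurd (h.2 he hiS) hiJ) (fun h => by simp) _ fun t s₂ ht₂ hs₂ => ?_
      rw [← add_assoc]
      exact hfin _ _ _ (by simp) ht₂ hs₂
    · refine hloop s₁ f₁ hv₁ h5₁' (fun h => by rw [hval, if_pos h.1])
        (fun h => by rw [hval, if_neg fun h' => h ⟨h', fun _ h => absurd h hiS⟩]) _
        fun t s₂ ht₂ hs₂ => ?_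
      rw [← add_assoc]
      exact hfin _ _ _ (by simp) ht₂ hs₂
    · refine hloop s₁ f₁ hv₁ h5₁' (fun h => by rw [hval, if_pos h.1])
        (fun h => by rw [hval, if_neg fun h' => h ⟨h', fun h => absurd h he⟩]) _
        fun t s₂ ht₂ hs₂ => ?_
      rw [← add_assoc]
      exact hfin _ _ _ (by simp) ht₂ hs₂
  rintro t₁ s₁ ht₁ ⟨f₁, v0, v1, v2, v3, v4, v5, h5⟩
  rw [runs_seq]
  refine runs_call (body := totalBody) rfl ?_
  simp only [List.map_cons, List.map_nil, NExp.eval, v0, v1, v2, v3, v4, List.sum_cons,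
    List.sum_nil, add_zero]
  refine (runs_total (Y := Y) (R := R) (ht.cells f₁ (by decide) (by decide)) hQN
    (hQ.frame f₁ (.inl (by decide))) hqb (hRQ.trans hQN) h5
    fun C hC => hY C (hC.trans hRQ)).mono ?_
  rintro t₂ s₂ ⟨ht₂, f₂, hle, hall⟩
  have f₂' : Frame (fun a i => (cells {2, 5} b) a i ∨ (cells {6, 7, 8} (b + N)) a i)
      (cells {1, 2} b) s s₂ := (f₁.mono
        (by simp only [cells, Finset.mem_insert, Finset.mem_singleton]; omega)
        (by simp [cells])).trans (f₂.mono (fun _ _ h => h)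
        (by simp only [cells, Finset.mem_insert, Finset.mem_singleton]; omega))
  have hrat : s₂.rat 1 b = s.rat 1 b := by
    rw [f₂.2 1 b (by
      simp only [cells, Finset.mem_singleton]; omega), f₁.2 1 b (by simp [cells])]
  have hcardR : (verts k R).card * Y ≤ (verts k Q).card * Y :=
    Nat.mul_le_mul_right _ (Finset.card_le_card (Finset.image_subset_image hRQ))
  have hRopt := opt_mono (G := G) (k := k) (w := w) hRQ
  have e4 : (N + 1) ^ 4 = (N + 1) * (N + 1) * (N + 1) ^ 2 := by ring
  have hM1 : 1 ≤ (N + 1) ^ 2 := Nat.one_le_pow _ _ (by omega)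
  have hM2 : (N + 1) * (N + 1) ≤ (N + 1) ^ 4 := by rw [e4]; exact Nat.le_mul_of_pos_right _ hM1
  have hM3 : 1 ≤ (N + 1) ^ 4 := Nat.one_le_pow _ _ (by omega)
  have ht₁' : t₁ ≤ 207 * (N + 1) ^ 4 := by
    simp at ht₁
    nlinarith
  have hv2 : (s₁.leave 7 s₂).var 2 = b := by simpa using v2
  simp only [runs_ite, runs_putRat, runs_skip, Test.eval, QExp.eval, NExp.eval, hv2,
    State.leave_rat, hrat]
  refine ⟨fun hlt => ⟨by simp; omega, ?_, ?_, ?_, ?_⟩, fun hlt => ⟨by simp; omega, ?_, ?_, ?_, ?_⟩⟩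
  · exact Frame.setRat (s' := s₁.leave 7 s₂) f₂' (by simp [cells]) _
  · simpa using hlt.le
  · intro _
    simpa using hle.trans hRopt
  · intro h
    simpa using (hall h).ge
  · exact f₂'
  · simp
  · intro h
    simpa [hrat] using h
  · intro h
    rw [← hall h]
    simpa [hrat] using hlt

end RAM

end Evaluate

section Guess

/-! ### Enumerating the guesses -/

namespace RAM

variable {G : SimpleGraph ℕ} {k n N : ℕ} {w : ℕ → ℚ≥0} {s : State}

open Classical in
/-- The sets `J ⊆ S` with at most `cap` pairs of each color that agree with `J₀` below `pos`. -/
noncomputable def guesses (k N : ℕ) (S : Finset ℕ) (cap pos : ℕ) (J₀ : Finset ℕ) :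
    Finset (Finset ℕ) :=
  (S ∩ Finset.range N).powerset.filter fun J => J ∩ Finset.range pos = J₀ ∧
    ∀ c, (J.filter (· % k = c)).card ≤ cap

theorem mem_guesses {S J₀ J : Finset ℕ} {cap pos : ℕ} : J ∈ guesses k N S cap pos J₀ ↔
    J ⊆ S ∩ Finset.range N ∧ J ∩ Finset.range pos = J₀ ∧
      ∀ c, (J.filter (· % k = c)).card ≤ cap := by
  classical
  rw [guesses, Finset.mem_filter, Finset.mem_powerset]

/-- The effect of trying all guesses in `F`. The value in cell `b` of the rational array `1` only
increases, is bounded by the optimum for `Q`, and is at least the value of every guess for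
which all components are accepted; the data of the enumeration in the arrays `6`, `7` and `8` are
restored. -/
structure Tried (G : SimpleGraph ℕ) (k N : ℕ) (w : ℕ → ℚ≥0) (b h : ℕ) (e : Prop) (Q S : Finset ℕ)
    (F : Finset (Finset ℕ)) (s s' : State) : Prop where
  frame : Frame (cells {2, 5, 6, 7, 8} b) (cells {1, 2} b) s s'
  keep : ∀ a, a ∈ ({6, 7, 8} : Finset ℕ) → ∀ i < N, s'.nat a (b + i) = s.nat a (b + i)
  mono : s.rat 1 b ≤ s'.rat 1 b
  le_opt : s.rat 1 b ≤ opt G k w Q → s'.rat 1 b ≤ opt G k w Q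
  le : ∀ J ∈ F, (∀ r ∈ restrict G k Q S J e,
    Accepted G k Q h e (comp G k (restrict G k Q S J e) r)) →
    opt G k w (restrict G k Q S J e) ≤ s'.rat 1 b

theorem card_filter_insert {J : Finset ℕ} {p : ℕ} (hp : p ∉ J) (c : ℕ) :
    ((insert p J).filter (· % k = c)).card =
      (J.filter (· % k = c)).card + if p % k = c then 1 else 0 := by
  rw [Finset.filter_insert]
  split_ifs with h
  · rw [Finset.card_insert_of_notMem fun h' => hp (Finset.mem_filter.1 h').1]
  · simp

/-- The procedure `guess` with `d` undecided positions tries all guesses in `guesses k N S cap pos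
J`; it calls itself with and without the pair `pos`, and every branch leads to some guess. -/
theorem runs_guess {q b h e cap Y : ℕ} {Q S : Finset ℕ} (hN : 0 < N)
    (hQN : Q ⊆ Finset.range N) (hqb : q + N ≤ b)
    (hY : SolvesAccepted G k n N w Q Q h (0 < e) Y) (d : ℕ) :
    ∀ (s : State) (pos : ℕ) (J : Finset ℕ), N = pos + d → Tables G k n N w s → Holds 2 q N Q s →
      Holds 6 b N S s → Holds 7 b N J s → J ⊆ S → J ⊆ Finset.range pos →
      (∀ c < N, s.nat 8 (b + c) = (J.filter (· % k = c)).card) →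
      (∀ c, (J.filter (· % k = c)).card ≤ cap) →
      Runs solver guessBody (s.enter [N, q, b, h, e, cap, pos]) fun t s' =>
        t ≤ (guesses k N S cap pos J).card *
          (2000 * (N + 1) ^ 4 + (verts k Q).card * Y + 100 * (d + 1)) ∧
        Tried G k N w b h (0 < e) Q S (guesses k N S cap pos J) s s' := by
  have hmem : ∀ pos ≤ N, ∀ J ⊆ S, J ⊆ Finset.range pos →
      (∀ c, (J.filter (· % k = c)).card ≤ cap) → J ∈ guesses k N S cap pos J := by
    intro pos hpos J hJS hJ hcap
    exact mem_guesses.2 ⟨Finset.subset_inter hJS fun x hx => Finset.mem_range.2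
      ((Finset.mem_range.1 (hJ hx)).trans_le hpos), Finset.inter_eq_left.2 hJ, hcap⟩
  induction d with
  | zero =>
    intro s pos J hNpos ht hQ hS hJ hJS hJpos hused hcap
    obtain rfl : N = pos := hNpos
    rw [guessBody, runs_ite]
    refine ⟨fun h => absurd h (by simp), fun _ => ?_⟩
    refine runs_call (body := evaluateBody) rfl ?_
    refine (runs_evaluate (q := q) (b := b) (h := h) (e := e) (s := s) hN ht hQN hQ hqb hJpos hS hJ
      hY).mono ?_
    rintro t s' ⟨ht, hf, h1, h2, h3⟩
    have hF := Finset.card_pos.2 ⟨J, hmem N le_rfl J hJS hJpos hcap⟩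
    refine ⟨?_, hf.mono ?_ fun _ _ h => h, fun a ha i hi => hf.1 _ _ ?_, h1, h2, fun J' hJ' => ?_⟩
    · refine le_trans ?_ (Nat.le_mul_of_pos_left _ hF)
      simp
      omega
    · simp only [cells, Finset.mem_insert, Finset.mem_singleton]
      omega
    · simp only [cells, Finset.mem_insert, Finset.mem_singleton] at ha ⊢
      omega
    · obtain ⟨g1, g2, -⟩ := mem_guesses.1 hJ'
      rw [Finset.inter_eq_left.2 (g1.trans Finset.inter_subset_right)] at g2
      rw [g2]
      exact h3
  | succ d ih =>
    intro s pos J hNpos ht hQ hS hJ hJS hJpos hused hcap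
    have hpos : pos < N := by omega
    have hpk : pos % k < N := (Nat.mod_le _ _).trans_lt hpos
    have hJpos' : J ⊆ Finset.range (pos + 1) := hJpos.trans (Finset.range_subset_range.2 (by omega))
    have hpJ : pos ∉ J := fun h => absurd (Finset.mem_range.1 (hJpos h)) (by omega)
    set Z := 2000 * (N + 1) ^ 4 + (verts k Q).card * Y with hZ
    rw [guessBody, runs_ite]
    refine ⟨fun _ => ?_, fun h => absurd h (by simp; omega)⟩
    rw [runs_seq]
    refine runs_call (body := guessBody) rfl ?_
    refine (ih s (pos + 1) J (by omega) ht hQ hS hJ hJS hJpos' hused hcap).mono ?_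
    rintro t₁ s₁ ⟨ht₁, h₁⟩
    set s₁' := (s.enter [N, q, b, h, e, cap, pos]).leave 7 s₁ with hs₁'
    have hv : ∀ y, y ≠ 7 → s₁'.var y = [N, q, b, h, e, cap, pos].getD y 0 := fun y hy => by
      simp [hs₁', hy]
    have hn : s₁'.nat = s₁.nat := rfl
    have hS₁ : Holds 6 b N S s₁ := hS.of_eq (h₁.keep 6 (by decide))
    have hJ₁ : Holds 7 b N J s₁ := hJ.of_eq (h₁.keep 7 (by decide))
    have ht₁' : Tables G k n N w s₁ := ht.cells h₁.frame (by decide) (by decide)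
    have hcol : s₁.nat 10 pos = pos % k := ht₁'.color pos hpos
    have hu₁ : s₁.nat 8 (b + pos % k) = (J.filter (· % k = pos % k)).card :=
      (h₁.keep 8 (by decide) _ hpk).trans (hused _ hpk)
    have hmem₁ := hmem (pos + 1) hpos J hJS hJpos' hcap
    have hsub₁ : guesses k N S cap (pos + 1) J ⊆ guesses k N S cap pos J := by
      intro J' hJ'
      obtain ⟨g1, g2, g3⟩ := mem_guesses.1 hJ'
      refine mem_guesses.2 ⟨g1, ?_, g3⟩
      rw [← Finset.inter_eq_left.2 hJpos, ← g2, Finset.inter_assoc]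
      congr 1
      rw [Finset.inter_eq_right.2 (Finset.range_subset_range.2 (by omega))]
    have hcase : ∀ J' ∈ guesses k N S cap pos J, J' ∈ guesses k N S cap (pos + 1) J ∨
        pos ∈ S ∧ (J.filter (· % k = pos % k)).card < cap ∧
        J' ∈ guesses k N S cap (pos + 1) (insert pos J) := by
      intro J' hJ'
      obtain ⟨g1, g2, g3⟩ := mem_guesses.1 hJ'
      have hr : Finset.range (pos + 1) = insert pos (Finset.range pos) := Finset.range_add_one
      by_cases hp : pos ∈ J'
      · right
        have hins : J' ∩ Finset.range (pos + 1) = insert pos J := by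
          rw [hr, Finset.inter_insert_of_mem hp, g2]
        refine ⟨(Finset.mem_inter.1 (g1 hp)).1, ?_, mem_guesses.2 ⟨g1, hins, g3⟩⟩
        refine lt_of_lt_of_le ?_ (g3 (pos % k))
        have := Finset.card_le_card (Finset.filter_subset_filter (· % k = pos % k)
          (hins.symm.subset.trans Finset.inter_subset_left))
        rw [card_filter_insert hpJ] at this
        simpa using this
      · left
        refine mem_guesses.2 ⟨g1, ?_, g3⟩
        rw [hr, Finset.inter_insert_of_notMem hp, g2]
    -- the case that `pos` cannot be part of the guess
    have hskip : ¬ (pos ∈ S ∧ (J.filter (· % k = pos % k)).card < cap) → ∀ c ≤ 70,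
        t₁ + c ≤ (guesses k N S cap pos J).card * (Z + 100 * (d + 1 + 1)) ∧
        Tried G k N w b h (0 < e) Q S (guesses k N S cap pos J) s s₁' := by
      intro hno c hc
      have heq : guesses k N S cap pos J = guesses k N S cap (pos + 1) J :=
        Finset.Subset.antisymm (fun J' hJ' => (hcase J' hJ').resolve_right
          fun h => hno ⟨h.1, h.2.1⟩) hsub₁
      rw [heq]
      refine ⟨?_, h₁.frame, h₁.keep, h₁.mono, h₁.le_opt, h₁.le⟩
      have := Finset.card_pos.2 ⟨J, hmem₁⟩
      nlinarith
    simp only [runs_ifPos, runs_ite, runs_seq, runs_put, runs_skip, cell, NExp.eval, Test.eval,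
      hv 2 (by decide), hv 5 (by decide), hv 6 (by decide), State.setNat_var, hn,
      List.getD_cons_succ, List.getD_cons_zero, hcol, hS₁.pos_iff hpos, hu₁]
    refine ⟨fun hpS => ⟨fun hlt => ?_, fun hlt => ?_⟩, fun hpS => ?_⟩
    rotate_left
    · have := hskip (fun h => hlt h.2) 42 (by decide)
      refine ⟨?_, this.2⟩
      simp
      omega
    · have := hskip (fun h => hpS h.1) 42 (by decide)
      refine ⟨?_, this.2⟩
      simp
      omega
    have hcol' : ∀ a i v, a ≠ 10 → (s₁'.setNat a i v).nat 10 pos = pos % k := fun a i v ha => by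
      rw [State.setNat_nat, if_neg fun h => ha h.1.symm]
      exact hcol
    simp only [hcol' 7 _ _ (by decide)]
    set s₂ := (s₁'.setNat 7 (b + pos) 1).setNat 8 (b + pos % k)
      ((s₁'.setNat 7 (b + pos) 1).nat 8 (b + pos % k) + 1) with hs₂
    have h8 : (s₁'.setNat 7 (b + pos) 1).nat 8 (b + pos % k) =
        (J.filter (· % k = pos % k)).card := by
      rw [State.setNat_nat, if_neg (by simp)]
      exact hu₁
    have f₂ : Frame (cells {2, 5, 6, 7, 8} b) (cells {1, 2} b) s s₂ :=
      ((show Frame _ _ s s₁' from h₁.frame).setNat (by simp [cells]) _).setNat (by simp [cells]) _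
    refine runs_call (body := guessBody) rfl ?_
    have hv₂ : s₂.var = s₁'.var := rfl
    simp only [List.map_cons, List.map_nil, NExp.eval, hv₂, hv 0 (by decide), hv 1 (by decide),
      hv 2 (by decide), hv 3 (by decide), hv 4 (by decide), hv 5 (by decide), hv 6 (by decide),
      List.getD_cons_succ, List.getD_cons_zero]
    have hcap' : ∀ c, ((insert pos J).filter (· % k = c)).card ≤ cap := by
      intro c
      rw [card_filter_insert hpJ]
      split_ifs with hc
      · subst hc
        omega
      · simpa using hcap c
    have hJpos'' : insert pos J ⊆ Finset.range (pos + 1) :=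
      Finset.insert_subset (Finset.self_mem_range_succ pos) hJpos'
    have hJS' : insert pos J ⊆ S := Finset.insert_subset hpS hJS
    refine (ih s₂ (pos + 1) (insert pos J) (by omega) (ht.cells f₂ (by decide) (by decide))
      (hQ.frame f₂ (.inr hqb)) ((hS₁.setNat_of_ne (by decide) _ _).setNat_of_ne (by decide) _ _)
      ((Holds.insert (s := s₁') hJ₁ pos).setNat_of_ne (by decide) _ _) hJS'
      hJpos'' ?_ hcap').mono ?_
    · intro c hc
      rw [card_filter_insert hpJ, hs₂, State.setNat_nat, h8]
      by_cases hcp : pos % k = c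
      · simp [hcp]
      · have hcp' : c ≠ pos % k := fun h => hcp h.symm
        simp only [hcp, hcp', if_false, add_zero, Nat.add_left_cancel_iff, and_false,
          State.setNat_nat]
        rw [if_neg (by simp)]
        exact (h₁.keep 8 (by decide) _ hc).trans (hused _ hc)
    rintro t₂ s₃ ⟨ht₂, h₂⟩
    have hw : ∀ y, y ≠ 7 → (s₂.leave 7 s₃).var y = [N, q, b, h, e, cap, pos].getD y 0 := by
      intro y hy
      rw [State.leave_var, if_neg hy, hv₂, hv y hy]
    have hcol₃ : s₃.nat 10 pos = pos % k :=
      ((ht.cells (f₂.trans h₂.frame) (by decide) (by decide)).color pos hpos)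
    have hw8 : ∀ i v, ((s₂.leave 7 s₃).setNat 7 i v).nat 10 pos = pos % k := fun i v => by
      rw [State.setNat_nat, if_neg (by simp)]
      exact hcol₃
    simp only [hw 2 (by decide), hw 6 (by decide), List.getD_cons_succ, List.getD_cons_zero, hw8]
    have hdisj : Disjoint (guesses k N S cap (pos + 1) J)
        (guesses k N S cap (pos + 1) (insert pos J)) := by
      rw [Finset.disjoint_left]
      intro J' h h'
      have := (mem_guesses.1 h).2.1.symm.trans (mem_guesses.1 h').2.1
      exact hpJ (this ▸ Finset.mem_insert_self _ _)
    have hsub₂ : guesses k N S cap (pos + 1) (insert pos J) ⊆ guesses k N S cap pos J := by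
      intro J' hJ'
      obtain ⟨g1, g2, g3⟩ := mem_guesses.1 hJ'
      refine mem_guesses.2 ⟨g1, ?_, g3⟩
      have : J' ∩ Finset.range pos = J' ∩ Finset.range (pos + 1) ∩ Finset.range pos := by
        rw [Finset.inter_assoc, Finset.inter_eq_right.2 (Finset.range_subset_range.2 (by omega))]
      rw [this, g2, Finset.insert_inter_of_notMem (by simp), Finset.inter_eq_left.2 hJpos]
    have hcard := Finset.card_le_card (Finset.union_subset hsub₁ hsub₂)
    rw [Finset.card_union_of_disjoint hdisj] at hcard
    have hr₂ : s₂.rat = s₁.rat := rfl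
    refine ⟨?_, ?_, ?_, ?_, ?_, ?_⟩
    · have := Finset.card_pos.2 ⟨J, hmem₁⟩
      have := Nat.mul_le_mul_right (Z + 100 * (d + 1 + 1)) hcard
      simp
      nlinarith
    · exact ((show Frame _ _ s (s₂.leave 7 s₃) from f₂.trans h₂.frame).setNat
        (by simp [cells]) _).setNat (by simp [cells]) _
    · intro a ha i hi
      have k1 := h₁.keep a ha i hi
      have k2 := h₂.keep a ha i hi
      have k3 := h₂.keep 8 (by decide) _ hpk
      rw [hs₂, State.setNat_nat, if_pos ⟨rfl, rfl⟩, h8] at k3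
      rw [hs₂, State.setNat_nat, State.setNat_nat, hn] at k2
      have k4 := hJ₁ pos hpos
      rw [if_neg hpJ] at k4
      simp only [State.setNat_nat, State.leave_nat]
      rw [← k1, k2]
      by_cases ha7 : a = 7
      · subst ha7
        by_cases hip : i = pos
        · subst hip
          simp [k4]
        · simp [hip, hn]
      · by_cases ha8 : a = 8
        · subst ha8
          by_cases hip : i = pos % k
          · subst hip
            simp [k3, hu₁]
          · simp [hip, hn]
        · simp [ha7, ha8, hn]
    · exact h₁.mono.trans h₂.mono
    · exact fun h => h₂.le_opt (h₁.le_opt h)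
    · intro J' hJ' hg
      rcases hcase J' hJ' with h | h
      · exact (h₁.le J' h hg).trans h₂.mono
      · exact h₂.le J' h.2.2 hg

end RAM

end Guess

section Solve

/-! ### One level of the recursion -/

namespace RAM

variable {G : SimpleGraph ℕ} {k n N : ℕ} {w : ℕ → ℚ≥0} {s : State}

theorem mem_twins_of_div_eq {Q : Finset ℕ} {p x y : ℕ} (hx : x ∈ twins G k Q p) (hy : y ∈ Q)
    (h : x / k = y / k) : y ∈ twins G k Q p := by
  refine mem_twins.2 ⟨hy, fun z hz => ((mem_twins.1 hx).2 z hz).trans ?_⟩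
  rw [Near, Near, h]

theorem mem_guesses_zero_empty {S : Finset ℕ} {cap : ℕ} {J : Finset ℕ} (hJS : J ⊆ S)
    (hJN : J ⊆ Finset.range N) (hcap : ∀ c, (J.filter (· % k = c)).card ≤ cap) :
    J ∈ guesses k N S cap 0 ∅ :=
  mem_guesses.2 ⟨Finset.subset_inter hJS hJN, by simp, hcap⟩

/-- The guesses that are tried suffice to find the optimum. -/
theorem opt_le_of_guesses (hG : EndsDominate G) (hk : 0 < k) {Q S : Finset ℕ} {cap : ℕ} {e : Prop}
    {x : ℚ≥0} (hQc : CutConnected (Conflict G k) (Q : Set ℕ)) (hQN : Q ⊆ Finset.range N)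
    (hN : ∀ p, p / k ∈ verts k Q → p < N) (hx : ∀ p ∈ Q, w p ≤ x)
    (hle : ∀ J ∈ guesses k N S cap 0 ∅, (∀ r ∈ restrict G k Q S J e,
      Accepted G k Q (verts k Q).card e (comp G k (restrict G k Q S J e) r)) →
      opt G k w (restrict G k Q S J e) ≤ x)
    (he : e → cap = N ∧ ∃ p p', S = twins G k Q p ∪ twins G k Q p' ∧ IsBalanced G k Q S)
    (hne : ¬ e → cap = 3 ∧ S = Finset.range N ∧
      ¬ ∃ p ∈ Q, ∃ p' ∈ Q, IsBalanced G k Q (twins G k Q p ∪ twins G k Q p')) :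
    opt G k w Q ≤ x := by
  rcases Nat.lt_or_ge 1 (verts k Q).card with hcard | hcard
  swap
  · exact opt_of_subsingleton_verts hcard hx
  obtain ⟨I, hIQ, hI, hIopt⟩ := exists_eq_opt G k w Q
  by_cases h : e
  · have he' : e = True := propext ⟨fun _ => trivial, fun _ => h⟩
    subst he'
    obtain ⟨rfl, p, p', hS, hbal⟩ := he h
    have hSQ : ∀ x ∈ S, ∀ y ∈ Q, x / k = y / k → y ∈ S := by
      intro x hx y hy hxy
      rw [hS, Finset.mem_union] at hx ⊢
      exact hx.imp (fun h => mem_twins_of_div_eq h hy hxy) fun h => mem_twins_of_div_eq h hy hxy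
    obtain ⟨h1, h2⟩ := restrict_balanced hcard hSQ hbal hIQ hI
    rw [← hIopt]
    refine (le_opt hI h1).trans (hle (I ∩ S) ?_ fun r hr =>
      ⟨fun _ => h2 r hr, fun h => absurd trivial h⟩)
    refine mem_guesses_zero_empty Finset.inter_subset_right (Finset.inter_subset_left.trans
      (hIQ.trans hQN)) fun c => ?_
    have := Finset.card_le_card (((Finset.filter_subset (· % k = c) (I ∩ S)).trans
      Finset.inter_subset_left).trans (hIQ.trans hQN))
    rwa [Finset.card_range] at this
  · have he' : e = False := propext ⟨h, False.elim⟩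
    subst he'
    obtain ⟨rfl, rfl, hno⟩ := hne h
    obtain ⟨J, hJ1, hJ2, hJ3⟩ := exists_guess hG hk hQc hcard hno hIQ hI
    obtain ⟨h1, h2⟩ := hJ3 (Finset.range N)
    rw [← hIopt]
    have hJN : J ⊆ Finset.range N := fun j hj => Finset.mem_range.2 (hN j (hJ1 j hj))
    exact (le_opt hI h1).trans (hle J (mem_guesses_zero_empty hJN hJN hJ2) fun r hr =>
      ⟨False.elim, fun _ => h2 r hr⟩)

/-- One level of the recursion: if small subsets are solved within `Y₁`, and dominated ones within
`Y₂` operations per vertex, and there are at most `X₁` guesses on two twin classes, and at most `X₂`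
guesses of three pairs per color, then `Q` is solved. -/
theorem solves_of_solvesAccepted (hG : EndsDominate G) (hk : 0 < k) {Q : Finset ℕ} {Y₁ Y₂ X₁ X₂ : ℕ}
    (hQ0 : Q.Nonempty) (hQc : CutConnected (Conflict G k) (Q : Set ℕ)) (hQN : Q ⊆ Finset.range N)
    (hN : ∀ p, p / k ∈ verts k Q → p < N)
    (hY₁ : SolvesAccepted G k n N w Q Q (verts k Q).card True Y₁)
    (hY₂ : SolvesAccepted G k n N w Q Q (verts k Q).card False Y₂)
    (hX₁ : ∀ p p', (guesses k N (twins G k Q p ∪ twins G k Q p') N 0 ∅).card ≤ X₁)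
    (hX₂ : (guesses k N (Finset.range N) 3 0 ∅).card ≤ X₂) :
    Solves G k n N w Q (3000 * (N + 1) ^ 6 +
      (X₁ * (2000 * (N + 1) ^ 4 + (verts k Q).card * Y₁ + 100 * (N + 1)) +
        X₂ * (2000 * (N + 1) ^ 4 + (verts k Q).card * Y₂ + 100 * (N + 1)))) := by
  intro s q b ht hQ hqb
  have hN0 : 0 < N := by
    obtain ⟨p, hp⟩ := hQ0
    have := Finset.mem_range.1 (hQN hp)
    omega
  have hM1 : 1 ≤ (N + 1) ^ 4 := Nat.one_le_pow _ _ (by omega)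
  have hM14 : N + 1 ≤ (N + 1) ^ 4 := Nat.le_self_pow (by decide) _
  have hM46 : (N + 1) ^ 4 ≤ (N + 1) ^ 6 := Nat.pow_le_pow_right (by omega) (by omega)
  rw [solveBody, runs_seq, runs_putRat]
  simp only [NExp.eval, QExp.eval, State.enter_var, List.getD_cons_succ, List.getD_cons_zero]
  rw [runs_seq]
  refine runs_for (N := N) (T := 40) (fun i s' => Frame (cells ∅ b) (cells {1} b) s s' ∧
    s'.var 0 = N ∧ s'.var 1 = q ∧ s'.var 2 = b ∧ s'.var 4 = 0 ∧ s'.var 5 = i ∧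
    (∀ p ∈ Q, p < i → w p ≤ s'.rat 1 b) ∧ s'.rat 1 b ≤ opt G k w Q) ?_ ?_ ?_ ?_
  · refine ⟨(Frame.refl _ _ s).setRat (by simp [cells]) _, ?_⟩
    simp
  · intro i s' h
    exact ⟨h.2.2.2.2.2.1, h.2.1⟩
  · rintro i s' hi ⟨f', v0, v1, v2, v4, v5, hle, hopt⟩
    have hw : s'.rat 0 i = w i := (ht.cells f' (by decide) (by decide)).weight i hi
    have hpos := (hQ.frame f' (.inl (by decide))).pos_iff hi
    simp only [runs_ifPos, runs_ite, runs_putRat, runs_skip, cell, NExp.eval, QExp.eval, Test.eval,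
      v1, v2, v5, hpos, hw]
    refine ⟨fun hiQ => ⟨fun hlt => ?_, fun hlt => ?_⟩, fun hiQ => ?_⟩
    · refine ⟨by simp, by simpa using v5, (f'.setRat (by simp [cells]) _).setVar _ _, ?_⟩
      simp [v0, v1, v2, v4]
      refine ⟨fun p hp hpi => ?_, weight_le_opt hiQ⟩
      rcases Nat.lt_or_eq_of_le hpi with h | rfl
      · exact (hle p hp h).trans hlt.le
      · exact le_rfl
    · refine ⟨by simp, trivial, f'.setVar _ _, ?_⟩
      simp [v0, v1, v2, v4]
      refine ⟨fun p hp hpi => ?_, hopt⟩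
      rcases Nat.lt_or_eq_of_le hpi with h | rfl
      · exact hle p hp h
      · exact not_lt.1 hlt
    · refine ⟨by simp, trivial, f'.setVar _ _, ?_⟩
      simp [v0, v1, v2, v4]
      refine ⟨fun p hp hpi => ?_, hopt⟩
      rcases Nat.lt_or_eq_of_le hpi with h | rfl
      · exact hle p hp h
      · exact absurd hp hiQ
  rintro t₁ s₁ ht₁ ⟨f₁, v0, v1, v2, v4, -, hw₁, hopt₁⟩
  rw [runs_seq]
  refine runs_count (b := q) (N := N) (Q := Q) v0 v1 (ht.cells f₁ (by decide) (by decide)) hQN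
    (hQ.frame f₁ (.inl (by decide))) fun t₂ ht₂ => ?_
  rw [runs_seq]
  set h := (verts k Q).card with hh
  -- the search for a balanced pair of twin classes
  refine runs_for (N := N) (T := 1200 * (N + 1) ^ 5) (fun i s' =>
    Frame (cells {2, 5, 6} b) (cells ∅ b) s₁ s' ∧ s'.var 0 = N ∧ s'.var 1 = q ∧ s'.var 2 = b ∧
    s'.var 3 = h ∧ s'.var 5 = i ∧
    (0 < s'.var 4 → ∃ p p', IsBalanced G k Q (twins G k Q p ∪ twins G k Q p') ∧
      Holds 6 b N (twins G k Q p ∪ twins G k Q p') s') ∧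
    (¬ 0 < s'.var 4 → ∀ p ∈ Q, p < i → ∀ p' ∈ Q,
      ¬ IsBalanced G k Q (twins G k Q p ∪ twins G k Q p'))) ?_ ?_ ?_ ?_
  · refine ⟨Frame.refl _ _ s₁, ?_⟩
    simp [v0, v1, v2, v4]
  · intro i s' h
    exact ⟨h.2.2.2.2.2.1, h.2.1⟩
  · rintro i s' hi ⟨f', v0, v1, v2, v3, v5, hyes, hno⟩
    have hQs : ∀ s', Frame (cells {2, 5, 6} b) (cells ∅ b) s₁ s' → Holds 2 q N Q s' := fun s' f' =>
      Holds.frame (hQ.frame f₁ (.inl (by decide))) f' (.inr hqb)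
    have hpos := (hQs _ f').pos_iff hi
    rw [runs_ifPos]
    simp only [cell, NExp.eval, v1, v5, hpos]
    refine ⟨fun hiQ => ?_, fun hiQ => ?_⟩
    · refine runs_for (N := N) (T := 1100 * (N + 1) ^ 4) (fun j s' =>
        Frame (cells {2, 5, 6} b) (cells ∅ b) s₁ s' ∧ s'.var 0 = N ∧ s'.var 1 = q ∧ s'.var 2 = b ∧
        s'.var 3 = h ∧ s'.var 5 = i ∧ s'.var 6 = j ∧
        (0 < s'.var 4 → ∃ p p', IsBalanced G k Q (twins G k Q p ∪ twins G k Q p') ∧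
          Holds 6 b N (twins G k Q p ∪ twins G k Q p') s') ∧
        (¬ 0 < s'.var 4 → (∀ p ∈ Q, p < i → ∀ p' ∈ Q,
          ¬ IsBalanced G k Q (twins G k Q p ∪ twins G k Q p')) ∧ ∀ p' ∈ Q, p' < j →
          ¬ IsBalanced G k Q (twins G k Q i ∪ twins G k Q p'))) ?_ ?_ ?_ ?_
      · refine ⟨f'.setVar _ _, by simpa using v0, by simpa using v1, by simpa using v2,
          by simpa using v3, by simpa using v5, by simp, hyes, fun h => ⟨hno h, by simp⟩⟩
      · intro j s' h
        exact ⟨h.2.2.2.2.2.2.1, h.2.1⟩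
      · rintro j s' hj ⟨f', v0, v1, v2, v3, v5, v6, hyes, hno⟩
        have hpos := (hQs _ f').pos_iff hj
        rw [runs_ifPos]
        simp only [NExp.eval, v1, v6, hpos]
        refine ⟨fun hjQ => ?_, fun hjQ => ?_⟩
        · simp only [runs_ifPos, runs_skip, NExp.eval]
          refine ⟨fun he => ⟨by simp; omega, v6, f'.setVar _ _, by simpa using v0, by simpa using v1,
            by simpa using v2, by simpa using v3, by simpa using v5, by simp, hyes,
            fun h => absurd he h⟩, fun he => ?_⟩
          refine runs_separates (q := q) (b := b) (h := h) (p := i) (p' := j) v0 v1 v2 v3 v5 v6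
            ((ht.cells f₁ (by decide) (by decide)).cells f' (by decide) (by decide)) hi hj hQN
            (hQs _ f') hqb hh ?_
          intro t₃ ht₃ s₃ hv₃ f₃ h6 v hv
          simp only [NExp.cost] at ht₃
          refine ⟨by simp; omega, by simpa [hv₃] using v6, f'.trans f₃,
            by simpa [hv₃] using v0, by simpa [hv₃] using v1, by simpa [hv₃] using v2,
            by simpa [hv₃] using v3, by simpa [hv₃] using v5, by simp, fun hv' => ⟨i, j, ?_, h6⟩,
            fun hv' => ⟨(hno he).1, fun p' hp' hpj => ?_⟩⟩
          · simpa [hv] using hv'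
          · rcases Nat.lt_succ_iff_lt_or_eq.1 hpj with h | rfl
            · exact (hno he).2 p' hp' h
            · rw [← hv]
              simpa using hv'
        · rw [runs_skip]
          refine ⟨by simp; omega, v6, f'.setVar _ _, by simpa using v0, by simpa using v1,
            by simpa using v2, by simpa using v3, by simpa using v5, by simp, hyes,
            fun h => ⟨(hno h).1, fun p' hp' hpj => ?_⟩⟩
          rcases Nat.lt_succ_iff_lt_or_eq.1 hpj with h' | rfl
          · exact (hno h).2 p' hp' h'
          · exact absurd hp' hjQ
      · rintro t s' ht ⟨f', v0, v1, v2, v3, v5, v6, hyes, hno⟩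
        have e5 : (N + 1) ^ 5 = (N + 1) * (N + 1) ^ 4 := by ring
        refine ⟨by simp at ht ⊢; nlinarith, v5, f'.setVar _ _, by simpa using v0, by simpa using v1,
          by simpa using v2, by simpa using v3, by simp, hyes, fun h p hp hpi => ?_⟩
        rcases Nat.lt_succ_iff_lt_or_eq.1 hpi with h' | rfl
        · exact (hno h).1 p hp h'
        · exact fun p' hp' => (hno h).2 p' hp' (Finset.mem_range.1 (hQN hp'))
    · rw [runs_skip]
      have hM45 : (N + 1) ^ 4 ≤ (N + 1) ^ 5 := Nat.pow_le_pow_right (by omega) (by omega)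
      refine ⟨by simp; omega, v5, f'.setVar _ _, by simpa using v0, by simpa using v1,
        by simpa using v2, by simpa using v3, by simp, hyes, fun h p hp hpi => ?_⟩
      rcases Nat.lt_succ_iff_lt_or_eq.1 hpi with h' | rfl
      · exact hno h p hp h'
      · exact absurd hp hiQ
  rintro t₃ s₃ ht₃ ⟨f₃, v0, v1, v2, v3, -, hyes, hno⟩
  have f₃' : Frame (cells {2, 5, 6, 7, 8} b) (cells {1, 2} b) s s₃ :=
    (f₁.mono (by simp [cells])
      (by simp only [cells, Finset.mem_insert, Finset.mem_singleton]; omega)).trans (f₃.mono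
      (by simp only [cells, Finset.mem_insert, Finset.mem_singleton]; omega) (by simp [cells]))
  have hr₃ : s₃.rat 1 b = s₁.rat 1 b := f₃.2 _ _ (by simp [cells])
  -- enumeration of the guesses, for either kind of guess
  have hrest : ∀ (s₄ : State) (S : Finset ℕ) (e cap X Y c : ℕ),
      Frame (cells {2, 5, 6, 7, 8} b) (cells {1, 2} b) s s₄ → s₄.rat 1 b = s₁.rat 1 b →
      Holds 6 b N S s₄ → s₄.var 0 = N → s₄.var 1 = q → s₄.var 2 = b → s₄.var 3 = h →
      s₄.var 4 = e → s₄.var 8 = cap →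
      (0 < e → cap = N ∧ ∃ p p', S = twins G k Q p ∪ twins G k Q p' ∧ IsBalanced G k Q S) →
      (¬ 0 < e → cap = 3 ∧ S = Finset.range N ∧
        ¬ ∃ p ∈ Q, ∃ p' ∈ Q, IsBalanced G k Q (twins G k Q p ∪ twins G k Q p')) →
      SolvesAccepted G k n N w Q Q h (0 < e) Y → (guesses k N S cap 0 ∅).card ≤ X →
      c ≤ 2000 * (N + 1) ^ 6 →
      Runs solver (.seq (forLoop 5 (.var 0)
          (.seq (.put 7 (.add (.var 2) (.var 5)) (.const 0))
            (.put 8 (.add (.var 2) (.var 5)) (.const 0))))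
        (.call 7 6 [.var 0, .var 1, .var 2, .var 3, .var 4, .var 8, .const 0])) s₄ fun t s' =>
        c + t ≤ 3000 * (N + 1) ^ 6 + X * (2000 * (N + 1) ^ 4 + h * Y + 100 * (N + 1)) ∧
        Frame (cells {2, 5, 6, 7, 8} b) (cells {1, 2} b) s s' ∧ s'.rat 1 b = opt G k w Q := by
    intro s₄ S e cap X Y c f₄ hr₄ hS v0 v1 v2 v3 v4 v8 he hne hY hX hc
    rw [runs_seq]
    refine runs_for (N := N) (T := 20) (fun i s' =>
      Frame (cells {2, 5, 6, 7, 8} b) (cells {1, 2} b) s s' ∧ s'.rat 1 b = s₁.rat 1 b ∧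
      Holds 6 b N S s' ∧ s'.var 0 = N ∧ s'.var 1 = q ∧ s'.var 2 = b ∧ s'.var 3 = h ∧
      s'.var 4 = e ∧ s'.var 8 = cap ∧ s'.var 5 = i ∧ (∀ j < i, s'.nat 7 (b + j) = 0) ∧
      ∀ j < i, s'.nat 8 (b + j) = 0) ?_ ?_ ?_ ?_
    · refine ⟨f₄.setVar _ _, hr₄, hS, ?_⟩
      simp [v0, v1, v2, v3, v4, v8]
    · intro i s' h
      exact ⟨h.2.2.2.2.2.2.2.2.2.1, h.2.2.2.1⟩
    · rintro i s' hi ⟨f', hr', hS', v0, v1, v2, v3, v4, v8, v5, z7, z8⟩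
      simp only [runs_seq, runs_put, NExp.eval, v2, v5, State.setNat_var]
      refine ⟨by simp, trivial, ((f'.setNat (by simp [cells]) _).setNat (by simp [cells]) _).setVar
        _ _, hr', ((hS'.setNat_of_ne (a' := 7) (by decide) _ _).setNat_of_ne (a' := 8)
          (by decide) _ _).setVar _ _, ?_⟩
      simp [v0, v1, v2, v3, v4, v8]
      grind
    rintro t₅ s₅ ht₅ ⟨f₅, hr₅, hS₅, v0, v1, v2, v3, v4, v8, -, z7, z8⟩
    refine runs_call (body := guessBody) rfl ?_
    simp only [List.map_cons, List.map_nil, NExp.eval, v0, v1, v2, v3, v4, v8, List.sum_cons,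
      List.sum_nil, add_zero]
    refine (runs_guess (n := n) (w := w) hN0 hQN hqb hY N s₅ 0 ∅ (by omega)
      (ht.cells f₅ (by decide) (by decide)) (hQ.frame f₅ (.inr hqb)) hS₅
      (fun i hi => by simp [z7 i hi])
      (by simp) (by simp) (fun i hi => by simp [z8 i hi]) (by simp)).mono ?_
    rintro t₆ s₆ ⟨ht₆, h₆⟩
    have hw₅ : ∀ p ∈ Q, w p ≤ s₅.rat 1 b := fun p hp => by
      rw [hr₅]
      exact hw₁ p hp (Finset.mem_range.1 (hQN hp))
    refine ⟨?_, f₅.trans h₆.frame, le_antisymm (h₆.le_opt (by rw [hr₅]; exact hopt₁)) ?_⟩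
    · have := Nat.mul_le_mul_right (2000 * (N + 1) ^ 4 + h * Y + 100 * (N + 1)) hX
      simp at ht₅ ⊢
      rw [hh] at *
      omega
    · exact opt_le_of_guesses hG hk hQc hQN hN (fun p hp => (hw₅ p hp).trans h₆.mono) h₆.le he hne
  have e6 : (N + 1) ^ 6 = (N + 1) * (N + 1) ^ 5 := by ring
  have hM45 : (N + 1) ^ 4 ≤ (N + 1) ^ 5 := Nat.pow_le_pow_right (by omega) (by omega)
  have ht₃' : t₃ ≤ 1207 * (N + 1) ^ 6 := by
    simp at ht₃
    nlinarith
  rw [runs_seq, runs_ifPos]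
  refine ⟨fun he => ?_, fun he => ?_⟩
  · rw [runs_set]
    obtain ⟨p, p', hbal, h6⟩ := hyes he
    have := hrest (s₃.setVar 8 N) _ (s₃.var 4) N X₁ Y₁ (1 + 1 + 1 + t₁ + t₂ + t₃ + 20) f₃' hr₃ h6
      (by simpa using v0) (by simpa using v1) (by simpa using v2) (by simpa using v3)
      (by simp) (by simp) (fun _ => ⟨rfl, p, p', rfl, hbal⟩) (fun h => absurd he h)
      (by rwa [show (0 < s₃.var 4) = True from propext ⟨fun _ => trivial, fun _ => he⟩]) (hX₁ p p')
      (by simp at ht₁ ht₂; omega)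
    simp only [NExp.eval, v0]
    refine this.mono fun t s' hs' => ⟨?_, hs'.2⟩
    have := hs'.1
    simp at ht₁ ht₂ ⊢
    omega
  · simp only [runs_seq, runs_set, NExp.eval]
    refine runs_for (N := N) (T := 20) (fun i s' =>
      Frame (cells {2, 5, 6, 7, 8} b) (cells {1, 2} b) s s' ∧ s'.rat 1 b = s₁.rat 1 b ∧
      s'.var 0 = N ∧ s'.var 1 = q ∧ s'.var 2 = b ∧ s'.var 3 = h ∧
      s'.var 4 = s₃.var 4 ∧ s'.var 8 = 3 ∧ s'.var 5 = i ∧ ∀ j < i, s'.nat 6 (b + j) = 1) ?_ ?_ ?_ ?_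
    · refine ⟨f₃', hr₃, ?_⟩
      simp [v0, v1, v2, v3]
    · intro i s' h
      exact ⟨h.2.2.2.2.2.2.2.2.1, h.2.2.1⟩
    · rintro i s' hi ⟨f', hr', v0, v1, v2, v3, v4, v8, v5, z6⟩
      simp only [runs_put, NExp.eval, v2, v5]
      refine ⟨by simp, by simpa using v5, (f'.setNat (by simp [cells]) _).setVar _ _, hr', ?_⟩
      simp [v0, v1, v2, v3, v4, v8]
      grind
    rintro t₄ s₄ ht₄ ⟨f₄, hr₄, v0, v1, v2, v3, v4, v8, -, z6⟩
    have := hrest s₄ (Finset.range N) (s₃.var 4) 3 X₂ Y₂ (1 + 1 + 1 + t₁ + t₂ + t₃ + t₄ + 20) f₄ hr₄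
      (fun i hi => by simp [z6 i hi, hi]) v0 v1 v2 v3 v4 v8 (fun h => absurd h he)
      (fun _ => ⟨rfl, rfl, ?_⟩)
      (by rwa [show (0 < s₃.var 4) = False from propext ⟨he, False.elim⟩]) hX₂
      (by simp at ht₁ ht₂ ht₄; omega)
    · rw [runs_seq] at this
      refine this.mono fun t s' hs' => hs'.mono fun t' s'' hs'' => ⟨?_, hs''.2⟩
      have := hs''.1
      simp at ht₁ ht₂ ht₄ ⊢
      omega
    · rintro ⟨p, hp, p', hp', hbal⟩
      exact hno he p hp (Finset.mem_range.1 (hQN hp)) p' hp' hbal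

end RAM

end Solve

section Counting

/-! ### The number of guesses and the recursion -/

variable {G : SimpleGraph ℕ} {k n N : ℕ} {w : ℕ → ℚ≥0}

theorem CliqueLE.mono {D D' : Finset ℕ} {c : ℕ} (h : CliqueLE G D c) (hD : D' ⊆ D) :
    CliqueLE G D' c := fun K hK => h K (hK.trans hD)

theorem CliqueLE.pos {D : Finset ℕ} {c : ℕ} (h : CliqueLE G D c) (hD : D.Nonempty) : 0 < c := by
  obtain ⟨v, hv⟩ := hD
  have := h {v} (by simpa using hv) (by simp)
  rw [Finset.card_singleton] at this
  omega

theorem card_le_mul_card_verts (hk : 0 < k) (Q : Finset ℕ) : Q.card ≤ k * (verts k Q).card := by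
  refine Finset.card_le_mul_card_image Q k fun v _ => ?_
  have : Q.filter (fun p => p / k = v) ⊆ (Finset.range k).image (v * k + ·) := by
    intro p hp
    obtain ⟨-, rfl⟩ := Finset.mem_filter.1 hp
    exact Finset.mem_image.2 ⟨p % k, Finset.mem_range.2 (Nat.mod_lt _ hk), Nat.div_add_mod' p k⟩
  exact (Finset.card_le_card this).trans (Finset.card_image_le.trans (by simp))

/-- The vertices of a twin class form a clique. -/
theorem card_twins_le (hk : 0 < k) {Q : Finset ℕ} {c : ℕ} (h : CliqueLE G (verts k Q) c) (p : ℕ) :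
    (twins G k Q p).card ≤ k * c := by
  refine (card_le_mul_card_verts hk _).trans (Nat.mul_le_mul_left _ (h _ ?_ ?_))
  · exact Finset.image_subset_image fun r hr => (RAM.mem_twins.1 hr).1
  · intro u hu v hv huv
    obtain ⟨r, hr, rfl⟩ := Finset.mem_image.1 hu
    obtain ⟨r', hr', rfl⟩ := Finset.mem_image.1 hv
    rw [RAM.mem_twins] at hr hr'
    have := (hr.2 r' hr'.1).1 ((hr'.2 r' hr'.1).2 (.inl rfl))
    exact this.resolve_left huv

namespace RAM

theorem card_guesses_le (S : Finset ℕ) (cap pos : ℕ) (J : Finset ℕ) :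
    (guesses k N S cap pos J).card ≤ 2 ^ S.card := by
  classical
  refine (Finset.card_filter_le _ _).trans ?_
  rw [Finset.card_powerset]
  exact Nat.pow_le_pow_right (by decide) (Finset.card_le_card Finset.inter_subset_left)

theorem card_powerset_filter_card_le_three (n : ℕ) :
    ((Finset.range n).powerset.filter fun A => A.card ≤ 3).card ≤ (n + 1) ^ 3 := by
  have hsub : ((Finset.range n).powerset.filter fun A => A.card ≤ 3) ⊆
      (Finset.range 4).biUnion fun i => Finset.powersetCard i (Finset.range n) := by
    intro A hA
    rw [Finset.mem_filter, Finset.mem_powerset] at hA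
    exact Finset.mem_biUnion.2 ⟨A.card, Finset.mem_range.2 (by omega),
      Finset.mem_powersetCard.2 ⟨hA.1, rfl⟩⟩
  refine (Finset.card_le_card hsub).trans (Finset.card_biUnion_le.trans ?_)
  simp only [Finset.card_powersetCard, Finset.card_range, Finset.sum_range_succ,
    Finset.sum_range_zero]
  have h2 := Nat.choose_le_pow n 2
  have h3 := Nat.choose_le_pow n 3
  simp only [Nat.choose_zero_right, Nat.choose_one_right]
  nlinarith

theorem card_guesses_three_le (hk : 0 < k) :
    (guesses k (n * k) (Finset.range (n * k)) 3 0 ∅).card ≤ (n + 1) ^ (3 * k) := by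
  classical
  set T := (Finset.range n).powerset.filter fun A => A.card ≤ 3 with hT
  have hle : (guesses k (n * k) (Finset.range (n * k)) 3 0 ∅).card ≤
      (Fintype.piFinset fun _ : Fin k => T).card := by
    refine Finset.card_le_card_of_injOn
      (fun J c => (J.filter (· % k = c)).image (· / k)) ?_ ?_
    · intro J hJ
      obtain ⟨h1, -, h3⟩ := mem_guesses.1 hJ
      rw [Finset.mem_coe, Fintype.mem_piFinset]
      refine fun c => Finset.mem_filter.2 ⟨Finset.mem_powerset.2 fun v hv => ?_,
        Finset.card_image_le.trans (h3 c)⟩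
      obtain ⟨p, hp, rfl⟩ := Finset.mem_image.1 hv
      have := Finset.mem_range.1 (Finset.mem_inter.1 (h1 (Finset.mem_filter.1 hp).1)).1
      exact Finset.mem_range.2 ((Nat.div_lt_iff_lt_mul hk).2 this)
    · have key : ∀ J : Finset ℕ, ∀ p, p ∈ J ↔ p / k ∈ (J.filter (· % k = p % k)).image (· / k) := by
        intro J p
        rw [Finset.mem_image]
        refine ⟨fun h => ⟨p, Finset.mem_filter.2 ⟨h, rfl⟩, rfl⟩, fun ⟨q, hq, h⟩ => ?_⟩
        obtain ⟨hq, h'⟩ := Finset.mem_filter.1 hq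
        rwa [← Nat.div_add_mod p k, ← h, ← h', Nat.div_add_mod q k]
      intro J _ J' _ h
      ext p
      rw [key J, key J']
      have := congrFun h ⟨p % k, Nat.mod_lt _ hk⟩
      simp only at this
      rw [this]
  refine hle.trans ?_
  rw [Fintype.card_piFinset, Finset.prod_const, Finset.card_univ, Fintype.card_fin, pow_mul]
  exact Nat.pow_le_pow_left (card_powerset_filter_card_le_three n) k

/-- The time bound for the recursion, where `2 ^ L` bounds the number of vertices and `c` the clique
number. Halving the number of vertices saves a factor `8 * 2 ^ (2 k ω)` (eight times the number of
guesses on two twin classes), and passing to a set dominated by a vertex saves a factor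
`8 * (n + 1) ^ (3 k)` (eight times the number of guesses of three vertices per color). -/
theorem solves_of_cliqueLE (hG : EndsDominate G) (hk : 0 < k) {ω : ℕ} (m : ℕ) :
    ∀ (Q : Finset ℕ) (L c : ℕ), (verts k Q).card = m → m < 2 ^ L → CliqueLE G (verts k Q) c → c ≤ ω →
      Q.Nonempty → CutConnected (Conflict G k) (Q : Set ℕ) → Q ⊆ Finset.range (n * k) →
      Solves G k n (n * k) w Q ((verts k Q).card *
        (6000 * (n * k + 1) ^ 6 * (8 * 2 ^ (2 * k * ω)) ^ L * (8 * (n + 1) ^ (3 * k)) ^ c)) := by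
  induction m using Nat.strong_induction_on with
  | _ m ih =>
  intro Q L c hm hL hc hcω hQ0 hQc hQN
  set M := n * k + 1 with hM
  set X₁ := 2 ^ (2 * k * ω) with hX₁
  set X₂ := (n + 1) ^ (3 * k) with hX₂
  have hv0 : (verts k Q).Nonempty := hQ0.image _
  have hm0 : 0 < (verts k Q).card := hv0.card_pos
  have hc0 := hc.pos hv0
  obtain ⟨c, rfl⟩ : ∃ c', c = c' + 1 := ⟨c - 1, by omega⟩
  obtain ⟨L, rfl⟩ : ∃ L', L = L' + 1 := by
    rcases L with _ | L
    · rw [pow_zero] at hL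
      omega
    · exact ⟨L, rfl⟩
  have hN : ∀ p, p / k ∈ verts k Q → p < n * k := by
    intro p hp
    obtain ⟨q, hq, hqp⟩ := Finset.mem_image.1 hp
    have h1 := (Nat.div_lt_iff_lt_mul hk).2 (Finset.mem_range.1 (hQN hq))
    exact (Nat.div_lt_iff_lt_mul hk).1 (hqp ▸ h1)
  set Y₁ := 6000 * M ^ 6 * (8 * X₁) ^ L * (8 * X₂) ^ (c + 1) with hY₁
  set Y₂ := 6000 * M ^ 6 * (8 * X₁) ^ (L + 1) * (8 * X₂) ^ c with hY₂
  have key := solves_of_solvesAccepted (w := w) (n := n) (N := n * k) (Y₁ := Y₁) (Y₂ := Y₂)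
    (X₁ := X₁) (X₂ := X₂) hG hk hQ0 hQc hQN hN ?_ ?_ (fun p p' => ?_) (card_guesses_three_le hk)
  · intro s q b ht hQ hqb
    refine (key s q b ht hQ hqb).mono fun t s' h => ⟨h.1.trans ?_, h.2⟩
    have hX₁0 : 1 ≤ X₁ := Nat.one_le_two_pow
    have hX₂0 : 1 ≤ X₂ := Nat.one_le_pow _ _ (by omega)
    have hpow : 1 ≤ (8 * X₁) ^ L * (8 * X₂) ^ c :=
      Nat.one_le_iff_ne_zero.2 (by positivity)
    set m' := (verts k Q).card with hm'
    set W := (8 * X₁) ^ L * (8 * X₂) ^ c with hW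
    have e1 : Y₁ = 6000 * M ^ 6 * W * (8 * X₂) := by rw [hY₁, hW]; ring
    have e2 : Y₂ = 6000 * M ^ 6 * W * (8 * X₁) := by rw [hY₂, hW]; ring
    have e3 : 6000 * M ^ 6 * (8 * X₁) ^ (L + 1) * (8 * X₂) ^ (c + 1) =
        6000 * M ^ 6 * W * (8 * X₁) * (8 * X₂) := by rw [hW]; ring
    rw [e1, e2, e3]
    have hM1 : 1 ≤ M := by omega
    have hM46 : M ^ 4 ≤ M ^ 6 := Nat.pow_le_pow_right hM1 (by decide)
    have hM16 : M ≤ M ^ 6 := Nat.le_self_pow (by decide) _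
    set U := m' * (M ^ 6 * W) with hU
    have hU1 : M ^ 6 ≤ U := by
      calc M ^ 6 = 1 * (M ^ 6 * 1) := by ring
        _ ≤ m' * (M ^ 6 * W) := by gcongr; exact hm0
    have hx : X₁ ≤ X₁ * X₂ := Nat.le_mul_of_pos_right _ hX₂0
    have hx' : X₂ ≤ X₁ * X₂ := Nat.le_mul_of_pos_left _ hX₁0
    calc 3000 * M ^ 6 + (X₁ * (2000 * M ^ 4 + m' * (6000 * M ^ 6 * W * (8 * X₂)) + 100 * M) +
          X₂ * (2000 * M ^ 4 + m' * (6000 * M ^ 6 * W * (8 * X₁)) + 100 * M))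
        ≤ 3000 * U + (X₁ * (2000 * U + 100 * U) + X₂ * (2000 * U + 100 * U)) +
          96000 * (U * (X₁ * X₂)) := by
          have h4 : M ^ 4 ≤ U := hM46.trans hU1
          have h1 : M ≤ U := hM16.trans hU1
          have h5 : X₁ * (2000 * M ^ 4 + 100 * M) ≤ X₁ * (2000 * U + 100 * U) := by gcongr
          have h6 : X₂ * (2000 * M ^ 4 + 100 * M) ≤ X₂ * (2000 * U + 100 * U) := by gcongr
          have h7 : X₁ * (m' * (6000 * M ^ 6 * W * (8 * X₂))) = 48000 * (U * (X₁ * X₂)) := by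
            rw [hU]; ring
          have h8 : X₂ * (m' * (6000 * M ^ 6 * W * (8 * X₁))) = 48000 * (U * (X₁ * X₂)) := by
            rw [hU]; ring
          linarith
      _ ≤ 384000 * (U * (X₁ * X₂)) := by
          have h1 : U ≤ U * (X₁ * X₂) := Nat.le_mul_of_pos_right _ (by positivity)
          have h2 : U * X₁ ≤ U * (X₁ * X₂) := Nat.mul_le_mul_left _ hx
          have h3 : U * X₂ ≤ U * (X₁ * X₂) := Nat.mul_le_mul_left _ hx'
          linarith
      _ = m' * (6000 * M ^ 6 * W * (8 * X₁) * (8 * X₂)) := by rw [hU]; ring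
  · intro C hCQ hC0 hCc hacc
    have h2 := hacc.1 trivial
    have hC1 : 0 < (verts k C).card := (hC0.image _).card_pos
    exact ih _ (by omega) C L (c + 1) rfl (by rw [pow_succ] at hL; omega)
      (hc.mono (Finset.image_subset_image hCQ)) hcω hC0 hCc (hCQ.trans hQN)
  · -- together with `x`, a clique in `C` is a larger clique in `Q`
    intro C hCQ hC0 hCc hacc
    obtain ⟨x, hxQ, hx⟩ := hacc.2 not_false
    have hxC : x / k ∉ verts k C := by
      intro h
      obtain ⟨p, hp, hpx⟩ := Finset.mem_image.1 h
      exact (hx p hp).ne hpx.symm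
    have hxv : x / k ∈ verts k Q := Finset.mem_image_of_mem _ hxQ
    have hsub : verts k C ⊆ verts k Q := Finset.image_subset_image hCQ
    have hlt := Finset.card_lt_card ((Finset.ssubset_iff_of_subset hsub).2 ⟨_, hxv, hxC⟩)
    refine ih _ (by omega) C (L + 1) c rfl (by omega) ?_ (by omega) hC0 hCc (hCQ.trans hQN)
    intro K hK hKc
    have hxK : x / k ∉ K := fun h => hxC (hK h)
    have := hc (insert (x / k) K) (Finset.insert_subset hxv (hK.trans hsub)) ?_
    · rw [Finset.card_insert_of_notMem hxK] at this
      omega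
    · rw [Finset.coe_insert]
      refine hKc.insert fun v hv _ => ?_
      obtain ⟨p, hp, rfl⟩ := Finset.mem_image.1 (hK hv)
      exact hx p hp
  · refine (card_guesses_le _ _ _ _).trans (Nat.pow_le_pow_right (by decide) ?_)
    refine (Finset.card_union_le _ _).trans ?_
    have h1 := card_twins_le hk hc p
    have h2 := card_twins_le hk hc p'
    have h3 := Nat.mul_le_mul_left k hcω
    rw [mul_assoc]
    omega

end RAM

end Counting

section Main

/-! ### The main program -/

namespace RAM

variable {G : SimpleGraph ℕ} {k n N : ℕ} {w : ℕ → ℚ≥0} {s : State}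

theorem runs_value {Q : Finset ℕ} {Y : ℕ} (ht : Tables G k n N w s) (hQN : Q ⊆ Finset.range N)
    (hQ : Holds 2 0 N Q s) (hY : SolvesAccepted G k n N w Q Q (N + N) True Y) :
    Runs solver valueBody (s.enter [N]) fun t s' => t ≤ 1100 * (N + 1) ^ 4 + (verts k Q).card * Y ∧
      Frame (cells {2, 5, 6, 7, 8} N) (cells {1, 2} N) s s' ∧ s'.rat 2 N = opt G k w Q := by
  rw [valueBody, runs_seq]
  refine runs_for (N := N) (T := 20) (fun i s' => Frame (cells {5} N) (cells ∅ N) s s' ∧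
    s'.var 0 = N ∧ s'.var 1 = i ∧ ∀ j < i, s'.nat 5 (N + j) = if j ∈ Q then 1 else 0) ?_ ?_ ?_ ?_
  · refine ⟨Frame.refl _ _ s, ?_⟩
    simp
  · intro i s' h
    exact ⟨h.2.2.1, h.2.1⟩
  · rintro i s' hi ⟨f', v0, v1, h5⟩
    have hv : s'.nat 2 i = if i ∈ Q then 1 else 0 := by
      simpa using (hQ.frame f' (.inl (by decide))) i hi
    simp only [runs_put, NExp.eval, v0, v1, hv]
    refine ⟨by simp, by simpa using v1, (f'.setNat (by simp [cells]) _).setVar _ _, ?_⟩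
    simp [v0]
    intro j hj
    by_cases hji : j = i
    · simp [hji]
    · simpa [hji] using h5 j (by omega)
  rintro t₁ s₁ ht₁ ⟨f₁, v0, -, h5⟩
  refine runs_call (body := totalBody) rfl ?_
  simp only [List.map_cons, List.map_nil, NExp.eval, v0, List.sum_cons, List.sum_nil, add_zero]
  refine (runs_total (Y := Y) (R := Q) (Q := Q) (ht.cells f₁ (by decide) (by decide)) hQN
    (hQ.frame f₁ (.inl (by decide))) (by omega) hQN h5 (by simpa using hY)).mono ?_
  rintro t₂ s₂ ⟨ht₂, f₂, -, hall⟩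
  refine ⟨?_, ?_, hall fun r _ => ⟨fun _ => ?_, fun h => absurd one_pos h⟩⟩
  · have : N + 1 ≤ (N + 1) ^ 4 := Nat.le_self_pow (by decide) _
    simp at ht₁ ⊢
    omega
  · refine Frame.trans (s' := s₁) (f₁.mono ?_ (by simp [cells])) (f₂.mono ?_ ?_) <;>
      simp only [cells, Finset.mem_insert, Finset.mem_singleton] <;> omega
  · have h1 := Finset.card_le_card ((comp_subset (G := G) (k := k) Q r).trans hQN)
    have h2 : (verts k (comp G k Q r)).card ≤ _ := Finset.card_image_le
    rw [Finset.card_range] at h1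
    omega

/-- Fills the tables and the array `2`; the variable `3` counts the pairs, and the variable `4` runs
through the multiples of `n`, which takes the place of multiplication. -/
def prepare (k : ℕ) : Stmt :=
  .seq (.set 3 (.const 0))
  (.seq (.set 4 (.const 0))
  (forLoop 1 (.var 0)
    (.seq (.put 11 (.var 1) (.var 4))
    (.seq (.set 4 (.add (.var 4) (.var 0)))
    (forLoop 2 (.const k)
      (.seq (.put 9 (.var 3) (.var 1))
      (.seq (.put 10 (.var 3) (.var 2))
      (.seq (.put 2 (.var 3) (.const 1))
      (.set 3 (.add (.var 3) (.const 1)))))))))))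

/-- Computes the optimum, and deletes one pair after the other from the set in array `2` unless
this makes the optimum smaller. -/
def shrink : Stmt :=
  .seq (.call 5 9 [.var 3])
  (.seq (.putRat 3 (.const 0) (.get 2 (.var 3)))
  (forLoop 6 (.var 3)
    (.seq (.put 2 (.var 6) (.const 0))
    (.seq (.call 5 9 [.var 3])
    (.ite (.ratLt (.get 2 (.var 3)) (.get 3 (.const 0))) (.put 2 (.var 6) (.const 1)) .skip)))))

/-- Writes the coloring given by the set in array `2` to array `1`. -/
def output : Stmt :=
  forLoop 6 (.var 3)
    (ifPos (.get 2 (.var 6)) (.put 1 (.get 9 (.var 6)) (.add (.get 10 (.var 6)) (.const 1))) .skip)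

/-- The program for `k` colors. -/
def partialColoringProgram (k : ℕ) : Program where
  procs := solver
  main := .seq (prepare k) (.seq shrink output)

theorem runs_prepare {P : ℕ → State → Prop} (hn : s.var 0 = n)
    (hP : ∀ t ≤ 200 * ((n + 1) * (k + 1)), ∀ s', Frame (cells {2, 9, 10, 11} 0) (cells ∅ 0) s s' →
      s'.var 3 = n * k → (∀ v < n, s'.nat 11 v = v * n) →
      (∀ p < n * k, s'.nat 9 p = p / k ∧ s'.nat 10 p = p % k ∧ s'.nat 2 p = 1) → P t s') :
    Runs solver (prepare k) s P := by
  simp only [prepare, runs_seq, runs_set, NExp.eval]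
  refine runs_for (N := n) (T := 40 * k + 60) (fun v s' =>
    Frame (cells {2, 9, 10, 11} 0) (cells ∅ 0) s s' ∧ s'.var 0 = n ∧ s'.var 1 = v ∧
    s'.var 3 = v * k ∧ s'.var 4 = v * n ∧ (∀ u < v, s'.nat 11 u = u * n) ∧
    ∀ p < v * k, s'.nat 9 p = p / k ∧ s'.nat 10 p = p % k ∧ s'.nat 2 p = 1) ?_ ?_ ?_ ?_
  · refine ⟨Frame.refl _ _ s, ?_⟩
    simp [hn]
  · intro v s' h
    exact ⟨h.2.2.1, h.2.1⟩
  · rintro v s' hv ⟨f', v0, v1, v3, v4, h11, hp⟩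
    rw [runs_seq, runs_put, runs_seq, runs_set]
    simp only [NExp.eval, v0, v1, v4, State.setNat_var]
    refine runs_for (N := k) (T := 30) (fun c s' =>
      Frame (cells {2, 9, 10, 11} 0) (cells ∅ 0) s s' ∧ s'.var 0 = n ∧ s'.var 1 = v ∧
      s'.var 2 = c ∧
      s'.var 3 = v * k + c ∧ s'.var 4 = (v + 1) * n ∧ (∀ u < v + 1, s'.nat 11 u = u * n) ∧
      ∀ p < v * k + c, s'.nat 9 p = p / k ∧ s'.nat 10 p = p % k ∧ s'.nat 2 p = 1) ?_ ?_ ?_ ?_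
    · refine ⟨f'.setNat (by simp [cells]) _, ?_⟩
      simp [v0, v1, v3, add_mul]
      refine ⟨fun u hu => ?_, hp⟩
      rcases Nat.lt_or_eq_of_le hu with h | rfl
      · simp [h.ne, h11 u h]
      · simp
    · intro c s' h
      exact ⟨h.2.2.2.1, rfl⟩
    · rintro c s' hc ⟨f', v0, v1, v2, v3, v4, h11, hp⟩
      simp only [runs_seq, runs_put, runs_set, NExp.eval, v1, v2, v3, State.setNat_var]
      refine ⟨by simp, by simpa using v2, ((f'.setNat (by simp [cells]) _).setNat
        (by simp [cells]) _).setNat (by simp [cells]) _, ?_⟩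
      simp [v0, v1, v4, add_assoc]
      refine ⟨fun u hu => h11 u (by omega), fun p hpc => ?_⟩
      by_cases hpe : p = v * k + c
      · subst hpe
        simp [mul_add_div_of_lt hc, mul_add_mod_of_lt hc]
      · simpa [hpe] using hp p (by omega)
    · rintro t s' ht ⟨f', v0, v1, v2, v3, v4, h11, hp⟩
      refine ⟨by simp at ht ⊢; omega, v1, f'.setVar _ _, ?_⟩
      have e : (v + 1) * k = v * k + k := by ring
      rw [e]
      simp [v0, v3, v4]
      exact ⟨fun u hu => h11 u (by omega), hp⟩
  · rintro t s' ht ⟨f', v0, v1, v3, v4, h11, hp⟩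
    refine hP _ ?_ s' f' v3 h11 hp
    simp at ht ⊢
    nlinarith

/-- At the end of `shrink`, the set in array `2` still has the optimum value, but would lose it
without any one of its elements: what cannot be deleted from a set cannot be deleted from a subset.
-/
theorem runs_shrink {P : ℕ → State → Prop} {V Y : ℕ} (ht : Tables G k n N w s) (hN : s.var 3 = N)
    (hs : ∀ p < N, s.nat 2 p = 1)
    (hY : ∀ Q ⊆ Finset.range N, SolvesAccepted G k n N w Q Q (N + N) True Y)
    (hV : (verts k (Finset.range N)).card ≤ V)
    (hP : ∀ t ≤ (N + 2) * (1100 * (N + 1) ^ 4 + V * Y + 50), ∀ s',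
      Frame (cells {2, 5, 6, 7, 8} 0) (cells {1, 2, 3} 0) s s' → s'.var 3 = N →
      (∃ Q ⊆ Finset.range N, Holds 2 0 N Q s' ∧ opt G k w Q = opt G k w (Finset.range N) ∧
        ∀ p ∈ Q, opt G k w (Q.erase p) < opt G k w (Finset.range N)) → P t s') :
    Runs solver shrink s P := by
  have hVQ : ∀ Q ⊆ Finset.range N, (verts k Q).card * Y ≤ V * Y := fun Q hQ =>
    Nat.mul_le_mul_right _ ((Finset.card_le_card (Finset.image_subset_image hQ)).trans hV)
  have hmono : ∀ {s' s'' : State}, Frame (cells {2, 5, 6, 7, 8} N) (cells {1, 2} N) s' s'' →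
      Frame (cells {2, 5, 6, 7, 8} 0) (cells {1, 2, 3} 0) s' s'' := fun hf => hf.mono
    (by simp only [cells, Finset.mem_insert, Finset.mem_singleton]; omega)
    (by simp only [cells, Finset.mem_insert, Finset.mem_singleton]; omega)
  rw [shrink, runs_seq]
  refine runs_call (body := valueBody) rfl ?_
  simp only [List.map_cons, List.map_nil, NExp.eval, hN, List.sum_cons, List.sum_nil, add_zero]
  refine (runs_value ht subset_rfl (fun i hi => by simp [hs i hi, hi]) (hY _ subset_rfl)).mono ?_
  rintro t₁ s₁ ⟨ht₁, f₁, hr₁⟩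
  have hv₁ : (s.leave 5 s₁).var 3 = N := by simpa using hN
  rw [runs_seq, runs_putRat]
  simp only [NExp.eval, QExp.eval, hv₁, State.leave_rat, hr₁]
  set B := opt G k w (Finset.range N) with hB
  refine runs_for (N := N) (T := 1100 * (N + 1) ^ 4 + V * Y + 40) (fun i s' =>
    Frame (cells {2, 5, 6, 7, 8} 0) (cells {1, 2, 3} 0) s s' ∧ s'.var 3 = N ∧ s'.var 6 = i ∧
    s'.rat 3 0 = B ∧ ∃ Q ⊆ Finset.range N, Holds 2 0 N Q s' ∧ opt G k w Q = B ∧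
      ∀ p ∈ Q, p < i → opt G k w (Q.erase p) < B) ?_ ?_ ?_ ?_
  · refine ⟨Frame.setRat (s' := s.leave 5 s₁) (hmono f₁) (by simp [cells]) _, by simpa using hN,
      by simp, by simp, _, subset_rfl, fun i hi => ?_, rfl, by simp⟩
    have := f₁.1 2 i (by simp only [cells]; omega)
    simp [this, hs i hi, hi]
  · intro i s' h
    exact ⟨h.2.2.1, h.2.1⟩
  · rintro i s' hi ⟨f', v3, v6, hr, Q, hQN, hQ, hopt, hmin⟩
    have hE : Q.erase i ⊆ Finset.range N := (Finset.erase_subset _ _).trans hQN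
    rw [runs_seq, runs_put, runs_seq]
    simp only [NExp.eval, v6]
    have f₂ : Frame (cells {2, 5, 6, 7, 8} 0) (cells {1, 2, 3} 0) s (s'.setNat 2 i 0) :=
      f'.setNat (by simp [cells]) _
    have h2 : Holds 2 0 N (Q.erase i) (s'.setNat 2 i 0) := by simpa using hQ.erase i
    refine runs_call (body := valueBody) rfl ?_
    simp only [List.map_cons, List.map_nil, NExp.eval, State.setNat_var, v3, List.sum_cons,
      List.sum_nil, add_zero]
    refine (runs_value (ht.cells f₂ (by decide) (by decide)) hE h2 (hY _ hE)).mono ?_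
    rintro t₃ s₃ ⟨ht₃, f₃, hr₃⟩
    have hv : ∀ y, y ≠ 5 → ((s'.setNat 2 i 0).leave 5 s₃).var y = s'.var y := fun y hy => by
      simp [hy]
    have hr3 : s₃.rat 3 0 = B := (f₃.2 3 0 (by simp [cells])).trans hr
    have hQ₃ : Holds 2 0 N (Q.erase i) s₃ := h2.frame f₃ (.inr (by omega))
    have f₃' : Frame (cells {2, 5, 6, 7, 8} 0) (cells {1, 2, 3} 0) s s₃ := f₂.trans (hmono f₃)
    have hVE := hVQ _ hE
    simp only [runs_ite, runs_put, runs_skip, Test.eval, QExp.eval, NExp.eval, hv 3 (by decide),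
      hv 6 (by decide), v3, v6, State.leave_rat, hr₃, hr3]
    refine ⟨fun hlt => ⟨by simp; omega, by simpa using v6,
        Frame.setNat (s' := (s'.setNat 2 i 0).leave 5 s₃) f₃' (by simp [cells]) _,
        by simpa using v3, by simp, by simpa using hr3, Q, hQN, ?_, hopt, ?_⟩,
      fun hlt => ⟨by simp; omega, trivial, f₃', by simpa using v3, by simp, hr3,
        Q.erase i, hE, hQ₃, ?_, ?_⟩⟩
    · have hiQ : i ∈ Q := by
        by_contra h
        rw [Finset.erase_eq_of_notMem h, hopt] at hlt
        exact lt_irrefl _ hlt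
      have := Holds.insert (s := (s'.setNat 2 i 0).leave 5 s₃) hQ₃ i
      rw [Finset.insert_erase hiQ, zero_add] at this
      exact this
    · intro p hp hpi
      rcases Nat.lt_succ_iff_lt_or_eq.1 hpi with h | rfl
      · exact hmin p hp h
      · exact hlt
    · exact le_antisymm (opt_mono hE) (not_lt.1 hlt)
    · intro p hp hpi
      have hp' := Finset.mem_erase.1 hp
      refine (opt_mono (Finset.erase_subset_erase _ (Finset.erase_subset _ _))).trans_lt
        (hmin p hp'.2 (by omega))
  · rintro t s' ht' ⟨f', v3, -, -, Q, hQN, hQ, hopt, hmin⟩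
    refine hP _ ?_ s' f' v3 ⟨Q, hQN, hQ, hopt, fun p hp => hmin p hp (Finset.mem_range.1 (hQN hp))⟩
    have := hVQ _ (subset_refl (Finset.range N))
    simp at ht' ⊢
    nlinarith

theorem runs_output {P : ℕ → State → Prop} {Q : Finset ℕ} (ht : Tables G k n N w s)
    (hN : s.var 3 = N) (hQN : Q ⊆ Finset.range N) (hQ : Holds 2 0 N Q s) (hI : IsIndep G k Q)
    (h1 : ∀ v, s.nat 1 v = 0)
    (hP : ∀ t ≤ 40 * (N + 1), ∀ s', (∀ p ∈ Q, s'.nat 1 (p / k) = p % k + 1) →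
      (∀ v ∉ verts k Q, s'.nat 1 v = 0) → P t s') :
    Runs solver output s P := by
  refine runs_for (N := N) (T := 30) (fun i s' =>
    Frame (cells {1} 0) (cells ∅ 0) s s' ∧ s'.var 3 = N ∧ s'.var 6 = i ∧
    (∀ p ∈ Q, p < i → s'.nat 1 (p / k) = p % k + 1) ∧
    ∀ v, (∀ p ∈ Q, p < i → p / k ≠ v) → s'.nat 1 v = 0) ?_ ?_ ?_ ?_
  · refine ⟨Frame.refl _ _ s, ?_⟩
    simp [hN, h1]
  · intro i s' h
    exact ⟨h.2.2.1, h.2.1⟩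
  · rintro i s' hi ⟨f', v3, v6, hc, hz⟩
    have ht' := ht.cells f' (by decide) (by decide)
    have hpos := (hQ.frame f' (.inl (by decide))).pos_iff hi
    rw [zero_add] at hpos
    simp only [runs_ifPos, runs_put, runs_skip, NExp.eval, v6, hpos, ht'.vertex i hi,
      ht'.color i hi]
    refine ⟨fun hiQ => ?_, fun hiQ => ?_⟩
    · refine ⟨by simp, by simpa using v6, (f'.setNat (by simp [cells]) _).setVar _ _,
        by simpa using v3, by simp, fun p hp hpi => ?_, fun v hv => ?_⟩
      · by_cases hpe : p = i
        · simp [hpe]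
        · have hne : p / k ≠ i / k := fun h => hI p hp i hiQ hpe (.inl h)
          simpa [hne] using hc p hp (by omega)
      · have hne : v ≠ i / k := fun h => hv i hiQ (by omega) h.symm
        simpa [hne] using hz v fun p hp hpi => hv p hp (by omega)
    · refine ⟨by simp, trivial, f'.setVar _ _, by simpa using v3, by simp, fun p hp hpi => ?_,
        fun v hv => hz v fun p hp hpi => hv p hp (by omega)⟩
      rcases Nat.lt_succ_iff_lt_or_eq.1 hpi with h | rfl
      · exact hc p hp h
      · exact absurd hp hiQ
  · rintro t s' ht' ⟨f', v3, v6, hc, hz⟩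
    refine hP t (by simp at ht'; omega) s' (fun p hp => hc p hp (Finset.mem_range.1 (hQN hp)))
      fun v hv => hz v fun p hp _ h => hv (h ▸ Finset.mem_image_of_mem _ hp)

end RAM

/-- A set that cannot be made smaller without losing weight is itself a partial coloring. -/
theorem isIndep_of_minimal {G : SimpleGraph ℕ} {k : ℕ} {w : ℕ → ℚ≥0} {Q : Finset ℕ}
    (h : ∀ p ∈ Q, opt G k w (Q.erase p) < opt G k w Q) :
    IsIndep G k Q ∧ ∑ p ∈ Q, w p = opt G k w Q := by
  obtain ⟨I, hIQ, hI, hsum⟩ := exists_eq_opt G k w Q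
  have : I = Q := by
    refine Finset.Subset.antisymm hIQ fun p hp => ?_
    by_contra hpI
    refine (h p hp).not_ge ?_
    rw [← hsum]
    exact le_opt hI fun q hq => Finset.mem_erase.2 ⟨fun e => hpI (e ▸ hq), hIQ hq⟩
  subst this
  exact ⟨hI, hsum⟩

end Main

section Transfer

/-! ### From pairs to colorings -/

variable {n k : ℕ} {G : SimpleGraph (Fin n)}

/-- The graph `G`, as a graph on the natural numbers; the numbers from `n` on are isolated. -/
def natGraph (G : SimpleGraph (Fin n)) : SimpleGraph ℕ := G.map Fin.valEmbedding

theorem natGraph_adj {u v : ℕ} : (natGraph G).Adj u v ↔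
    ∃ a b : Fin n, G.Adj a b ∧ (a : ℕ) = u ∧ (b : ℕ) = v := SimpleGraph.map_adj _ _ _ _

theorem natGraph_adj_coe {a b : Fin n} : (natGraph G).Adj a b ↔ G.Adj a b :=
  SimpleGraph.map_adj_apply

theorem EndsDominate.natGraph (hG : EndsDominate G) : EndsDominate (natGraph G) := by
  intro a b c d hab hbc hcd hac hbd had x hx
  obtain ⟨a, b, -, rfl, rfl⟩ := natGraph_adj.1 hab
  obtain ⟨c, d, -, rfl, rfl⟩ := natGraph_adj.1 hcd
  obtain ⟨x, rfl⟩ : ∃ x' : Fin n, (x' : ℕ) = x := by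
    rcases hx with h | h <;> obtain ⟨x, -, -, rfl, -⟩ := natGraph_adj.1 h <;> exact ⟨x, rfl⟩
  simp only [natGraph_adj_coe, Fin.val_inj] at *
  exact hG hab hbc hcd hac hbd had hx

theorem natGraph_cliqueLE {D : Finset ℕ} (hD : D ⊆ Finset.range n) :
    CliqueLE (natGraph G) D G.cliqueNum := by
  intro K hK hKc
  have hKn : ∀ v ∈ K, v < n := fun v hv => Finset.mem_range.1 (hD (hK hv))
  have hcard : K.card = (K.attachFin hKn).card := (Finset.card_attachFin K hKn).symm
  rw [hcard]
  refine SimpleGraph.IsClique.card_le_cliqueNum (t := K.attachFin hKn) (tc := ?_)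
  intro a ha b hb hab
  rw [← natGraph_adj_coe]
  exact hKc (by simpa using ha) (by simpa using hb) (fun h => hab (Fin.ext h))

namespace PartialColoring

/-- The set of pairs that encodes a partial coloring. -/
def pairs (S : PartialColoring G k) : Finset ℕ :=
  S.X.attach.image fun v : {v // v ∈ S.X} => ((v : Fin n) : ℕ) * k + S.color ⟨v.1, v.2⟩

theorem pairs_subset (S : PartialColoring G k) : S.pairs ⊆ Finset.range (n * k) := by
  intro p hp
  obtain ⟨v, -, rfl⟩ := Finset.mem_image.1 hp
  have h1 := v.1.2
  have h2 := (S.color ⟨v.1, v.2⟩).2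
  have h3 : ((v : ℕ) + 1) * k ≤ n * k := Nat.mul_le_mul_right _ h1
  rw [add_mul] at h3
  exact Finset.mem_range.2 (by omega)

theorem isIndep_pairs (S : PartialColoring G k) : IsIndep (natGraph G) k S.pairs := by
  intro p hp q hq hpq hc
  obtain ⟨u, -, rfl⟩ := Finset.mem_image.1 hp
  obtain ⟨v, -, rfl⟩ := Finset.mem_image.1 hq
  have hu := (S.color ⟨u.1, u.2⟩).2
  have hv := (S.color ⟨v.1, v.2⟩).2
  simp only [Conflict, Clash, mul_add_div_of_lt hu, mul_add_div_of_lt hv, mul_add_mod_of_lt hu,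
    mul_add_mod_of_lt hv] at hc
  rcases hc with h | ⟨h1, h2⟩
  · have : u = v := Subtype.ext (Fin.ext h)
    subst this
    exact hpq rfl
  · exact S.color.valid (v := ⟨u.1, u.2⟩) (w := ⟨v.1, v.2⟩) (natGraph_adj_coe.1 h2) (Fin.ext h1)

theorem sum_pairs (S : PartialColoring G k) (rev : Fin n → Fin k → ℚ≥0) :
    ∑ p ∈ S.pairs, (inputState G rev).rat 0 p = S.revenue rev := by
  rw [pairs, Finset.sum_image, revenue]
  · refine Finset.sum_congr rfl fun v _ => ?_
    have hc := (S.color ⟨v.1, v.2⟩).2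
    have hlt : ((v : Fin n) : ℕ) * k + S.color ⟨v.1, v.2⟩ < n * k :=
      Finset.mem_range.1 (S.pairs_subset (Finset.mem_image_of_mem _ (Finset.mem_attach _ v)))
    rw [inputState]
    simp only [true_and, hlt, dif_pos]
    congr 1
    · exact Fin.ext (mul_add_div_of_lt hc)
    · exact Fin.ext (mul_add_mod_of_lt hc)
  · intro u _ v _ h
    have h1 := congrArg (· / k) h
    simp only [mul_add_div_of_lt (S.color ⟨u.1, u.2⟩).2,
      mul_add_div_of_lt (S.color ⟨v.1, v.2⟩).2] at h1
    exact Subtype.ext (Fin.ext h1)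

theorem exists_pairs_eq (hk : 0 < k) {Q : Finset ℕ} (hQ : Q ⊆ Finset.range (n * k))
    (hI : IsIndep (natGraph G) k Q) : ∃ S : PartialColoring G k, S.pairs = Q ∧
      (∀ v, v ∈ S.X ↔ (v : ℕ) ∈ verts k Q) ∧
      ∀ v (h : v ∈ S.X), (v : ℕ) * k + S.color ⟨v, h⟩ ∈ Q := by
  classical
  set X : Finset (Fin n) := Finset.univ.filter fun v => (v : ℕ) ∈ verts k Q with hX
  have hmem : ∀ v : (X : Set (Fin n)), ∃ p ∈ Q, p / k = v := fun v => by
    have := (Finset.mem_filter.1 (Finset.mem_coe.1 v.2)).2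
    simpa [verts] using this
  choose f hf hfv using hmem
  have hfe : ∀ v, f v = (v : ℕ) * k + f v % k := fun v => by
    rw [← hfv v]
    exact (Nat.div_add_mod' _ _).symm
  let c : (G.induce (X : Set (Fin n))).Coloring (Fin k) :=
    SimpleGraph.Coloring.mk (fun v => ⟨f v % k, Nat.mod_lt _ hk⟩) (by
      intro u v huv h
      have h1 : f u % k = f v % k := congrArg Fin.val h
      have h2 : (natGraph G).Adj (f u / k) (f v / k) := by
        rw [hfv, hfv]
        exact natGraph_adj_coe.2 huv
      refine hI _ (hf u) _ (hf v) (fun e => h2.ne (by rw [e])) (.inr ⟨h1, h2⟩))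
  have hc : ∀ (v : Fin n) h, (v : ℕ) * k + c ⟨v, h⟩ = f ⟨v, h⟩ := fun v h => (hfe ⟨v, h⟩).symm
  refine ⟨⟨X, c⟩, ?_, fun v => by simp [hX], fun v h => ?_⟩
  · ext p
    rw [pairs, Finset.mem_image]
    constructor
    · rintro ⟨v, -, rfl⟩
      rw [hc]
      exact hf _
    · intro hp
      have hpn : p / k < n := (Nat.div_lt_iff_lt_mul hk).2 (Finset.mem_range.1 (hQ hp))
      have hpX : (⟨p / k, hpn⟩ : Fin n) ∈ X := Finset.mem_filter.2
        ⟨Finset.mem_univ _, Finset.mem_image_of_mem _ hp⟩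
      refine ⟨⟨_, hpX⟩, Finset.mem_attach _ _, ?_⟩
      rw [hc]
      by_contra hne
      exact hI _ (hf ⟨_, hpX⟩) p hp hne (.inl (hfv _))
  · rw [hc]
    exact hf _

end PartialColoring

/-- The sum of the bounds for the three parts of the main program is at most `max n 2 ^ (60 k ω)`:
with `b = max n 2` one has `k + 1 ≤ b ^ k` and `2 ^ L ≤ b ^ 2`, so each factor is a power of `b`
whose exponent is `O(k ω)`. -/
theorem steps_le_pow {n k ω L : ℕ} (hk : 1 ≤ k) (hω : 1 ≤ ω) (hL : 2 ^ L ≤ 2 * max n 2) :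
    200 * ((n + 1) * (k + 1)) + ((n * k + 2) * (1100 * (n * k + 1) ^ 4 + n *
      (6000 * (n * k + 1) ^ 6 * (8 * 2 ^ (2 * k * ω)) ^ L * (8 * (n + 1) ^ (3 * k)) ^ ω) + 50)) +
      40 * (n * k + 1) ≤ max n 2 ^ (60 * k * ω) := by
  set b := max n 2 with hb
  have hb2 : 2 ≤ b := le_max_right _ _
  have hnb : n ≤ b := le_max_left _ _
  have hb0 : 1 ≤ b := by omega
  have hn1 : n + 1 ≤ b ^ 2 := by nlinarith
  have hk1 : k + 1 ≤ b ^ k := (Nat.lt_pow_self (by omega : 1 < b))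
  set M := b ^ (k + 2) with hM
  have hM' : (n + 1) * (k + 1) ≤ M := by
    rw [hM, pow_add, mul_comm]
    exact Nat.mul_le_mul hk1 hn1
  have hN : n * k + 1 ≤ M := le_trans (by nlinarith) hM'
  have hM1 : 1 ≤ M := Nat.one_le_pow _ _ hb0
  set E := (8 * 2 ^ (2 * k * ω)) ^ L * (8 * (n + 1) ^ (3 * k)) ^ ω with hE
  have hE1 : 1 ≤ E := Nat.one_le_iff_ne_zero.2 (by positivity)
  have hEb : E ≤ b ^ (6 + 4 * k * ω + (3 + 6 * k) * ω) := by
    rw [hE, pow_add]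
    refine Nat.mul_le_mul ?_ ?_
    · have h1 : (8 * 2 ^ (2 * k * ω)) ^ L = (2 ^ L) ^ (3 + 2 * k * ω) := by
        rw [show (8 : ℕ) = 2 ^ 3 by norm_num, ← pow_add, ← pow_mul, ← pow_mul, mul_comm]
      have h2 : 2 ^ L ≤ b ^ 2 := hL.trans (by nlinarith)
      rw [h1]
      refine (Nat.pow_le_pow_left h2 _).trans ?_
      rw [← pow_mul]
      exact Nat.pow_le_pow_right hb0 (le_of_eq (by ring))
    · have h1 : 8 * (n + 1) ^ (3 * k) ≤ b ^ (3 + 6 * k) := by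
        rw [pow_add]
        refine Nat.mul_le_mul ?_ ?_
        · calc (8 : ℕ) = 2 ^ 3 := by norm_num
            _ ≤ b ^ 3 := Nat.pow_le_pow_left hb2 3
        · refine (Nat.pow_le_pow_left hn1 _).trans ?_
          rw [← pow_mul]
          exact Nat.pow_le_pow_right hb0 (le_of_eq (by ring))
      refine (Nat.pow_le_pow_left h1 _).trans ?_
      rw [← pow_mul]
  have hbM : b ≤ M := Nat.le_self_pow (by omega) _
  calc 200 * ((n + 1) * (k + 1)) + ((n * k + 2) * (1100 * (n * k + 1) ^ 4 + n *
      (6000 * (n * k + 1) ^ 6 * (8 * 2 ^ (2 * k * ω)) ^ L * (8 * (n + 1) ^ (3 * k)) ^ ω) + 50)) +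
      40 * (n * k + 1)
      ≤ 200 * M + ((2 * M) * (1100 * M ^ 4 + b * (6000 * M ^ 6 * E) + 50)) + 40 * M := by
        rw [mul_assoc (6000 * (n * k + 1) ^ 6), ← hE]
        gcongr
        omega
    _ ≤ 2 ^ 14 * (M ^ 7 * (b * E)) := by
        have hM7 : M ≤ M ^ 7 := Nat.le_self_pow (by decide) _
        have hM5 : M * M ^ 4 ≤ M ^ 7 := by
          rw [← pow_succ']
          exact Nat.pow_le_pow_right hM1 (by decide)
        have e7 : M * M ^ 6 = M ^ 7 := by ring
        have hbE : 1 ≤ b * E := Nat.one_le_iff_ne_zero.2 (by positivity)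
        have h7 : M ^ 7 ≤ M ^ 7 * (b * E) := Nat.le_mul_of_pos_right _ hbE
        have e : 200 * M + ((2 * M) * (1100 * M ^ 4 + b * (6000 * M ^ 6 * E) + 50)) + 40 * M =
            340 * M + 2200 * (M * M ^ 4) + 12000 * (M * M ^ 6 * (b * E)) := by ring
        rw [e, e7]
        norm_num
        linarith
    _ ≤ b ^ 14 * (b ^ ((k + 2) * 7) * (b * b ^ (6 + 4 * k * ω + (3 + 6 * k) * ω))) := by
        rw [hM, ← pow_mul]
        gcongr
    _ = b ^ (14 + ((k + 2) * 7 + (1 + (6 + 4 * k * ω + (3 + 6 * k) * ω)))) := by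
        ring
    _ ≤ b ^ (60 * k * ω) := by
        refine Nat.pow_le_pow_right hb0 ?_
        have h1 : k ≤ k * ω := Nat.le_mul_of_pos_right _ hω
        have h2 : ω ≤ k * ω := Nat.le_mul_of_pos_left _ hk
        nlinarith

end Transfer

section Solution

/-! ### The solution that is found -/

variable {n k : ℕ} {G : SimpleGraph (Fin n)}

open RAM

theorem verts_subset_range (hk : 0 < k) {Q : Finset ℕ} (hQ : Q ⊆ Finset.range (n * k)) :
    verts k Q ⊆ Finset.range n := by
  intro v hv
  obtain ⟨p, hp, rfl⟩ := Finset.mem_image.1 hv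
  exact Finset.mem_range.2 ((Nat.div_lt_iff_lt_mul hk).2 (Finset.mem_range.1 (hQ hp)))

/-- After `prepare`, the memory represents the graph and the revenues. The cells `u * n + v` with
`u, v < n` determine `u` and `v`, so no entry of the adjacency matrix is read wrongly. -/
theorem tables_of_frame (hk : 0 < k) {rev : Fin n → Fin k → ℚ≥0} {s : State}
    (hs : Frame (cells {2, 9, 10, 11} 0) (cells ∅ 0) (inputState G rev) s)
    (hrow : ∀ v < n, s.nat 11 v = v * n)
    (hpair : ∀ p < n * k, s.nat 9 p = p / k ∧ s.nat 10 p = p % k ∧ s.nat 2 p = 1) :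
    Tables (natGraph G) k n (n * k) ((inputState G rev).rat 0) s where
  lt p hp := (Nat.div_lt_iff_lt_mul hk).2 hp
  vertex p hp := (hpair p hp).1
  color p hp := (hpair p hp).2.1
  row := hrow
  adj u hu v hv := by
    have e : s.nat 0 (u * n + v) = (inputState G rev).nat 0 (u * n + v) :=
      hs.1 _ _ (by simp [cells])
    rw [e, inputState, natGraph_adj]
    refine ⟨?_, fun h => if_neg ?_⟩
    · rintro ⟨a, b, hab, rfl, rfl⟩
      exact if_pos ⟨rfl, a, b, rfl, hab⟩
    · rintro ⟨-, a, b, hab, hadj⟩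
      refine h ⟨a, b, hadj, ?_, ?_⟩
      · rw [← mul_add_div_of_lt (v := (a : ℕ)) b.2, ← hab, mul_add_div_of_lt hv]
      · rw [← mul_add_mod_of_lt (v := (a : ℕ)) b.2, ← hab, mul_add_mod_of_lt hv]
  weight p _ := hs.2 _ _ (by simp [cells])

theorem exists_pow_bounds (n : ℕ) : ∃ L, n < 2 ^ L ∧ 2 ^ L ≤ 2 * max n 2 := by
  rcases Nat.eq_zero_or_pos n with rfl | hn
  · -- without vertices, `n < 2 ^ 0`
    exact ⟨0, by simp⟩
  · refine ⟨Nat.log 2 n + 1, Nat.lt_pow_succ_log_self one_lt_two n, ?_⟩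
    have := Nat.pow_log_le_self 2 hn.ne'
    have := le_max_left n 2
    rw [pow_succ]
    omega

/-- If a set of pairs is a partial coloring whose weight is the optimum, then it encodes an
optimum solution. -/
theorem exists_isOptimal (hk : 0 < k) (rev : Fin n → Fin k → ℚ≥0) {Q : Finset ℕ}
    (hQ : Q ⊆ Finset.range (n * k)) (hI : IsIndep (natGraph G) k Q)
    (hw : ∑ p ∈ Q, (inputState G rev).rat 0 p =
      opt (natGraph G) k ((inputState G rev).rat 0) (Finset.range (n * k)))
    {s : State} (hin : ∀ p ∈ Q, s.nat 1 (p / k) = p % k + 1)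
    (hout : ∀ v ∉ verts k Q, s.nat 1 v = 0) :
    ∃ S : PartialColoring G k, S.IsOptimal rev ∧ IsOutput s S := by
  obtain ⟨S, hS, hX, hc⟩ := PartialColoring.exists_pairs_eq hk hQ hI
  refine ⟨S, fun S' => ?_, fun v => ⟨fun hv => hout _ fun h => hv ((hX v).2 h), fun hv => ?_⟩⟩
  · rw [← S'.sum_pairs rev, ← S.sum_pairs rev, hS, hw]
    exact le_opt S'.isIndep_pairs S'.pairs_subset
  · have hlt := (S.color ⟨v, hv⟩).2
    have := hin _ (hc v hv)
    rwa [mul_add_div_of_lt hlt, mul_add_mod_of_lt hlt] at this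

/-- The program for `k` colors is correct and has the required running time. The exponent `60` comes
from `steps_le_pow`. -/
theorem runs_partialColoringProgram (hk : 1 ≤ k) (hG : EndsDominate G)
    (rev : Fin n → Fin k → ℚ≥0) :
    Runs (partialColoringProgram k).procs (partialColoringProgram k).main (inputState G rev)
      fun t s => t ≤ max n 2 ^ (60 * k * max G.cliqueNum 1) ∧
        ∃ S : PartialColoring G k, S.IsOptimal rev ∧ IsOutput s S := by
  obtain ⟨L, hnL, hL⟩ := exists_pow_bounds n
  have hω : 1 ≤ max G.cliqueNum 1 := le_max_right _ _
  have hωG : G.cliqueNum ≤ max G.cliqueNum 1 := le_max_left _ _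
  generalize max G.cliqueNum 1 = ω at hω hωG ⊢
  have htime := steps_le_pow hk hω hL
  have hv : ∀ {Q : Finset ℕ}, Q ⊆ Finset.range (n * k) → (verts k Q).card ≤ n := fun hQ => by
    simpa using Finset.card_le_card (verts_subset_range hk hQ)
  rw [partialColoringProgram, runs_seq]
  refine runs_prepare (n := n) (by simp [inputState]) fun t₁ ht₁ s₁ f₁ h3 hrow hpair => ?_
  have ht := tables_of_frame hk f₁ hrow hpair
  rw [runs_seq]
  refine runs_shrink ht h3 (fun p hp => (hpair p hp).2.2)
    (Y := 6000 * (n * k + 1) ^ 6 * (8 * 2 ^ (2 * k * ω)) ^ L * (8 * (n + 1) ^ (3 * k)) ^ ω)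
    ?_ (hv subset_rfl) fun t₂ ht₂ s₂ f₂ h3' => ?_
  · intro Q hQ C hCQ hC0 hC _
    have hCN := hCQ.trans hQ
    exact solves_of_cliqueLE hG.natGraph hk _ C L ω rfl ((hv hCN).trans_lt hnL)
      (fun K hK hKc => (natGraph_cliqueLE (verts_subset_range hk hCN) K hK hKc).trans
        hωG) le_rfl hC0 hC hCN
  rintro ⟨Q, hQN, hQ, hopt, hmin⟩
  obtain ⟨hI, hsum⟩ := isIndep_of_minimal fun p hp => (hmin p hp).trans_eq hopt.symm
  refine runs_output (ht.cells f₂ (by decide) (by decide)) h3' hQN hQ hI (fun v => ?_)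
    fun t₃ ht₃ s₃ hin hout => ?_
  · rw [f₂.1 1 v (by simp [cells]), f₁.1 1 v (by simp [cells])]
    simp [inputState]
  · exact ⟨by omega, exists_isOptimal hk rev hQN hI (hsum.trans hopt) hin hout⟩

end Solution

theorem theorem1 :
    ∃ τ : ℕ, ∀ k : ℕ, 1 ≤ k → ∃ P : RAM.Program,
      ∀ (n : ℕ) (G : SimpleGraph (Fin n)) (rev : Fin n → Fin k → ℚ≥0),
        ¬ bull ⊴ G → ¬ chair ⊴ G →
          ∃ (t : ℕ) (s : RAM.State), P.Run (inputState G rev) t s ∧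
            t ≤ max n 2 ^ (τ * k * max G.cliqueNum 1) ∧
            ∃ S : PartialColoring G k, S.IsOptimal rev ∧ IsOutput s S := by
  refine ⟨60, fun k hk => ⟨RAM.partialColoringProgram k, fun n G rev hb hc => ?_⟩⟩
  exact runs_partialColoringProgram hk (endsDominate_of_free hb hc) rev
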